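/- **Conventions.** Let $\eta_{\alpha\beta}=\mathrm{diag}(1,-1,-1,-1,-1)$ on $\mathbb R^5$ ($\alpha,\beta=0,\dots,4$) and let $\mathrm{dS}=\{x\in\mathbb R^5 : x_\alpha x^\alpha=-1\}$ be de Sitter space ($H=1$). Put $\theta_{\alpha\beta}=\eta_{\alpha\beta}+x_\alpha x_\beta$ and $\bar\partial_\alpha=\partial_\alpha+x_\alpha\,(x\cdot\partial)$ (tangential derivative). For an expression with free indices $\alpha,\beta$, the symbol $S$ adds the same expression with $\alpha$ and $\beta$ exchanged. For scalars $\phi$, covectors $V$ and symmetric tensors $K$ on (an open part of) $\mathrm{dS}$, given by ambient components, let $$Q_0=-\bar\partial_\alpha\bar\partial^\alpha\ \bigl(=-\tfrac12 M_{\alpha\beta}M^{\alpha\beta},\ M_{\alpha\beta}=i(x_\alpha\partial_\beta-x_\beta\partial_\alpha)\bigr),\qquad (D_1\phi)_\alpha=\bar\partial_\alpha\phi,\qquad (D_2V)_{\alpha\beta}=S(\bar\partial_\alpha-x_\alpha)V_\beta,$$ $$(\bar\partial\cdot K)_\beta=\bar\partial^\alpha K_{\alpha\beta},\qquad \bar\partial\cdot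 V=\bar\partial^\alpha V_\alpha,\qquad K'=\eta^{\alpha\beta}K_{\alpha\beta},\qquad (x\cdot K)_\beta=x^\alpha K_{\alpha\beta},$$ $$(Q_2+6)K_{\alpha\beta}=Q_0K_{\alpha\beta}+2S\,x_\alpha(\bar\partial\cdot K)_\beta+2\eta_{\alpha\beta}K'-2S\,\bar\partial_\alpha(x\cdot K)_\beta .$$ On $\mathbb R^6$ with coordinates $u^A$, $A=0,\dots,5$, use the metric $\mathrm{diag}(1,-1,-1,-1,-1,1)$, let $N_5=u^A\partial_A$, and let $\mathcal C=\{u\ne0: u_Au^A=0\}$ be the six-cone. It is related to $\mathrm{dS}$ by $x^\alpha=u^\alpha/u^5$; a point $x$ lies on $\mathrm{dS}$ iff $(x,1)\in\mathcal C$. **Part 1 (the equation).** Let $U\subset\mathbb R^6$ be open and let $\psi_{AB}$ be a smooth symmetric tensor field on $U$ which satisfies Dirac's six-cone system of conformal degree $p=2$, $$N_5\psi_{AB}=0\ \text{ on } U,\qquad (\partial_C\partial^C)^2\psi_{AB}=0\ \text{ on } U\cap\mathcal C,$$ and is transverse and traceless there: $u^A\psi_{AB}=0$ and $\psi_A{}^A=0$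 on $U\cap\mathcal C$. Then, with $\psi_{AB}$ evaluated at $(x,1)$, the tensor field $$k_{\alpha\beta}=\psi_{\alpha\beta}+S\,x_\beta\,\psi_{\alpha\gamma}x^\gamma+x_\alpha x_\beta\,x^\gamma\psi_{\gamma\delta}x^\delta$$ is smooth, and at every $x\in \mathrm{dS}$ with $(x,1)\in U$ it is symmetric, transverse ($x\cdot k=0$) and traceless ($k'=0$), and satisfies $$(Q_2+4)\bigl[(Q_2+6)k+D_2\,\bar\partial\cdot k\bigr]_{\alpha\beta}+\tfrac13\bigl(D_2D_1\,\bar\partial\cdot\bar\partial\cdot k\bigr)_{\alpha\beta}-\tfrac13\,\theta_{\alpha\beta}\,(Q_0+6)\,\bar\partial\cdot\bar\partial\cdot k=0.\qquad(*)$$ **Part 2 (conformal invariance).** The equation $(*)$ for smooth symmetric transverse traceless tensor fields $k$ is invariant under the conformal group $O(2,4)$. For $M\in O(2,4)$ let $\varphi(x)$ be the point of $\mathrm{dS}$ with $M(x,1)=\lambda\,(\varphi(x),1)$, defined where $\lambda=\lambda(x)=(M(x,1))^5\neq0$; it is a conformal map, $\varphi^*g=\lambda^{-2}g$ for the induced metric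 $g$. If $k$ is a smooth symmetric transverse traceless solution of $(*)$ on the part of $\mathrm{dS}$ in an open set $V\subset\mathbb R^5$, then $\lambda^{2}\,\varphi^*k$ is such a solution on the part of $\mathrm{dS}$ where $\lambda\ne0$ and $\varphi(x)\in V$. In ambient components, $\lambda^2\varphi^*k$ is the tensor built by the formula for $k_{\alpha\beta}$ in Part 1 from $\psi_{AB}(u)=M^{\gamma}{}_{A}M^{\delta}{}_{B}\,k_{\gamma\delta}(y)$, where $\gamma,\delta$ are summed over $0,\dots,4$ and $y^\alpha=(Mu)^\alpha/(Mu)^5$. -/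

import Mathlib

open scoped ContDiff

noncomputable section

namespace SixCone

/-- The diagonal of the ambient metric of de Sitter space, `diag(1,-1,-1,-1,-1)`. -/
def eta5 : Fin 5 → ℝ := ![1, -1, -1, -1, -1]

/-- The diagonal of the metric of the six-cone, `diag(1,-1,-1,-1,-1,1)`. -/
def eta6 : Fin 6 → ℝ := ![1, -1, -1, -1, -1, 1]

/-- The partial derivative of a function on `ℝⁿ` in the `i`-th coordinate. -/
def pderiv {n : ℕ} (i : Fin n) (f : (Fin n → ℝ) → ℝ) : (Fin n → ℝ) → ℝ :=
  fun x => fderiv ℝ f x (Pi.single i 1)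

/-! ### The ambient-space calculus of de Sitter space (`H = 1`)

Fields on (an open part of) the hyperboloid are represented by functions of the ambient coordinates
defined near it, and are only ever evaluated on it. A vector or tensor field is the family of its
components with lower indices. -/

/-- Scalar fields in ambient coordinates. -/
abbrev Scalar := (Fin 5 → ℝ) → ℝ

/-- Covector fields in ambient coordinates. -/
abbrev Covector := Fin 5 → Scalar

/-- Covariant tensor fields of rank two in ambient coordinates. -/
abbrev Tensor2 := Fin 5 → Fin 5 → Scalar

/-- The de Sitter hyperboloid `x_α x^α = -1`. -/
def deSitter : Set (Fin 5 → ℝ) := {x | ∑ α, eta5 α * x α ^ 2 = -1}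

/-- The coordinate with lower index, `x_α = η_{αβ} x^β`. -/
def low (α : Fin 5) (x : Fin 5 → ℝ) : ℝ := eta5 α * x α

/-- The components `η_{αβ}`. -/
def etaLow (α β : Fin 5) : ℝ := if α = β then eta5 α else 0

/-- The transverse projector `θ_{αβ} = η_{αβ} + x_α x_β`. -/
def theta (α β : Fin 5) : Scalar := fun x => etaLow α β + low α x * low β x

/-- The tangential derivative `∂̄_α = ∂_α + x_α (x·∂)`. On the hyperboloid its value depends on the
restriction of the function to the hyperboloid only. -/
def dbar (α : Fin 5) (f : Scalar) : Scalar :=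
  fun x => pderiv α f x + low α x * ∑ β, x β * pderiv β f x

/-- The scalar Casimir operator `Q₀ = -∂̄_α ∂̄^α`, which on the hyperboloid is
`-(1/2) M_{αβ} M^{αβ}` with `M_{αβ} = i (x_α ∂_β - x_β ∂_α)`. -/
def Q0 (f : Scalar) : Scalar := fun x => -∑ α, eta5 α * dbar α (dbar α f) x

/-- The divergence `∂̄·V = ∂̄^α V_α`. -/
def divV (V : Covector) : Scalar := fun x => ∑ α, eta5 α * dbar α (V α) x

/-- The divergence `(∂̄·K)_β = ∂̄^α K_{αβ}`. -/
def divT (K : Tensor2) : Covector := fun β x => ∑ α, eta5 α * dbar α (K α β) x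

/-- The contraction `(x·K)_β = x^α K_{αβ}`. -/
def xdot (K : Tensor2) : Covector := fun β x => ∑ α, x α * K α β x

/-- The trace `K' = η^{αβ} K_{αβ}`. -/
def trace (K : Tensor2) : Scalar := fun x => ∑ α, eta5 α * K α α x

/-- The rank-two Casimir operator,
`(Q₂ + 6) K = Q₀ K + 2 S x_α (∂̄·K)_β + 2 η_{αβ} K' - 2 S ∂̄_α (x·K)_β`, where `S` adds the term with
`α` and `β` exchanged. -/
def Q2 (K : Tensor2) : Tensor2 := fun α β x =>
  Q0 (K α β) x - 6 * K α β x
    + 2 * (low α x * divT K β x + low β x * divT K α x)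
    + 2 * etaLow α β * trace K x
    - 2 * (dbar α (xdot K β) x + dbar β (xdot K α) x)

/-- `D₁ φ = ∂̄ φ`. -/
def D1 (f : Scalar) : Covector := fun α => dbar α f

/-- `(D₂ V)_{αβ} = S (∂̄_α - x_α) V_β`. -/
def D2 (V : Covector) : Tensor2 := fun α β x =>
  (dbar α (V β) x - low α x * V β x) + (dbar β (V α) x - low β x * V α x)

/-- The tensor `(Q₂ + 6) k + D₂ ∂̄·k`. -/
def innerPart (k : Tensor2) : Tensor2 := fun α β x =>
  Q2 k α β x + 6 * k α β x + D2 (divT k) α β x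

/-- The left-hand side
`(Q₂ + 4)[(Q₂ + 6) k + D₂ ∂̄·k] + (1/3) D₂ D₁ ∂̄·∂̄·k - (1/3) θ (Q₀ + 6) ∂̄·∂̄·k`. -/
def conformalOperator (k : Tensor2) : Tensor2 := fun α β x =>
  (Q2 (innerPart k) α β x + 4 * innerPart k α β x)
    + (1 / 3) * D2 (D1 (divV (divT k))) α β x
    - (1 / 3) * theta α β x * (Q0 (divV (divT k)) x + 6 * divV (divT k) x)

/-- `k` is a smooth symmetric, transverse and traceless tensor field on the part of de Sitter space
in the open set `V`, and satisfies the fourth-order equation there. -/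
structure IsConformalField (V : Set (Fin 5 → ℝ)) (k : Tensor2) : Prop where
  smooth : ∀ α β, ContDiffOn ℝ ∞ (k α β) V
  symm : ∀ x ∈ V ∩ deSitter, ∀ α β, k α β x = k β α x
  transverse : ∀ x ∈ V ∩ deSitter, ∀ β, xdot k β x = 0
  traceless : ∀ x ∈ V ∩ deSitter, trace k x = 0
  equation : ∀ x ∈ V ∩ deSitter, ∀ α β, conformalOperator k α β x = 0

/-! ### The six-cone -/

/-- Covariant tensor fields of rank two on six-dimensional space. -/
abbrev SixTensor := Fin 6 → Fin 6 → (Fin 6 → ℝ) → ℝ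

/-- The cone `u_A u^A = 0` without its vertex. -/
def cone : Set (Fin 6 → ℝ) := {u | u ≠ 0 ∧ ∑ A, eta6 A * u A ^ 2 = 0}

/-- The wave operator `∂_A ∂^A`. -/
def box (f : (Fin 6 → ℝ) → ℝ) : (Fin 6 → ℝ) → ℝ :=
  fun u => ∑ A, eta6 A * pderiv A (pderiv A f) u

/-- The conformal degree operator `N₅ = u^A ∂_A`. -/
def N5 (f : (Fin 6 → ℝ) → ℝ) : (Fin 6 → ℝ) → ℝ := fun u => ∑ A, u A * pderiv A f u

/-- Dirac's system of conformal degree `p = 2` for a smooth symmetric tensor field `ψ_{AB}` that is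
transverse and traceless on the cone. The field is defined on an open set `U`; the conditions other
than homogeneity are required on the cone only. -/
structure DiracSystem (U : Set (Fin 6 → ℝ)) (ψ : SixTensor) : Prop where
  smooth : ∀ A B, ContDiffOn ℝ ∞ (ψ A B) U
  symm : ∀ u ∈ U, ∀ A B, ψ A B u = ψ B A u
  degree : ∀ u ∈ U, ∀ A B, N5 (ψ A B) u = 0
  wave : ∀ u ∈ U ∩ cone, ∀ A B, box (box (ψ A B)) u = 0
  transverse : ∀ u ∈ U ∩ cone, ∀ B, ∑ A, u A * ψ A B u = 0
  traceless : ∀ u ∈ U ∩ cone, ∑ A, eta6 A * ψ A A u = 0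

/-- The point `(x, 1)`, which lies on the cone exactly when `x` lies on the hyperboloid. -/
def toCone (x : Fin 5 → ℝ) : Fin 6 → ℝ := Fin.snoc x 1

/-- The ambient coordinates `x^α = u^α / u^5`. -/
def ofCone (u : Fin 6 → ℝ) : Fin 5 → ℝ := fun α => u α.castSucc / u (Fin.last 5)

/-- `k_{αβ} = ψ_{αβ} + S x_β ψ_α·x + x_α x_β x·ψ·x`. -/
def ambientTensor (ψ : SixTensor) : Tensor2 := fun α β x =>
  ψ α.castSucc β.castSucc (toCone x)
    + (low β x * ∑ γ, ψ α.castSucc γ.castSucc (toCone x) * x γ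
      + low α x * ∑ γ, ψ β.castSucc γ.castSucc (toCone x) * x γ)
    + low α x * low β x *
      ∑ γ, ∑ δ, x γ * ψ γ.castSucc δ.castSucc (toCone x) * x δ

/-! ### The action of the conformal group -/

/-- The matrix `M` preserves the metric of the six-cone: `M ∈ O(2,4)`. -/
def IsConformal (M : Matrix (Fin 6) (Fin 6) ℝ) : Prop :=
  M.transpose * Matrix.diagonal eta6 * M = Matrix.diagonal eta6

/-- The (partially defined) conformal map of de Sitter space induced by a linear map that preserves
the cone. -/
def conformalMap (M : Matrix (Fin 6) (Fin 6) ℝ) (x : Fin 5 → ℝ) : Fin 5 → ℝ :=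
  ofCone (M.mulVec (toCone x))

/-- The points at which `conformalMap M` is defined, with value in `V`. -/
def conformalDomain (M : Matrix (Fin 6) (Fin 6) ℝ) (V : Set (Fin 5 → ℝ)) : Set (Fin 5 → ℝ) :=
  {x | M.mulVec (toCone x) (Fin.last 5) ≠ 0 ∧ conformalMap M x ∈ V}

/-- The conformal transform of `k`: regard `k` as the tensor field of degree `0` on the cone with
components `ψ_{αβ}(u) = k_{αβ}(u^α / u^5)`, `ψ_{α5} = ψ_{55} = 0`, pull it back by the linear map `M`,
and return to de Sitter space by `ambientTensor`. For transverse `k` this is `Ω⁻² φ^* k`, where `φ` is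
`conformalMap M` and `Ω` is its conformal factor, `φ^* g = Ω² g`. -/
def conformalTransform (M : Matrix (Fin 6) (Fin 6) ℝ) (k : Tensor2) : Tensor2 :=
  ambientTensor fun A B u =>
    ∑ γ : Fin 5, ∑ δ : Fin 5,
      M γ.castSucc A * M δ.castSucc B * k γ δ (ofCone (M.mulVec u))

end SixCone

end

noncomputable section

namespace SixCone

open TopologicalSpace Set

/-! ### Smooth functions of a point and an auxiliary vector -/

/-! A symmetric tensor is encoded as the quadratic form f(u, z) = ψ_{AB}(u) z^A z^B in an auxiliary
vector z. The invariant operators on such functions are the metric contractions of pairs taken from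
u, z, ∂_u, ∂_z. They close under commutators into a copy of sp(4), up to additive constants, so
tensor calculus becomes rewriting with a fixed list of commutation relations (`ctr_comm`).

A field on de Sitter space is extended homogeneously to the cone over it. Let κ be the degree-zero
extension of a transverse traceless k. Since ∂̄ is tangential, the equation can be evaluated on κ,
where the lower-order terms cancel and leave bach κ + (1/6) θ □DDκ = 0 with bach = □² − GD□ +
(1/3)G²D². The second term only removes a trace, so the equation says that bach κ is a multiple of θ
at each point (`IsHomTT.conformalOperator_eq_zero_iff`, `bach_add_trace_eq_zero`).

Let π be the projection to five dimensions. Near a point of the six-cone, a degree-zero F that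
agrees with ψ on the section (x, 1) has the form F = π*κ + 2X π*ξ + X² π*σ + Qχ, where ξ, σ, χ have
degrees −1, −2, −2. This is Hadamard division by u·u (`exists_eq_Q`, `exists_decomposition`).

Dirac's system: degree −2 is critical in dimension six, so □²Qχ is again a multiple of u·u. The
vanishing of □²F on the cone then splits by powers of z^5 into three equations for κ, ξ, σ.
Contracting the equation for κ with u expresses D□κ and DDκ through ξ and σ, after which bach κ
collapses to a multiple of θ (`bach_eq_of_wave`).

Invariance: now F is the pull-back of κ by π∘M. This map preserves inverse metrics, so F is
transverse and traceless off the cone as well, and bach F is the pull-back of bach κ. If κ' extends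
the transformed tensor, F − π*κ' must have the gauge form Qχ − XIχ + (1/2)X²Tχ (`remainder_eq`), and
in dimension six bach sends this to Xa + Qb + Zc with c independent of z (`bach_gauge`). On the cone
and for z orthogonal to u, the two values of bach therefore differ by a multiple of z·z. Under the
orthogonal lift of tangent vectors z·z is θ at the source and at the image, so proportionality to θ
is transported. -/

/-- A point together with an auxiliary vector, used to contract the indices of tensors. -/
abbrev Pt (n : ℕ) := (Fin n → ℝ) × (Fin n → ℝ)

/-- The functions of a point of `Ω` and a vector which are smooth, extended by zero. -/
def Fld {n : ℕ} (Ω : Opens (Fin n → ℝ)) : Submodule ℝ (Pt n → ℝ) where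
  carrier := {f | ContDiffOn ℝ ∞ f ((Ω : Set (Fin n → ℝ)) ×ˢ univ) ∧ ∀ p : Pt n, p.1 ∉ Ω → f p = 0}
  add_mem' := fun {f g} hf hg => ⟨hf.1.add hg.1, fun p hp => by simp [hf.2 p hp, hg.2 p hp]⟩
  zero_mem' := ⟨contDiffOn_const, fun _ _ => rfl⟩
  smul_mem' := fun c f hf => ⟨contDiffOn_const.smul hf.1, fun p hp => by simp [hf.2 p hp]⟩

namespace Fld

variable {n : ℕ} {Ω : Opens (Fin n → ℝ)}

instance : CoeFun (Fld Ω) (fun _ => Pt n → ℝ) := ⟨fun f => f.1⟩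

theorem isOpen_domain (Ω : Opens (Fin n → ℝ)) :
    IsOpen ((Ω : Set (Fin n → ℝ)) ×ˢ (univ : Set (Fin n → ℝ))) := Ω.2.prod isOpen_univ

theorem domain_mem_nhds {p : Pt n} (hp : p.1 ∈ Ω) :
    (Ω : Set (Fin n → ℝ)) ×ˢ (univ : Set (Fin n → ℝ)) ∈ nhds p :=
  (isOpen_domain Ω).mem_nhds ⟨hp, trivial⟩

/-- Extension by zero makes the values over Ω determine the element, so operator identities are
honest equalities in a module. -/
theorem ext_on {f g : Fld Ω} (h : ∀ p : Pt n, p.1 ∈ Ω → f p = g p) : f = g := by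
  apply Subtype.ext
  funext p
  by_cases hp : p.1 ∈ Ω
  · exact h p hp
  · rw [f.2.2 p hp, g.2.2 p hp]

theorem contDiffAt (f : Fld Ω) {p : Pt n} (hp : p.1 ∈ Ω) : ContDiffAt ℝ ∞ f p :=
  (f.2.1 p ⟨hp, trivial⟩).contDiffAt (domain_mem_nhds hp)

theorem differentiableAt (f : Fld Ω) {p : Pt n} (hp : p.1 ∈ Ω) : DifferentiableAt ℝ f p :=
  (contDiffAt f hp).differentiableAt (by simp)

@[simp] theorem coe_add_apply (f g : Fld Ω) (p : Pt n) : (f + g : Fld Ω) p = f p + g p := rfl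

@[simp] theorem coe_sub_apply (f g : Fld Ω) (p : Pt n) : (f - g : Fld Ω) p = f p - g p := rfl

@[simp] theorem coe_neg_apply (f : Fld Ω) (p : Pt n) : (-f : Fld Ω) p = -f p := rfl

@[simp] theorem coe_smul_apply (c : ℝ) (f : Fld Ω) (p : Pt n) : (c • f : Fld Ω) p = c * f p := rfl

@[simp] theorem coe_zero_apply (p : Pt n) : (0 : Fld Ω) p = 0 := rfl

@[simp] theorem coe_sum_apply {ι : Type*} (s : Finset ι) (f : ι → Fld Ω) (p : Pt n) :
    (∑ i ∈ s, f i : Fld Ω) p = ∑ i ∈ s, f i p := by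
  classical
  induction s using Finset.induction_on with
  | empty => simp
  | insert a s ha ih => simp [Finset.sum_insert ha, ih]

open Classical in
/-- The element of `Fld Ω` that agrees with a given smooth function over `Ω`. -/
def mk (f : Pt n → ℝ) (hf : ContDiffOn ℝ ∞ f ((Ω : Set (Fin n → ℝ)) ×ˢ univ)) : Fld Ω :=
  ⟨fun p => if p.1 ∈ Ω then f p else 0,
    hf.congr fun _ hp => if_pos hp.1, fun _ hp => if_neg hp⟩

theorem mk_apply {f : Pt n → ℝ} (hf : ContDiffOn ℝ ∞ f ((Ω : Set (Fin n → ℝ)) ×ˢ univ))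
    {p : Pt n} (hp : p.1 ∈ Ω) : mk (Ω := Ω) f hf p = f p := if_pos hp

theorem mk_eventuallyEq {f : Pt n → ℝ}
    (hf : ContDiffOn ℝ ∞ f ((Ω : Set (Fin n → ℝ)) ×ˢ univ)) {p : Pt n} (hp : p.1 ∈ Ω) :
    (mk (Ω := Ω) f hf : Pt n → ℝ) =ᶠ[nhds p] f :=
  Filter.eventually_of_mem (domain_mem_nhds hp) fun _ hq => mk_apply hf hq.1

theorem contDiffOn_fderiv (f : Fld Ω) :
    ContDiffOn ℝ ∞ (fderiv ℝ f) ((Ω : Set (Fin n → ℝ)) ×ˢ univ) :=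
  f.2.1.fderiv_of_isOpen (isOpen_domain Ω) (by simp)

/-- The derivative in a constant direction. -/
def dir (v : Pt n) : Module.End ℝ (Fld Ω) where
  toFun f := mk (fun p => fderiv ℝ (f : Pt n → ℝ) p v) ((contDiffOn_fderiv f).clm_apply contDiffOn_const)
  map_add' f g := ext_on fun p hp => by
    rw [coe_add_apply, mk_apply _ hp, mk_apply _ hp, mk_apply _ hp]
    change fderiv ℝ ((f : Pt n → ℝ) + (g : Pt n → ℝ)) p v = _
    rw [fderiv_add (differentiableAt f hp) (differentiableAt g hp)]
    rfl
  map_smul' c f := ext_on fun p hp => by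
    rw [RingHom.id_apply, coe_smul_apply, mk_apply _ hp, mk_apply _ hp]
    change fderiv ℝ (c • (f : Pt n → ℝ)) p v = _
    rw [fderiv_const_smul (differentiableAt f hp)]
    rfl

theorem dir_apply (v : Pt n) (f : Fld Ω) {p : Pt n} (hp : p.1 ∈ Ω) :
    dir v f p = fderiv ℝ f p v :=
  mk_apply ((contDiffOn_fderiv f).clm_apply contDiffOn_const) hp

theorem dir_eventuallyEq (v : Pt n) (f : Fld Ω) {p : Pt n} (hp : p.1 ∈ Ω) :
    (dir v f : Pt n → ℝ) =ᶠ[nhds p] fun q => fderiv ℝ (f : Pt n → ℝ) q v :=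
  mk_eventuallyEq ((contDiffOn_fderiv f).clm_apply contDiffOn_const) hp

/-- Multiplication by a linear function. -/
def mulL (l : Pt n →L[ℝ] ℝ) : Module.End ℝ (Fld Ω) where
  toFun f := ⟨fun p => l p * f p, l.contDiff.contDiffOn.mul f.2.1, fun p hp => by simp [f.2.2 p hp]⟩
  map_add' f g := by apply Subtype.ext; funext p; exact mul_add _ _ _
  map_smul' c f := by apply Subtype.ext; funext p; exact mul_left_comm _ _ _

@[simp] theorem mulL_apply (l : Pt n →L[ℝ] ℝ) (f : Fld Ω) (p : Pt n) : mulL l f p = l p * f p := rfl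

theorem dir_dir (v w : Pt n) (f : Fld Ω) : dir v (dir w f) = dir w (dir v f) := by
  have key : ∀ (v w : Pt n) (p : Pt n), p.1 ∈ Ω →
      dir v (dir w f) p = fderiv ℝ (fderiv ℝ f) p v w := by
    intro v w p hp
    rw [dir_apply _ _ hp, (dir_eventuallyEq w f hp).fderiv_eq]
    have hd : DifferentiableAt ℝ (fderiv ℝ f) p :=
      ((contDiffOn_fderiv f).contDiffAt (domain_mem_nhds hp)).differentiableAt (by simp)
    rw [fderiv_clm_apply hd (differentiableAt_const _)]
    simp
  refine ext_on fun p hp => ?_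
  rw [key v w p hp, key w v p hp]
  exact ((contDiffAt f hp).isSymmSndFDerivAt
    (by simpa using (mod_cast le_top : ((2 : ℕ∞) : WithTop ℕ∞) ≤ ∞))).eq v w

theorem dir_mulL (v : Pt n) (l : Pt n →L[ℝ] ℝ) (f : Fld Ω) :
    dir v (mulL l f) = mulL l (dir v f) + l v • f := by
  refine ext_on fun p hp => ?_
  rw [dir_apply _ _ hp, coe_add_apply, mulL_apply, coe_smul_apply, dir_apply _ _ hp]
  change fderiv ℝ (fun q => l q * f q) p v = _
  rw [fderiv_fun_mul l.differentiableAt (differentiableAt f hp)]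
  simp [mul_comm]

theorem mulL_mulL (l m : Pt n →L[ℝ] ℝ) (f : Fld Ω) : mulL l (mulL m f) = mulL m (mulL l f) := by
  refine ext_on fun p _ => ?_
  simp [mul_left_comm]

/-! ### Quadratic combinations of coordinates and derivatives -/

/-- A coordinate of the point. -/
def uL (i : Fin n) : Pt n →L[ℝ] ℝ := (ContinuousLinearMap.proj i).comp (.fst ℝ _ _)

/-- A coordinate of the auxiliary vector. -/
def zL (i : Fin n) : Pt n →L[ℝ] ℝ := (ContinuousLinearMap.proj i).comp (.snd ℝ _ _)

@[simp] theorem uL_apply (i : Fin n) (p : Pt n) : uL i p = p.1 i := rfl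

@[simp] theorem zL_apply (i : Fin n) (p : Pt n) : zL i p = p.2 i := rfl

/-- The coordinates `u`, `z` and the derivatives along `u`, `z`, with upper indices. -/
def gen (η : Fin n → ℝ) (p : Fin 4) (i : Fin n) : Module.End ℝ (Fld Ω) :=
  match p with
  | 0 => mulL (uL i)
  | 1 => mulL (zL i)
  | 2 => η i • dir (Pi.single i 1, 0)
  | 3 => η i • dir (0, Pi.single i 1)

/-- The symplectic form of the commutation relations. -/
def sympl (p q : Fin 4) : ℝ :=
  (!![0, 0, -1, 0; 0, 0, 0, -1; 1, 0, 0, 0; 0, 1, 0, 0] : Matrix (Fin 4) (Fin 4) ℝ) p q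

/-- Canonical commutation relations. With all indices raised, the only nonzero brackets are those of
a derivative with its own coordinate, and they produce η^{ij}. -/
theorem gen_comm (η : Fin n → ℝ) (p q : Fin 4) (i j : Fin n) (f : Fld Ω) :
    gen η p i (gen η q j f) = gen η q j (gen η p i f) + (if i = j then sympl p q * η i else 0) • f := by
  by_cases hij : i = j
  · subst hij
    fin_cases p <;> fin_cases q <;>
      simp [gen, sympl, dir_mulL, mulL_mulL, dir_dir (0, Pi.single i 1) (Pi.single i 1, 0)] <;>
      module
  · have hji : ¬ j = i := fun h => hij h.symm
    fin_cases p <;> fin_cases q <;>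
      simp [gen, dir_mulL, hij, hji, mulL_mulL (uL i) (zL j), mulL_mulL (zL i) (uL j),
        mulL_mulL (uL i) (uL j), mulL_mulL (zL i) (zL j),
        dir_dir (0, Pi.single i 1) (Pi.single j 1, 0), dir_dir (Pi.single i 1, 0) (Pi.single j 1, 0),
        dir_dir (Pi.single i 1, 0) (0, Pi.single j 1), dir_dir (0, Pi.single i 1) (0, Pi.single j 1),
        smul_comm (η i) (η j)]

/-- The contraction of two of the four families. -/
def ctr (η : Fin n → ℝ) (p q : Fin 4) : Module.End ℝ (Fld Ω) :=
  ∑ i, η i • (gen η p i * gen η q i)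

theorem ctr_apply (η : Fin n → ℝ) (p q : Fin 4) (f : Fld Ω) :
    ctr η p q f = ∑ i, η i • gen η p i (gen η q i f) := by
  simp [ctr, LinearMap.sum_apply]

theorem ctr_gen {η : Fin n → ℝ} (hη : ∀ i, η i * η i = 1) (p q r : Fin 4) (j : Fin n) (f : Fld Ω) :
    ctr η p q (gen η r j f) =
      gen η r j (ctr η p q f) + sympl q r • gen η p j f + sympl p r • gen η q j f := by
  have h : ∀ i, η i • gen η p i (gen η q i (gen η r j f)) =
      gen η r j (η i • gen η p i (gen η q i f)) + (if i = j then sympl q r • gen η p j f else 0)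
        + (if i = j then sympl p r • gen η q j f else 0) := by
    intro i
    rw [gen_comm η q r, map_add, gen_comm η p r]
    by_cases hij : i = j
    · subst hij
      simp only [if_true, map_smul, smul_add, smul_smul, ← mul_assoc, mul_comm (η i) (sympl _ _)]
      simp only [mul_assoc, hη, mul_one]
      abel
    · simp [hij]
  rw [ctr_apply, Finset.sum_congr rfl fun i _ => h i]
  simp [Finset.sum_add_distrib, ctr_apply]

/-- The Leibniz rule for `ctr_gen`, applied to both factors of the second contraction. Every
commutator below is an instance of this formula. -/
theorem ctr_comm {η : Fin n → ℝ} (hη : ∀ i, η i * η i = 1) (p q r s : Fin 4) (f : Fld Ω) :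
    ctr η p q (ctr η r s f) = ctr η r s (ctr η p q f)
      + sympl q r • ctr η p s f + sympl p r • ctr η q s f
      + sympl q s • ctr η r p f + sympl p s • ctr η r q f := by
  rw [ctr_apply η r s f, map_sum]
  simp only [map_smul, ctr_gen hη, map_add, smul_add, Finset.sum_add_distrib]
  simp only [ctr_apply η r s, ctr_apply η p s, ctr_apply η q s, ctr_apply η r p, ctr_apply η r q,
    Finset.smul_sum, smul_comm (η _) (sympl _ _)]
  abel

/-- The ordering constant is the trace of the identity; this is the only way in which the dimension
n enters the commutators. -/
theorem ctr_swap {η : Fin n → ℝ} (hη : ∀ i, η i * η i = 1) (p q : Fin 4) (f : Fld Ω) :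
    ctr η p q f = ctr η q p f + (n * sympl p q) • f := by
  rw [ctr_apply, ctr_apply, Finset.sum_congr rfl fun i _ => by rw [gen_comm η p q]]
  simp [smul_smul, Finset.sum_add_distrib, mul_left_comm _ (sympl p q), hη, ← Nat.cast_smul_eq_nsmul ℝ]

end Fld

/-- The diagonal entries of a metric of arbitrary signature. -/
class IsSignature {n : ℕ} (η : Fin n → ℝ) : Prop where
  mul_self : ∀ i, η i * η i = 1

namespace Fld

variable {n : ℕ} {Ω : Opens (Fin n → ℝ)} (η : Fin n → ℝ)

/-- Multiplication by `u·u`. -/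
def Q : Module.End ℝ (Fld Ω) := ctr η 0 0

/-- Multiplication by `u·z`. -/
def X : Module.End ℝ (Fld Ω) := ctr η 0 1

/-- Multiplication by `z·z`. -/
def Z : Module.End ℝ (Fld Ω) := ctr η 1 1

/-- The symmetrised gradient `z·∂_u`. -/
def G : Module.End ℝ (Fld Ω) := ctr η 1 2

/-- The contraction with the position, `u·∂_z`. -/
def I : Module.End ℝ (Fld Ω) := ctr η 0 3

/-- The wave operator `∂_u·∂_u`. -/
def box : Module.End ℝ (Fld Ω) := ctr η 2 2

/-- The divergence `∂_z·∂_u`. -/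
def D : Module.End ℝ (Fld Ω) := ctr η 2 3

/-- The trace `∂_z·∂_z`. -/
def T : Module.End ℝ (Fld Ω) := ctr η 3 3

/-- The degree of homogeneity in `u`. -/
def N : Module.End ℝ (Fld Ω) := ctr η 0 2

/-- The degree of homogeneity in `z`. -/
def Nz : Module.End ℝ (Fld Ω) := ctr η 1 3

variable [h : IsSignature η]

/-! ### The commutation relations as rewrite rules -/

section Commutators

theorem ctr_1_0 (f : Fld Ω) : ctr η 1 0 f = ctr η 0 1 f := by
  simpa [sympl] using ctr_swap h.mul_self 1 0 f

theorem ctr_2_0 (f : Fld Ω) : ctr η 2 0 f = ctr η 0 2 f + (n : ℝ) • f := by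
  simpa [sympl] using ctr_swap h.mul_self 2 0 f

theorem ctr_2_1 (f : Fld Ω) : ctr η 2 1 f = ctr η 1 2 f := by
  simpa [sympl] using ctr_swap h.mul_self 2 1 f

theorem ctr_3_0 (f : Fld Ω) : ctr η 3 0 f = ctr η 0 3 f := by
  simpa [sympl] using ctr_swap h.mul_self 3 0 f

theorem ctr_3_1 (f : Fld Ω) : ctr η 3 1 f = ctr η 1 3 f + (n : ℝ) • f := by
  simpa [sympl] using ctr_swap h.mul_self 3 1 f

theorem ctr_3_2 (f : Fld Ω) : ctr η 3 2 f = ctr η 2 3 f := by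
  simpa [sympl] using ctr_swap h.mul_self 3 2 f

attribute [local simp] Q X Z G I box D T N Nz sympl ctr_1_0 ctr_2_0 ctr_2_1 ctr_3_0 ctr_3_1 ctr_3_2

-- This and the following rules are oriented: multiplications Q, X, Z move to the left, then G, box,
-- D, with I, T and the degrees N, Nz pushed towards the field. An operator identity is then checked
-- by `simp` followed by `module`.
@[simp] theorem X_Q (f : Fld Ω) : X η (Q η f) = Q η (X η f) := by
  rw [X, Q, ctr_comm h.mul_self]
  simp

@[simp] theorem G_Q (f : Fld Ω) : G η (Q η f) = Q η (G η f) + (2 : ℝ) • X η f := by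
  rw [G, Q, ctr_comm h.mul_self]
  simp
  module

@[simp] theorem G_X (f : Fld Ω) : G η (X η f) = X η (G η f) + Z η f := by
  rw [G, X, ctr_comm h.mul_self]
  simp

@[simp] theorem I_Q (f : Fld Ω) : I η (Q η f) = Q η (I η f) := by
  rw [I, Q, ctr_comm h.mul_self]
  simp

@[simp] theorem I_X (f : Fld Ω) : I η (X η f) = X η (I η f) + Q η f := by
  rw [I, X, ctr_comm h.mul_self]
  simp

@[simp] theorem I_Z (f : Fld Ω) : I η (Z η f) = Z η (I η f) + (2 : ℝ) • X η f := by
  rw [I, Z, ctr_comm h.mul_self]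
  simp
  module

@[simp] theorem I_G (f : Fld Ω) : I η (G η f) = G η (I η f) + N η f - Nz η f := by
  rw [I, G, ctr_comm h.mul_self]
  simp
  module

@[simp] theorem box_Q (f : Fld Ω) : box η (Q η f) = Q η (box η f) + (4 : ℝ) • N η f + (2 * n : ℝ) • f := by
  rw [box, Q, ctr_comm h.mul_self]
  simp
  module

@[simp] theorem box_X (f : Fld Ω) : box η (X η f) = X η (box η f) + (2 : ℝ) • G η f := by
  rw [box, X, ctr_comm h.mul_self]
  simp
  module

@[simp] theorem box_Z (f : Fld Ω) : box η (Z η f) = Z η (box η f) := by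
  rw [box, Z, ctr_comm h.mul_self]
  simp

@[simp] theorem box_G (f : Fld Ω) : box η (G η f) = G η (box η f) := by
  rw [box, G, ctr_comm h.mul_self]
  simp

@[simp] theorem I_box (f : Fld Ω) : I η (box η f) = box η (I η f) - (2 : ℝ) • D η f := by
  rw [I, box, ctr_comm h.mul_self]
  simp
  module

@[simp] theorem D_Q (f : Fld Ω) : D η (Q η f) = Q η (D η f) + (2 : ℝ) • I η f := by
  rw [D, Q, ctr_comm h.mul_self]
  simp
  module

@[simp] theorem D_X (f : Fld Ω) : D η (X η f) = X η (D η f) + N η f + Nz η f + (n : ℝ) • f := by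
  rw [D, X, ctr_comm h.mul_self]
  simp
  module

@[simp] theorem D_Z (f : Fld Ω) : D η (Z η f) = Z η (D η f) + (2 : ℝ) • G η f := by
  rw [D, Z, ctr_comm h.mul_self]
  simp
  module

@[simp] theorem D_G (f : Fld Ω) : D η (G η f) = G η (D η f) + box η f := by
  rw [D, G, ctr_comm h.mul_self]
  simp

@[simp] theorem I_D (f : Fld Ω) : I η (D η f) = D η (I η f) - T η f := by
  rw [I, D, ctr_comm h.mul_self]
  simp
  module

@[simp] theorem D_box (f : Fld Ω) : D η (box η f) = box η (D η f) := by
  rw [D, box, ctr_comm h.mul_self]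
  simp

@[simp] theorem T_Q (f : Fld Ω) : T η (Q η f) = Q η (T η f) := by
  rw [T, Q, ctr_comm h.mul_self]
  simp

@[simp] theorem T_X (f : Fld Ω) : T η (X η f) = X η (T η f) + (2 : ℝ) • I η f := by
  rw [T, X, ctr_comm h.mul_self]
  simp
  module

@[simp] theorem T_Z (f : Fld Ω) : T η (Z η f) = Z η (T η f) + (4 : ℝ) • Nz η f + (2 * n : ℝ) • f := by
  rw [T, Z, ctr_comm h.mul_self]
  simp
  module

@[simp] theorem T_G (f : Fld Ω) : T η (G η f) = G η (T η f) + (2 : ℝ) • D η f := by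
  rw [T, G, ctr_comm h.mul_self]
  simp
  module

@[simp] theorem T_box (f : Fld Ω) : T η (box η f) = box η (T η f) := by
  rw [T, box, ctr_comm h.mul_self]
  simp

@[simp] theorem T_D (f : Fld Ω) : T η (D η f) = D η (T η f) := by
  rw [T, D, ctr_comm h.mul_self]
  simp

@[simp] theorem N_Q (f : Fld Ω) : N η (Q η f) = Q η (N η f) + (2 : ℝ) • Q η f := by
  rw [N, Q, ctr_comm h.mul_self]
  simp
  module

@[simp] theorem N_X (f : Fld Ω) : N η (X η f) = X η (N η f) + X η f := by
  rw [N, X, ctr_comm h.mul_self]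
  simp

@[simp] theorem N_G (f : Fld Ω) : N η (G η f) = G η (N η f) - G η f := by
  rw [N, G, ctr_comm h.mul_self]
  simp
  module

@[simp] theorem N_I (f : Fld Ω) : N η (I η f) = I η (N η f) + I η f := by
  rw [N, I, ctr_comm h.mul_self]
  simp

@[simp] theorem N_box (f : Fld Ω) : N η (box η f) = box η (N η f) - (2 : ℝ) • box η f := by
  rw [N, box, ctr_comm h.mul_self]
  simp
  module

@[simp] theorem N_D (f : Fld Ω) : N η (D η f) = D η (N η f) - D η f := by
  rw [N, D, ctr_comm h.mul_self]
  simp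
  module

@[simp] theorem N_T (f : Fld Ω) : N η (T η f) = T η (N η f) := by
  rw [N, T, ctr_comm h.mul_self]
  simp

@[simp] theorem Nz_Q (f : Fld Ω) : Nz η (Q η f) = Q η (Nz η f) := by
  rw [Nz, Q, ctr_comm h.mul_self]
  simp

@[simp] theorem Nz_X (f : Fld Ω) : Nz η (X η f) = X η (Nz η f) + X η f := by
  rw [Nz, X, ctr_comm h.mul_self]
  simp

@[simp] theorem Nz_G (f : Fld Ω) : Nz η (G η f) = G η (Nz η f) + G η f := by
  rw [Nz, G, ctr_comm h.mul_self]
  simp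

@[simp] theorem Nz_I (f : Fld Ω) : Nz η (I η f) = I η (Nz η f) - I η f := by
  rw [Nz, I, ctr_comm h.mul_self]
  simp
  module

@[simp] theorem Nz_box (f : Fld Ω) : Nz η (box η f) = box η (Nz η f) := by
  rw [Nz, box, ctr_comm h.mul_self]
  simp

@[simp] theorem Nz_D (f : Fld Ω) : Nz η (D η f) = D η (Nz η f) - D η f := by
  rw [Nz, D, ctr_comm h.mul_self]
  simp
  module

@[simp] theorem Nz_T (f : Fld Ω) : Nz η (T η f) = T η (Nz η f) - (2 : ℝ) • T η f := by
  rw [Nz, T, ctr_comm h.mul_self]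
  simp
  module

end Commutators

end Fld

namespace Fld

variable {n : ℕ} {Ω : Opens (Fin n → ℝ)} (η : Fin n → ℝ)

/-! ### Values of the operators -/

/-- The bilinear form with diagonal entries `η`. -/
def bil (η : Fin n → ℝ) (x y : Fin n → ℝ) : ℝ := ∑ i, η i * (x i * y i)

theorem bil_comm (x y : Fin n → ℝ) : bil η x y = bil η y x :=
  Finset.sum_congr rfl fun i _ => by ring

theorem bil_add_left (x x' y : Fin n → ℝ) : bil η (x + x') y = bil η x y + bil η x' y := by
  simp only [bil, ← Finset.sum_add_distrib, Pi.add_apply]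
  exact Finset.sum_congr rfl fun i _ => by ring

theorem bil_smul_left (c : ℝ) (x y : Fin n → ℝ) : bil η (c • x) y = c * bil η x y := by
  simp only [bil, Finset.mul_sum, Pi.smul_apply, smul_eq_mul]
  exact Finset.sum_congr rfl fun i _ => by ring

theorem bil_add_right (x y y' : Fin n → ℝ) : bil η x (y + y') = bil η x y + bil η x y' := by
  rw [bil_comm, bil_add_left, bil_comm η y, bil_comm η y']

theorem bil_smul_right (c : ℝ) (x y : Fin n → ℝ) : bil η x (c • y) = c * bil η x y := by
  rw [bil_comm, bil_smul_left, bil_comm]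

@[simp] theorem Q_apply (f : Fld Ω) (p : Pt n) : Q η f p = bil η p.1 p.1 * f p := by
  simp [Q, ctr_apply, gen, bil, Finset.sum_mul, mul_assoc]

@[simp] theorem X_apply (f : Fld Ω) (p : Pt n) : X η f p = bil η p.1 p.2 * f p := by
  simp [X, ctr_apply, gen, bil, Finset.sum_mul, mul_assoc]

@[simp] theorem Z_apply (f : Fld Ω) (p : Pt n) : Z η f p = bil η p.2 p.2 * f p := by
  simp [Z, ctr_apply, gen, bil, Finset.sum_mul, mul_assoc]

theorem sum_fderiv_fst (f : Fld Ω) (p : Pt n) (v : Fin n → ℝ) :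
    ∑ i, v i * fderiv ℝ (f : Pt n → ℝ) p (Pi.single i 1, 0) = fderiv ℝ (f : Pt n → ℝ) p (v, 0) := by
  have : ((v, 0) : Pt n) = ∑ i, v i • ((Pi.single i 1, 0) : Pt n) := by
    ext j
    · simp [Prod.fst_sum, Finset.sum_apply, Pi.single_apply]
    · simp [Prod.snd_sum, Finset.sum_apply]
  rw [this, map_sum]
  simp only [map_smul, smul_eq_mul]

theorem sum_fderiv_snd (f : Fld Ω) (p : Pt n) (v : Fin n → ℝ) :
    ∑ i, v i * fderiv ℝ (f : Pt n → ℝ) p (0, Pi.single i 1) = fderiv ℝ (f : Pt n → ℝ) p (0, v) := by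
  have : ((0, v) : Pt n) = ∑ i, v i • ((0, Pi.single i 1) : Pt n) := by
    ext j
    · simp [Prod.fst_sum, Finset.sum_apply]
    · simp [Prod.snd_sum, Finset.sum_apply, Pi.single_apply]
  rw [this, map_sum]
  simp only [map_smul, smul_eq_mul]

variable [h : IsSignature η]

theorem mul_self_mul (i : Fin n) (c : ℝ) : η i * (η i * c) = c := by
  rw [← mul_assoc, h.mul_self, one_mul]

theorem N_apply (f : Fld Ω) {p : Pt n} (hp : p.1 ∈ Ω) :
    N η f p = fderiv ℝ (f : Pt n → ℝ) p (p.1, 0) := by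
  rw [← sum_fderiv_fst]
  simp [N, ctr_apply, gen, dir_apply _ _ hp, mul_left_comm _ (η _), mul_self_mul η]

theorem Nz_apply (f : Fld Ω) {p : Pt n} (hp : p.1 ∈ Ω) :
    Nz η f p = fderiv ℝ (f : Pt n → ℝ) p (0, p.2) := by
  rw [← sum_fderiv_snd]
  simp [Nz, ctr_apply, gen, dir_apply _ _ hp, mul_left_comm _ (η _), mul_self_mul η]

theorem I_apply (f : Fld Ω) {p : Pt n} (hp : p.1 ∈ Ω) :
    I η f p = fderiv ℝ (f : Pt n → ℝ) p (0, p.1) := by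
  rw [← sum_fderiv_snd]
  simp [I, ctr_apply, gen, dir_apply _ _ hp, mul_left_comm _ (η _), mul_self_mul η]

theorem G_apply (f : Fld Ω) {p : Pt n} (hp : p.1 ∈ Ω) :
    G η f p = fderiv ℝ (f : Pt n → ℝ) p (p.2, 0) := by
  rw [← sum_fderiv_fst]
  simp [G, ctr_apply, gen, dir_apply _ _ hp, mul_left_comm _ (η _), mul_self_mul η]

/-! ### Functions of degree zero and one in the auxiliary vector -/

/-- Along t ↦ t z the degree operator is t times the derivative, so the derivative vanishes for t ≠
0. The mean value theorem on [0, 1] only needs an interior point, so t = 0 causes no trouble. -/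
theorem eq_of_Nz_eq_zero {f : Fld Ω} (hf : Nz η f = 0) (u z : Fin n → ℝ) : f (u, z) = f (u, 0) := by
  by_cases hu : u ∈ Ω
  swap
  · rw [f.2.2 _ hu, f.2.2 _ hu]
  have hd : ∀ t : ℝ, HasDerivAt (fun t : ℝ => f (u, t • z))
      (fderiv ℝ (f : Pt n → ℝ) (u, t • z) (0, z)) t := by
    intro t
    have h1 : HasDerivAt (fun t : ℝ => ((u, t • z) : Pt n)) (0, z) t := by
      simpa using (hasDerivAt_const t u).prodMk ((hasDerivAt_id t).smul_const z)
    exact (differentiableAt f (p := (u, t • z)) hu).hasFDerivAt.comp_hasDerivAt t h1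
  have hzero : ∀ t : ℝ, t ≠ 0 → deriv (fun t : ℝ => f (u, t • z)) t = 0 := by
    intro t ht
    have h2 : Nz η f (u, t • z) = 0 := by rw [hf]; rfl
    rw [Nz_apply η f (p := (u, t • z)) hu] at h2
    have h3 : ((0, t • z) : Pt n) = t • ((0, z) : Pt n) := by simp
    rw [h3, map_smul, smul_eq_mul] at h2
    rw [(hd t).deriv]
    exact (mul_eq_zero.1 h2).resolve_left ht
  have hdiff : Differentiable ℝ (fun t : ℝ => f (u, t • z)) := fun t => (hd t).differentiableAt
  obtain ⟨c, hc, hc'⟩ := exists_deriv_eq_slope (fun t : ℝ => f (u, t • z)) zero_lt_one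
    hdiff.continuous.continuousOn hdiff.differentiableOn
  rw [hzero c hc.1.ne'] at hc'
  simp only [one_smul, zero_smul, sub_zero, div_one] at hc'
  linarith

theorem gen_three_eq_zero {f : Fld Ω} (hf : Nz η f = 0) (i : Fin n) : gen η 3 i f = 0 := by
  refine ext_on fun p hp => ?_
  have h1 : HasDerivAt (fun t : ℝ => p + t • ((0, Pi.single i 1) : Pt n)) (0, Pi.single i 1) 0 := by
    simpa using ((hasDerivAt_id (0 : ℝ)).smul_const ((0, Pi.single i 1) : Pt n)).const_add p
  have hp' : (p + (0 : ℝ) • ((0, Pi.single i 1) : Pt n)) = p := by simp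
  have h2 : HasFDerivAt (f : Pt n → ℝ) (fderiv ℝ (f : Pt n → ℝ) p)
      (p + (0 : ℝ) • ((0, Pi.single i 1) : Pt n)) := by
    rw [hp']
    exact (differentiableAt f hp).hasFDerivAt
  have h3 := h2.comp_hasDerivAt (0 : ℝ) h1
  have h4 : ((f : Pt n → ℝ) ∘ fun t : ℝ => p + t • ((0, Pi.single i 1) : Pt n)) =
      fun _ => f (p.1, 0) := by
    funext t
    have : (p + t • ((0, Pi.single i 1) : Pt n)) = (p.1, p.2 + t • Pi.single i 1) := by
      ext <;> simp
    simp only [Function.comp, this]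
    exact eq_of_Nz_eq_zero η hf _ _
  rw [h4] at h3
  have h5 := h3.unique (hasDerivAt_const _ _)
  simp [gen, dir_apply _ _ hp, h5]

theorem ctr_three_eq_zero {f : Fld Ω} (hf : Nz η f = 0) (p : Fin 4) : ctr η p 3 f = 0 := by
  simp [ctr_apply, gen_three_eq_zero η hf]

theorem D_eq_zero {f : Fld Ω} (hf : Nz η f = 0) : D η f = 0 := ctr_three_eq_zero η hf 2

theorem T_eq_zero {f : Fld Ω} (hf : Nz η f = 0) : T η f = 0 := ctr_three_eq_zero η hf 3

theorem I_eq_zero {f : Fld Ω} (hf : Nz η f = 0) : I η f = 0 := ctr_three_eq_zero η hf 0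

/-- A first z-derivative lowers the z-degree from one to zero, so it does not depend on z and a
second z-derivative kills it. -/
theorem T_eq_zero_of_Nz {f : Fld Ω} (hf : Nz η f = f) : T η f = 0 := by
  rw [T, ctr_apply]
  refine Finset.sum_eq_zero fun i _ => ?_
  rw [gen_three_eq_zero η, smul_zero]
  have := ctr_gen h.mul_self 1 3 3 i f
  rw [← Nz, hf] at this
  simp only [sympl] at this
  simp at this
  rw [this]
  module

/-! ### The operator of the linearised Bach tensor -/

/-- The fourth-order operator `□² - z·∂ ∂_z·∂ □ + (1/3) (z·∂)² (∂_z·∂)²`. -/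
def bach (f : Fld Ω) : Fld Ω :=
  box η (box η f) - G η (D η (box η f)) + (1 / 3 : ℝ) • G η (G η (D η (D η f)))

theorem bach_add (f g : Fld Ω) : bach η (f + g) = bach η f + bach η g := by
  simp only [bach, map_add]
  module

/-- D³f vanishes because f is quadratic in z. The term GD□ contributes −2 and (1/3)G²D² contributes
2/3, in any dimension. -/
theorem T_bach {f : Fld Ω} (hz : Nz η f = (2 : ℝ) • f)
    (hT : T η f = 0) : T η (bach η f) = -(4 / 3 : ℝ) • box η (D η (D η f)) := by
  have h3 : D η (D η (D η f)) = 0 := D_eq_zero η (by simp [hz]; module)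
  simp [bach, hT, h3]
  module

theorem N_bach {f : Fld Ω} (hN : N η f = 0) : N η (bach η f) = (-4 : ℝ) • bach η f := by
  simp [bach, hN]
  module

end Fld

/-- In dimension six, adding `(u·u - u·z u·∂_z + (1/2) (u·z)² ∂_z·∂_z) χ` does not change the
tangential trace-free part on the cone. -/
theorem Fld.bach_gauge {Ω : Opens (Fin 6 → ℝ)} (η : Fin 6 → ℝ) [IsSignature η] {χ : Fld Ω}
    (hN : N η χ = (-2 : ℝ) • χ) (hz : Nz η χ = (2 : ℝ) • χ) :
    ∃ a b c : Fld Ω, Nz η c = 0 ∧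
      bach η (Q η χ - X η (I η χ) + (1 / 2 : ℝ) • X η (X η (T η χ))) = X η a + Q η b + Z η c := by
  have h2 : D η (T η χ) = 0 := D_eq_zero η (by simp [hz])
  have h3 : T η (T η χ) = 0 := T_eq_zero η (by simp [hz])
  have h4 : D η (D η (D η χ)) = 0 := D_eq_zero η (by simp [hz]; module)
  have h5 : D η (D η (I η χ)) = 0 := D_eq_zero η (by simp [hz]; module)
  have h6 : D η (I η (I η χ)) = 0 := D_eq_zero η (by simp [hz]; module)
  have h7 : T η (I η χ) = 0 := T_eq_zero_of_Nz η (by simp [hz]; module)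
  -- The three witnesses collect the terms of the normally ordered expansion that begin with X, Q
  -- and Z. For degree −2 and n = 6 all terms beginning with G or box cancel.
  refine ⟨-box η (box η (I η χ)) + (1 / 2 : ℝ) • X η (box η (box η (T η χ))) - G η (box η (T η χ))
      + G η (box η (D η (I η χ))) - (2 : ℝ) • box η (D η χ) + (4 / 3 : ℝ) • G η (D η (D η χ)),
    box η (box η χ) - G η (box η (D η χ)) + (1 / 3 : ℝ) • G η (G η (D η (D η χ))),
    (-3 : ℝ) • box η (T η χ) + box η (D η (I η χ)) + (2 / 3 : ℝ) • D η (D η χ),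
    by simp [hz]; module, ?_⟩
  simp [bach, hN, hz, h2, h5]
  module

namespace Fld

variable {m n : ℕ} {Ω : Opens (Fin n → ℝ)} {Ω' : Opens (Fin m → ℝ)}

/-! ### Pull-back under linear maps -/

/-- The action of a linear map on a point and a vector. -/
def pairMap (L : (Fin m → ℝ) →L[ℝ] (Fin n → ℝ)) : Pt m →L[ℝ] Pt n := L.prodMap L

@[simp] theorem pairMap_apply (L : (Fin m → ℝ) →L[ℝ] (Fin n → ℝ)) (p : Pt m) :
    pairMap L p = (L p.1, L p.2) := rfl

/-- The pull-back under a linear map. -/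
def pull (L : (Fin m → ℝ) →L[ℝ] (Fin n → ℝ)) (hL : ∀ u ∈ Ω', L u ∈ Ω) : Fld Ω →ₗ[ℝ] Fld Ω' where
  toFun f := mk (fun p => f (pairMap L p))
    (f.2.1.comp (pairMap L).contDiff.contDiffOn fun p hp => ⟨hL _ hp.1, trivial⟩)
  map_add' f g := ext_on fun p hp => by
    rw [coe_add_apply, mk_apply _ hp, mk_apply _ hp, mk_apply _ hp, coe_add_apply]
  map_smul' c f := ext_on fun p hp => by
    rw [RingHom.id_apply, coe_smul_apply, mk_apply _ hp, mk_apply _ hp, coe_smul_apply]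

section Pull

variable (L : (Fin m → ℝ) →L[ℝ] (Fin n → ℝ)) (hL : ∀ u ∈ Ω', L u ∈ Ω)

theorem pull_apply (f : Fld Ω) {p : Pt m} (hp : p.1 ∈ Ω') :
    pull L hL f p = f (L p.1, L p.2) :=
  mk_apply (f.2.1.comp (pairMap L).contDiff.contDiffOn fun _ hp => ⟨hL _ hp.1, trivial⟩) hp

theorem fderiv_pull (f : Fld Ω) {p : Pt m} (hp : p.1 ∈ Ω') (v : Pt m) :
    fderiv ℝ (pull L hL f : Pt m → ℝ) p v = fderiv ℝ (f : Pt n → ℝ) (L p.1, L p.2) (L v.1, L v.2) := by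
  have h1 : (pull L hL f : Pt m → ℝ) =ᶠ[nhds p] fun p => f (pairMap L p) :=
    Filter.eventually_of_mem (domain_mem_nhds hp) fun q hq => pull_apply L hL f hq.1
  rw [h1.fderiv_eq]
  have h2 : HasFDerivAt (f : Pt n → ℝ) (fderiv ℝ (f : Pt n → ℝ) (pairMap L p)) (pairMap L p) :=
    (differentiableAt f (hL _ hp)).hasFDerivAt
  exact congrArg (· v) (h2.comp p (pairMap L).hasFDerivAt).fderiv

theorem dir_pull (f : Fld Ω) (v : Pt m) : dir v (pull L hL f) = pull L hL (dir (L v.1, L v.2) f) :=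
  ext_on fun p hp => by
    rw [dir_apply _ _ hp, fderiv_pull L hL f hp, pull_apply L hL _ hp, dir_apply _ _ (hL _ hp)]

variable (η' : Fin m → ℝ) (η : Fin n → ℝ) [h' : IsSignature η'] [h : IsSignature η]

/-- N, Nz, I and G pair a derivative with u or z and need no metric, so they commute with the
pull-back by any linear map. Q, X and Z need not do so. -/
theorem N_pull (f : Fld Ω) : N η' (pull L hL f) = pull L hL (N η f) := ext_on fun p hp => by
  rw [N_apply η' _ hp, fderiv_pull L hL f hp, pull_apply L hL _ hp, N_apply η _ (hL _ hp), map_zero]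

theorem Nz_pull (f : Fld Ω) : Nz η' (pull L hL f) = pull L hL (Nz η f) := ext_on fun p hp => by
  rw [Nz_apply η' _ hp, fderiv_pull L hL f hp, pull_apply L hL _ hp, Nz_apply η _ (hL _ hp), map_zero]

theorem I_pull (f : Fld Ω) : I η' (pull L hL f) = pull L hL (I η f) := ext_on fun p hp => by
  rw [I_apply η' _ hp, fderiv_pull L hL f hp, pull_apply L hL _ hp, I_apply η _ (hL _ hp), map_zero]

theorem G_pull (f : Fld Ω) : G η' (pull L hL f) = pull L hL (G η f) := ext_on fun p hp => by
  rw [G_apply η' _ hp, fderiv_pull L hL f hp, pull_apply L hL _ hp, G_apply η _ (hL _ hp), map_zero]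

/-- The linear map `L` preserves the inverse metrics. -/
def IsCoisometry : Prop := ∀ j k, ∑ i, η' i * (L (Pi.single i 1) j * L (Pi.single i 1) k) =
  if j = k then η j else 0

variable {L} {η' η}

/-- The chain rule, restricted to the two derivative families (2 ≤ p). The factors η' and η move
indices up and down. -/
theorem gen_pull (p : Fin 4) (hp : 2 ≤ p) (i : Fin m) (f : Fld Ω) :
    gen η' p i (pull L hL f) =
      ∑ j, (η' i * η j * L (Pi.single i 1) j) • pull L hL (gen η p j f) := by
  have hs : ∀ v : Fin n → ℝ, v = ∑ j, v j • Pi.single j 1 := fun v => by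
    ext j
    simp [Finset.sum_apply, Pi.single_apply]
  refine ext_on fun q hq => ?_
  rw [coe_sum_apply]
  simp only [coe_smul_apply, pull_apply L hL _ hq]
  have hq' : L q.1 ∈ Ω := hL _ hq
  have h4 : p = 2 ∨ p = 3 := by
    fin_cases p <;> simp at hp ⊢
  rcases h4 with rfl | rfl
  · simp only [gen, LinearMap.smul_apply, coe_smul_apply, dir_pull, pull_apply L hL _ hq, map_zero,
      dir_apply _ _ (p := (L q.1, L q.2)) hq', ← sum_fderiv_fst f _ (L (Pi.single i 1)),
      Finset.mul_sum]
    refine Finset.sum_congr rfl fun j _ => ?_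
    linear_combination (-(η' i) * L (Pi.single i 1) j *
      fderiv ℝ (f : Pt n → ℝ) (L q.1, L q.2) (Pi.single j 1, 0)) * h.mul_self j
  · simp only [gen, LinearMap.smul_apply, coe_smul_apply, dir_pull, pull_apply L hL _ hq, map_zero,
      dir_apply _ _ (p := (L q.1, L q.2)) hq', ← sum_fderiv_snd f _ (L (Pi.single i 1)),
      Finset.mul_sum]
    refine Finset.sum_congr rfl fun j _ => ?_
    linear_combination (-(η' i) * L (Pi.single i 1) j *
      fderiv ℝ (f : Pt n → ℝ) (L q.1, L q.2) (0, Pi.single j 1)) * h.mul_self j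

/-- A contraction of two derivatives is built from the inverse metric, which the coisometry
condition transports even between different dimensions. -/
theorem ctr_pull (hη : IsCoisometry L η' η) (p q : Fin 4) (hp : 2 ≤ p) (hq : 2 ≤ q) (f : Fld Ω) :
    ctr η' p q (pull L hL f) = pull L hL (ctr η p q f) := by
  have h1 : ∀ i, η' i • gen η' p i (gen η' q i (pull L hL f)) =
      ∑ j, ∑ k, (η j * η k) • (η' i * (L (Pi.single i 1) j * L (Pi.single i 1) k)) •
        pull L hL (gen η p j (gen η q k f)) := by
    intro i
    rw [gen_pull (η := η) hL q hq, map_sum, Finset.sum_comm, Finset.smul_sum]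
    refine Finset.sum_congr rfl fun k _ => ?_
    rw [map_smul, gen_pull (η := η) hL p hp, Finset.smul_sum, Finset.smul_sum]
    refine Finset.sum_congr rfl fun j _ => ?_
    simp only [smul_smul]
    congr 1
    linear_combination (η' i * η j * η k * L (Pi.single i 1) j * L (Pi.single i 1) k) *
      h'.mul_self i
  rw [ctr_apply, ctr_apply, Finset.sum_congr rfl fun i _ => h1 i, Finset.sum_comm, map_sum]
  refine Finset.sum_congr rfl fun j _ => ?_
  rw [Finset.sum_comm]
  simp only [← Finset.smul_sum, ← Finset.sum_smul, hη j]
  rw [Finset.sum_eq_single j]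
  · rw [if_pos rfl, smul_smul, map_smul, h.mul_self, one_mul]
  · intro k _ hk
    rw [if_neg hk.symm, zero_smul, smul_zero]
  · simp

theorem box_pull (hη : IsCoisometry L η' η) (f : Fld Ω) :
    box η' (pull L hL f) = pull L hL (box η f) := ctr_pull hL hη 2 2 le_rfl le_rfl f

theorem D_pull (hη : IsCoisometry L η' η) (f : Fld Ω) :
    D η' (pull L hL f) = pull L hL (D η f) := ctr_pull hL hη 2 3 le_rfl (by decide) f

theorem T_pull (hη : IsCoisometry L η' η) (f : Fld Ω) :
    T η' (pull L hL f) = pull L hL (T η f) := ctr_pull hL hη 3 3 (by decide) (by decide) f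

/-- bach is a polynomial in box, D and G, each of which commutes with the pull-back by a coisometry.
-/
theorem bach_pull (hη : IsCoisometry L η' η) (f : Fld Ω) :
    bach η' (pull L hL f) = pull L hL (bach η f) := by
  simp only [bach, box_pull hL hη, D_pull hL hη, G_pull L hL η' η, map_add, map_sub, map_smul]

end Pull

/-! ### Homogeneous functions -/

variable (η : Fin n → ℝ) [h : IsSignature η]

theorem hasDerivAt_smul_fst (f : Fld Ω) {u : Fin n → ℝ} (z : Fin n → ℝ) {t : ℝ} (ht : t • u ∈ Ω) :
    HasDerivAt (fun t : ℝ => f (t • u, z)) (fderiv ℝ (f : Pt n → ℝ) (t • u, z) (u, 0)) t := by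
  have h1 : HasDerivAt (fun t : ℝ => ((t • u, z) : Pt n)) (u, 0) t := by
    simpa using ((hasDerivAt_id t).smul_const u).prodMk (hasDerivAt_const t z)
  exact (differentiableAt f (p := (t • u, z)) ht).hasFDerivAt.comp_hasDerivAt t h1

/-- Euler's relation: s ^ k * f (s u, z) has derivative zero on the positive half-line. -/
theorem pow_mul_smul_fst {f : Fld Ω} (hΩ : ∀ u ∈ Ω, ∀ t : ℝ, 0 < t → t • u ∈ Ω) (k : ℕ)
    (hf : N η f = (-k : ℝ) • f) {u : Fin n → ℝ} (hu : u ∈ Ω) (z : Fin n → ℝ) {t : ℝ} (ht : 0 < t) :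
    t ^ k * f (t • u, z) = f (u, z) := by
  have hd : ∀ s ∈ Ioi (0 : ℝ), HasDerivAt (fun s : ℝ => s ^ k * f (s • u, z)) 0 s := by
    intro s hs
    have hs' : (0 : ℝ) < s := hs
    refine ((hasDerivAt_pow k s).mul (hasDerivAt_smul_fst f z (hΩ u hu s hs))).congr_deriv ?_
    have h2 : N η f (s • u, z) = -k * f (s • u, z) := by rw [hf]; rfl
    rw [N_apply η f (p := (s • u, z)) (hΩ u hu s hs)] at h2
    have h3 : ((s • u, 0) : Pt n) = s • ((u, 0) : Pt n) := by simp
    rw [h3, map_smul, smul_eq_mul] at h2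
    rcases k with _ | k
    · simp at h2
      simp [h2.resolve_left hs'.ne']
    · simp only [Nat.add_sub_cancel, pow_succ]
      linear_combination (s ^ k) * h2
  have hdiff : DifferentiableOn ℝ (fun s : ℝ => s ^ k * f (s • u, z)) (Ioi 0) :=
    fun s hs => (hd s hs).differentiableAt.differentiableWithinAt
  have := isOpen_Ioi.is_const_of_deriv_eq_zero isPreconnected_Ioi hdiff
    (fun s hs => (hd s hs).deriv) (mem_Ioi.2 ht) (mem_Ioi.2 one_pos)
  simpa using this

/-- Each ray in the region u·u < 0 meets u·u = −1. This upgrades identities on de Sitter space to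
identities of fields, which may then be differentiated in u. -/
theorem eq_zero_of_homogeneous {f : Fld Ω} (hΩ : ∀ u ∈ Ω, ∀ t : ℝ, 0 < t → t • u ∈ Ω)
    (hneg : ∀ u ∈ Ω, bil η u u < 0) (k : ℕ) (hf : N η f = (-k : ℝ) • f)
    (h0 : ∀ u ∈ Ω, bil η u u = -1 → ∀ z, f (u, z) = 0) : f = 0 := by
  refine ext_on fun ⟨u, z⟩ hu => ?_
  have hpos : 0 < -bil η u u := neg_pos.2 (hneg u hu)
  have hs : 0 < (√(-bil η u u))⁻¹ := inv_pos.2 (Real.sqrt_pos.2 hpos)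
  rw [← pow_mul_smul_fst η hΩ k hf hu z hs, h0 _ (hΩ u hu _ hs), mul_zero]
  · rfl
  · rw [bil_smul_left, bil_smul_right, ← mul_assoc, ← mul_inv, Real.mul_self_sqrt hpos.le, inv_neg, neg_mul,
      inv_mul_cancel₀ (hneg u hu).ne]

/-! ### Dependence on the auxiliary vector at a fixed point -/

theorem dir_snd_congr {f g : Fld Ω} {u : Fin n → ℝ} (hu : u ∈ Ω) (hfg : ∀ z, f (u, z) = g (u, z))
    (w z : Fin n → ℝ) : dir (0, w) f (u, z) = dir (0, w) g (u, z) := by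
  have key : ∀ f : Fld Ω, HasDerivAt (fun t : ℝ => f (u, z + t • w)) (dir (0, w) f (u, z)) 0 := by
    intro f
    have h1 : HasDerivAt (fun t : ℝ => ((u, z + t • w) : Pt n)) (0, w) 0 := by
      simpa using (hasDerivAt_const (0 : ℝ) u).prodMk
        (((hasDerivAt_id (0 : ℝ)).smul_const w).const_add z)
    have h2 : HasFDerivAt (f : Pt n → ℝ) (fderiv ℝ (f : Pt n → ℝ) (u, z))
        (u, z + (0 : ℝ) • w) := by
      simpa using (differentiableAt f (p := (u, z)) hu).hasFDerivAt
    rw [dir_apply _ _ (p := (u, z)) hu]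
    exact h2.comp_hasDerivAt (0 : ℝ) h1
  have h3 := key f
  simp only [hfg] at h3
  exact h3.unique (key g)

theorem gen_three_congr {f g : Fld Ω} {u : Fin n → ℝ} (hu : u ∈ Ω)
    (hfg : ∀ z, f (u, z) = g (u, z)) (i : Fin n) (z : Fin n → ℝ) :
    gen η 3 i f (u, z) = gen η 3 i g (u, z) := by
  simp only [gen, LinearMap.smul_apply, coe_smul_apply, dir_snd_congr hu hfg]

/-- T and I contain no u-derivative, so they can be applied to an identity known only at one value
of u. -/
theorem T_congr {f g : Fld Ω} {u : Fin n → ℝ} (hu : u ∈ Ω) (hfg : ∀ z, f (u, z) = g (u, z))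
    (z : Fin n → ℝ) : T η f (u, z) = T η g (u, z) := by
  simp only [T, ctr_apply, coe_sum_apply, coe_smul_apply,
    gen_three_congr η hu (gen_three_congr η hu hfg _)]

theorem I_congr {f g : Fld Ω} {u : Fin n → ℝ} (hu : u ∈ Ω) (hfg : ∀ z, f (u, z) = g (u, z))
    (z : Fin n → ℝ) : I η f (u, z) = I η g (u, z) := by
  simp only [I, ctr_apply, coe_sum_apply, coe_smul_apply, gen, mulL_apply, LinearMap.smul_apply,
    dir_snd_congr hu hfg]

end Fld

instance : IsSignature eta5 where
  mul_self i := by fin_cases i <;> simp [eta5]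

instance : IsSignature eta6 where
  mul_self i := by fin_cases i <;> simp [eta6]

/-! ### From Dirac's equation to proportionality with the metric, in five dimensions -/

namespace Fld

/-- The quadratic form on auxiliary vectors `z·z + (x·z)²`, the induced metric of de Sitter space. -/
def thetaMul {n : ℕ} {Ω : Opens (Fin n → ℝ)} (η : Fin n → ℝ) (f : Fld Ω) : Fld Ω :=
  Z η f + X η (X η f)

variable {Ω : Opens (Fin 5 → ℝ)}

/-- If the tensor `bach κ` is proportional to the metric at a point of de Sitter space, then its
trace-free part vanishes there. -/
theorem bach_add_trace_eq_zero {κ : Fld Ω} (hz : Nz eta5 κ = (2 : ℝ) • κ)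
    (hT : T eta5 κ = 0) {x : Fin 5 → ℝ} (hx : x ∈ Ω) (hx1 : bil eta5 x x = -1) (e : ℝ)
    (he : ∀ z, bach eta5 κ (x, z) = e * (bil eta5 z z + bil eta5 x z ^ 2)) (z : Fin 5 → ℝ) :
    (bach eta5 κ + (1 / 6 : ℝ) • thetaMul eta5 (box eta5 (D eta5 (D eta5 κ)))) (x, z) = 0 := by
  -- The constant function lets θ be written as operators applied to a field, so that T acts on it
  -- by the commutation rules.
  let one : Fld Ω := mk (fun _ => 1) contDiffOn_const
  have hone : ∀ z, one (x, z) = 1 := fun z => mk_apply (p := (x, z)) contDiffOn_const hx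
  have hNz : Nz eta5 one = 0 := ext_on fun p hp => by
    have : (one : Pt 5 → ℝ) =ᶠ[nhds p] fun _ => 1 := mk_eventuallyEq contDiffOn_const hp
    rw [Nz_apply eta5 _ hp, this.fderiv_eq]
    simp
  have hcongr : ∀ z, bach eta5 κ (x, z) = (e • thetaMul eta5 one) (x, z) := by
    intro z
    simp only [he, thetaMul, coe_smul_apply, coe_add_apply, Z_apply, X_apply, hone]
    ring
  have h1 := T_congr eta5 hx hcongr z
  rw [T_bach eta5 hz hT] at h1
  simp only [thetaMul, map_smul, map_add, T_Z, T_X, I_X, hNz, T_eq_zero eta5 hNz, I_eq_zero eta5 hNz,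
    map_zero, coe_smul_apply, coe_add_apply, Q_apply, hone, hx1,
    coe_zero_apply] at h1
  simp only [thetaMul, coe_smul_apply, coe_add_apply, Z_apply, X_apply, he]
  push_cast at h1
  -- The 8 is T applied to θ: 2·5 from z·z and 2 x·x = −2 from (x·z)². Together with `T_bach` this
  -- gives e = −(1/6) □DDκ.
  linear_combination (-(bil eta5 z z + bil eta5 x z ^ 2) / 8) * h1

/-- The consequence of Dirac's equation for the tensor on de Sitter space. -/
theorem bach_eq_of_wave (hΩ : ∀ u ∈ Ω, ∀ t : ℝ, 0 < t → t • u ∈ Ω)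
    (hneg : ∀ u ∈ Ω, bil eta5 u u < 0) {κ ξ σ : Fld Ω}
    (hN : N eta5 κ = 0) (hI : I eta5 κ = 0) (hT : T eta5 κ = 0)
    (hξN : N eta5 ξ = (-1 : ℝ) • ξ) (hξz : Nz eta5 ξ = ξ) (hξI : I eta5 ξ = 0)
    (hσN : N eta5 σ = (-2 : ℝ) • σ) (hσz : Nz eta5 σ = 0)
    (hσ : ∀ x ∈ Ω, bil eta5 x x = -1 → ∀ z, box eta5 (box eta5 σ) (x, z) = -4 * box eta5 σ (x, z))
    (hξ : ∀ x ∈ Ω, bil eta5 x x = -1 → ∀ z,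
      (box eta5 (box eta5 ξ) + X eta5 (box eta5 (box eta5 σ)) + (4 : ℝ) • G eta5 (box eta5 σ)) (x, z) = 0)
    (hκ : ∀ x ∈ Ω, bil eta5 x x = -1 → ∀ z,
      (box eta5 (box eta5 κ) + (2 : ℝ) • X eta5 (box eta5 (box eta5 ξ)) + (8 : ℝ) • G eta5 (box eta5 ξ)
        + X eta5 (X eta5 (box eta5 (box eta5 σ))) + (8 : ℝ) • X eta5 (G eta5 (box eta5 σ))
        + (4 : ℝ) • Z eta5 (box eta5 σ) + (8 : ℝ) • G eta5 (G eta5 σ)) (x, z) = 0)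
    {x : Fin 5 → ℝ} (hx : x ∈ Ω) (hx1 : bil eta5 x x = -1) (z : Fin 5 → ℝ) :
    bach eta5 κ (x, z) = -4 * box eta5 σ (x, 0) * (bil eta5 z z + bil eta5 x z ^ 2) := by
  have hDσ : D eta5 σ = 0 := D_eq_zero eta5 hσz
  have hIσ : I eta5 σ = 0 := I_eq_zero eta5 hσz
  have hTξ : T eta5 ξ = 0 := T_eq_zero_of_Nz eta5 hξz
  have hDDξ : D eta5 (D eta5 ξ) = 0 := D_eq_zero eta5 (by simp [hξz])
  -- Eliminates □²ξ and □²σ from the equation for κ.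
  have e1 : ∀ x ∈ Ω, bil eta5 x x = -1 → ∀ z, box eta5 (box eta5 κ) (x, z) =
      (-((4 : ℝ) • thetaMul eta5 (box eta5 σ)) - (8 : ℝ) • G eta5 (box eta5 ξ)
        - (8 : ℝ) • G eta5 (G eta5 σ)) (x, z) := by
    intro x hx hx1 z
    have h1 := hσ x hx hx1 z
    have h2 := hξ x hx hx1 z
    have h3 := hκ x hx hx1 z
    simp only [thetaMul, coe_add_apply, coe_sub_apply, coe_neg_apply, coe_smul_apply, X_apply,
      Z_apply] at h2 h3 ⊢
    linear_combination h3 - 2 * bil eta5 x z * h2 + bil eta5 x z ^ 2 * h1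
  -- I applied to □²κ leaves −4 D□κ, because Iκ = 0. Both sides have degree −3, so the identity
  -- extends off de Sitter space, as is needed for applying G to it later.
  have e2 : D eta5 (box eta5 κ) = -((4 : ℝ) • G eta5 (D eta5 ξ)) - (8 : ℝ) • box eta5 ξ
      - (12 : ℝ) • G eta5 σ := by
    rw [← sub_eq_zero]
    refine eq_zero_of_homogeneous eta5 hΩ hneg 3 (by simp [hN, hξN, hσN]; module) ?_
    intro x hx hx1 z
    have h1 := I_congr eta5 hx (e1 x hx hx1) z
    simp [thetaMul, hI, hξI, hξN, hξz, hσN, hσz, hIσ, hDσ, hx1] at h1 ⊢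
    linear_combination (-1 / 4) * h1
  -- A second contraction with u: I of D□κ is −2 DDκ, because Iκ and Tκ vanish.
  have e3 : D eta5 (D eta5 κ) = -((12 : ℝ) • (D eta5 ξ + σ)) := by
    have h1 := congrArg (I eta5) e2
    simp [hI, hT, hξI, hξN, hξz, hσN, hσz, hIσ, hTξ] at h1
    have h2 : D eta5 (D eta5 κ) = (-1 / 2 : ℝ) • -((2 : ℝ) • D eta5 (D eta5 κ)) := by module
    rw [h2, h1]
    module
  -- After substitution all terms in G□ξ, GGDξ and GGσ cancel, and only −4 θ □σ survives.
  rw [bach]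
  simp only [coe_add_apply, coe_sub_apply, e1 x hx hx1 z, e2, e3]
  have h4 : box eta5 σ (x, z) = box eta5 σ (x, 0) :=
    eq_of_Nz_eq_zero eta5 (by simp [hσz]) x z
  simp [thetaMul, h4]
  ring

end Fld

/-! ### Smoothness of integrals depending on a parameter -/

theorem continuousOn_slice {E F : Type*} [TopologicalSpace E] [TopologicalSpace F]
    {W : Set (E × ℝ)} {s : Set E} (hsub : ∀ x ∈ s, ∀ t ∈ Icc (0 : ℝ) 1, (x, t) ∈ W)
    {f : E × ℝ → F} (hf : ContinuousOn f W) {x : E} (hx : x ∈ s) :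
    ContinuousOn (fun t => f (x, t)) (Icc 0 1) :=
  hf.comp (by fun_prop) fun t ht => hsub x hx t ht

section Parametric

variable {E F : Type} [NormedAddCommGroup E] [NormedSpace ℝ E] [FiniteDimensional ℝ E]
  [NormedAddCommGroup F] [NormedSpace ℝ F] [CompleteSpace F] {W : Set (E × ℝ)} {s : Set E}

theorem hasFDerivAt_parametric_integral (hW : IsOpen W) (hs : IsOpen s)
    (hsub : ∀ x ∈ s, ∀ t ∈ Icc (0 : ℝ) 1, (x, t) ∈ W) {f : E × ℝ → F} (hf : ContDiffOn ℝ ∞ f W)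
    {x : E} (hx : x ∈ s) :
    HasFDerivAt (fun x => ∫ t in (0 : ℝ)..1, f (x, t))
      (∫ t in (0 : ℝ)..1, (fderiv ℝ f (x, t)).comp (.inl ℝ E ℝ)) x := by
  have hIoc : uIoc (0 : ℝ) 1 ⊆ Icc 0 1 := by
    rw [uIoc_of_le zero_le_one]
    exact Ioc_subset_Icc_self
  have hf' : ContinuousOn (fun p => (fderiv ℝ f p).comp (.inl ℝ E ℝ)) W :=
    ((hf.fderiv_of_isOpen hW (m := ∞) (by simp)).continuousOn).clm_comp continuousOn_const
  -- The dominating constant is a bound for the derivative on a compact set, closed ball times [0,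
  -- 1].
  obtain ⟨ε, hε, hball⟩ := Metric.nhds_basis_closedBall.mem_iff.1 (hs.mem_nhds hx)
  have hcompact : IsCompact (Metric.closedBall x ε ×ˢ Icc (0 : ℝ) 1) :=
    (isCompact_closedBall x ε).prod isCompact_Icc
  obtain ⟨C, hC⟩ := hcompact.exists_bound_of_continuousOn
    (hf'.mono fun p hp => hsub p.1 (hball hp.1) p.2 hp.2)
  have hmeas : ∀ {F' : Type} [NormedAddCommGroup F'] [NormedSpace ℝ F'] {g : E × ℝ → F'},
      ContinuousOn g W → ∀ y ∈ s, MeasureTheory.AEStronglyMeasurable (fun t => g (y, t))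
        (MeasureTheory.volume.restrict (uIoc (0 : ℝ) 1)) := by
    intro F' _ _ g hg y hy
    exact ((continuousOn_slice hsub hg hy).mono hIoc).aestronglyMeasurable measurableSet_uIoc
  refine intervalIntegral.hasFDerivAt_integral_of_dominated_of_fderiv_le
    (F := fun x t => f (x, t)) (F' := fun x t => (fderiv ℝ f (x, t)).comp (.inl ℝ E ℝ))
    (bound := fun _ => C) (Metric.closedBall_mem_nhds x hε) ?_ ?_ (hmeas hf' x hx) ?_ ?_ ?_
  · filter_upwards [hs.mem_nhds hx] with y hy using hmeas hf.continuousOn y hy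
  · refine ContinuousOn.intervalIntegrable ?_
    rw [uIcc_of_le zero_le_one]
    exact continuousOn_slice hsub hf.continuousOn hx
  · filter_upwards with t ht y hy using hC (y, t) ⟨hy, hIoc ht⟩
  · exact intervalIntegrable_const
  · filter_upwards with t ht y hy
    have h1 : DifferentiableAt ℝ f (y, t) :=
      (hf.contDiffAt (hW.mem_nhds (hsub y (hball hy) t (hIoc ht)))).differentiableAt (by simp)
    exact h1.hasFDerivAt.comp y (hasFDerivAt_prodMk_left y t)

end Parametric

/-- Induction on the order by differentiation under the integral. The codomain is quantified inside
because the derivative takes values in a space of linear maps. -/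
theorem contDiffOn_parametric_integral_nat {E : Type} [NormedAddCommGroup E] [NormedSpace ℝ E]
    [FiniteDimensional ℝ E] {W : Set (E × ℝ)} {s : Set E} (hW : IsOpen W) (hs : IsOpen s)
    (hsub : ∀ x ∈ s, ∀ t ∈ Icc (0 : ℝ) 1, (x, t) ∈ W) (n : ℕ) :
    ∀ {F : Type} [NormedAddCommGroup F] [NormedSpace ℝ F] [CompleteSpace F] {f : E × ℝ → F},
      ContDiffOn ℝ ∞ f W → ContDiffOn ℝ n (fun x => ∫ t in (0 : ℝ)..1, f (x, t)) s := by
  induction n with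
  | zero =>
    intro F _ _ _ f hf
    simp only [Nat.cast_zero, contDiffOn_zero]
    exact fun x hx => (hasFDerivAt_parametric_integral hW hs hsub hf hx).continuousAt.continuousWithinAt
  | succ n ih =>
    intro F _ _ _ f hf
    rw [Nat.cast_succ, contDiffOn_succ_iff_fderiv_of_isOpen hs]
    refine ⟨fun x hx => (hasFDerivAt_parametric_integral hW hs hsub hf
      hx).differentiableAt.differentiableWithinAt, by simp, ?_⟩
    refine ContDiffOn.congr (ih (f := fun p => (fderiv ℝ f p).comp (.inl ℝ E ℝ)) ?_)
      fun x hx => (hasFDerivAt_parametric_integral hW hs hsub hf hx).fderiv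
    exact (hf.fderiv_of_isOpen hW (by simp)).clm_comp contDiffOn_const

theorem contDiffOn_parametric_integral {E F : Type} [NormedAddCommGroup E] [NormedSpace ℝ E]
    [FiniteDimensional ℝ E] [NormedAddCommGroup F] [NormedSpace ℝ F] [CompleteSpace F]
    {W : Set (E × ℝ)} {s : Set E} (hW : IsOpen W) (hs : IsOpen s)
    (hsub : ∀ x ∈ s, ∀ t ∈ Icc (0 : ℝ) 1, (x, t) ∈ W) {f : E × ℝ → F} (hf : ContDiffOn ℝ ∞ f W) :
    ContDiffOn ℝ ∞ (fun x => ∫ t in (0 : ℝ)..1, f (x, t)) s :=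
  contDiffOn_infty.2 fun n => contDiffOn_parametric_integral_nat hW hs hsub n hf

/-! ### Division by `u·u` -/

/-- The projection of six-dimensional space to the first five coordinates. -/
def proj5 : (Fin 6 → ℝ) →L[ℝ] (Fin 5 → ℝ) :=
  ContinuousLinearMap.pi fun i : Fin 5 =>
    (ContinuousLinearMap.proj i.castSucc : (Fin 6 → ℝ) →L[ℝ] ℝ)

@[simp] theorem proj5_apply (u : Fin 6 → ℝ) (i : Fin 5) : proj5 u i = u i.castSucc := rfl

theorem bil_eta6 (u v : Fin 6 → ℝ) :
    Fld.bil eta6 u v = Fld.bil eta5 (proj5 u) (proj5 v) + u (Fin.last 5) * v (Fin.last 5) := by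
  simp only [Fld.bil, Fin.sum_univ_castSucc (n := 5), proj5_apply]
  have h1 : ∀ i : Fin 5, eta6 i.castSucc = eta5 i := fun i => by fin_cases i <;> rfl
  have h2 : eta6 (Fin.last 5) = 1 := rfl
  simp only [h1, h2, one_mul]

/-- The length of a timelike vector. -/
def radius (x : Fin 5 → ℝ) : ℝ := √(-Fld.bil eta5 x x)

/-- The vector field tangent to the last axis. -/
def lastAxis : Fin 6 → ℝ := Pi.single (Fin.last 5) 1

theorem proj5_lastAxis : proj5 lastAxis = 0 := by
  ext i
  exact Pi.single_eq_of_ne (Fin.castSucc_ne_last i) 1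

theorem contDiff_bil {n : ℕ} (η : Fin n → ℝ) : ContDiff ℝ ∞ fun x : Fin n → ℝ => Fld.bil η x x := by
  unfold Fld.bil
  fun_prop

theorem contDiffOn_radius : ContDiffOn ℝ ∞ radius {x | Fld.bil eta5 x x < 0} :=
  ((contDiff_bil eta5).neg.contDiffOn).sqrt fun _ hx => (neg_pos.2 hx).ne'

/-- The point at the fraction `t` of the way from the cone to `u`, along the last axis. -/
def conePath (u : Fin 6 → ℝ) (t : ℝ) : Fin 6 → ℝ :=
  u + ((1 - t) * (radius (proj5 u) - u (Fin.last 5))) • lastAxis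

/-- A smooth function that vanishes on the cone is divisible by `u·u`. -/
theorem exists_eq_Q {Ω : Opens (Fin 6 → ℝ)} (hpos : ∀ u ∈ Ω, 0 < u (Fin.last 5))
    (hneg : ∀ u ∈ Ω, Fld.bil eta5 (proj5 u) (proj5 u) < 0)
    (hpath : ∀ u ∈ Ω, ∀ t ∈ Icc (0 : ℝ) 1, conePath u t ∈ Ω) {f : Fld Ω}
    (hf : ∀ u ∈ Ω, Fld.bil eta6 u u = 0 → ∀ z, f (u, z) = 0) : ∃ g : Fld Ω, f = Fld.Q eta6 g := by
  let Γ : Pt 6 × ℝ → Pt 6 := fun q => (conePath q.1.1 q.2, q.1.2)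
  let W₀ : Set (Pt 6 × ℝ) := {q | q.1.1 ∈ Ω}
  have hW₀ : IsOpen W₀ := Ω.2.preimage (by fun_prop)
  have hr : ContDiffOn ℝ ∞ (fun q : Pt 6 × ℝ => radius (proj5 q.1.1)) W₀ :=
    contDiffOn_radius.comp (t := {x | Fld.bil eta5 x x < 0})
      (proj5.contDiff.comp (contDiff_fst.comp contDiff_fst)).contDiffOn fun q hq => hneg _ hq
  have hlast : ContDiff ℝ ∞ fun q : Pt 6 × ℝ => q.1.1 (Fin.last 5) := by fun_prop
  have hΓ : ContDiffOn ℝ ∞ Γ W₀ := by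
    refine ContDiffOn.prodMk ?_ (contDiff_snd.comp contDiff_fst).contDiffOn
    refine ContDiffOn.add (contDiff_fst.comp contDiff_fst).contDiffOn (ContDiffOn.smul
      (ContDiffOn.mul (contDiff_const.sub contDiff_snd).contDiffOn ?_) contDiffOn_const)
    exact hr.sub hlast.contDiffOn
  let W : Set (Pt 6 × ℝ) := W₀ ∩ Γ ⁻¹' ((Ω : Set (Fin 6 → ℝ)) ×ˢ univ)
  have hW : IsOpen W := hΓ.continuousOn.isOpen_inter_preimage hW₀ (Fld.isOpen_domain Ω)
  have hsub : ∀ p ∈ (Ω : Set (Fin 6 → ℝ)) ×ˢ (univ : Set (Fin 6 → ℝ)), ∀ t ∈ Icc (0 : ℝ) 1,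
      (p, t) ∈ W := fun p hp t ht => ⟨hp.1, hpath _ hp.1 t ht, trivial⟩
  have hint : ContDiffOn ℝ ∞ (fun p : Pt 6 => ∫ t in (0 : ℝ)..1,
      fderiv ℝ (f : Pt 6 → ℝ) (Γ (p, t)) (lastAxis, 0)) ((Ω : Set (Fin 6 → ℝ)) ×ˢ univ) := by
    refine contDiffOn_parametric_integral (f := fun q => fderiv ℝ (f : Pt 6 → ℝ) (Γ q) (lastAxis, 0))
      hW (Fld.isOpen_domain Ω) hsub ?_
    exact ((Fld.contDiffOn_fderiv f).comp (hΓ.mono inter_subset_left) fun q hq => hq.2).clm_apply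
      contDiffOn_const
  have hr' : ContDiffOn ℝ ∞ (fun p : Pt 6 => radius (proj5 p.1)) ((Ω : Set (Fin 6 → ℝ)) ×ˢ univ) :=
    contDiffOn_radius.comp (t := {x | Fld.bil eta5 x x < 0})
      (proj5.contDiff.comp contDiff_fst).contDiffOn fun q hq => hneg _ hq.1
  have hlast' : ContDiff ℝ ∞ fun p : Pt 6 => p.1 (Fin.last 5) := by fun_prop
  have hden : ∀ u ∈ Ω, 0 < u (Fin.last 5) + radius (proj5 u) := fun u hu =>
    add_pos_of_pos_of_nonneg (hpos u hu) (Real.sqrt_nonneg _)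
  -- With r the radius of the first five coordinates, u·u = (u^5 − r)(u^5 + r). The fundamental
  -- theorem of calculus along the last axis produces the factor u^5 − r, and the other factor is
  -- positive and can be divided out.
  have hg := hint.div (hlast'.contDiffOn.add hr') fun p hp => (hden p.1 hp.1).ne'
  refine ⟨Fld.mk _ hg, Fld.ext_on fun ⟨u, z⟩ hu => ?_⟩
  have hu' : u ∈ Ω := hu
  rw [Fld.Q_apply, Fld.mk_apply hg hu]
  have hrsq : radius (proj5 u) ^ 2 = -Fld.bil eta5 (proj5 u) (proj5 u) :=
    Real.sq_sqrt (neg_pos.2 (hneg u hu')).le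
  have hd : ∀ t ∈ uIcc (0 : ℝ) 1, HasDerivAt (fun t : ℝ => f (conePath u t, z))
      ((u (Fin.last 5) - radius (proj5 u)) *
        fderiv ℝ (f : Pt 6 → ℝ) (Γ ((u, z), t)) (lastAxis, 0)) t := by
    intro t ht
    rw [uIcc_of_le zero_le_one] at ht
    have h1 : HasDerivAt (fun t : ℝ => (conePath u t, z))
        ((u (Fin.last 5) - radius (proj5 u)) • ((lastAxis, 0) : Pt 6)) t := by
      have h2 : HasDerivAt (fun t : ℝ => (1 - t) * (radius (proj5 u) - u (Fin.last 5)))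
          (u (Fin.last 5) - radius (proj5 u)) t := by
        simpa using ((hasDerivAt_id t).const_sub 1).mul_const (radius (proj5 u) - u (Fin.last 5))
      simpa [conePath] using ((h2.smul_const lastAxis).const_add u).prodMk (hasDerivAt_const t z)
    have h3 := (Fld.differentiableAt f (p := (conePath u t, z))
      (hpath u hu' t ht)).hasFDerivAt.comp_hasDerivAt t h1
    rwa [map_smul, smul_eq_mul] at h3
  have hftc := intervalIntegral.integral_eq_sub_of_hasDerivAt hd (by
    refine ContinuousOn.intervalIntegrable ?_
    rw [uIcc_of_le zero_le_one]
    refine ContinuousOn.mul continuousOn_const ?_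
    exact (continuousOn_slice (f := fun q => fderiv ℝ (f : Pt 6 → ℝ) (Γ q) (lastAxis, 0)) hsub
      (((Fld.contDiffOn_fderiv f).comp (hΓ.mono inter_subset_left) fun q hq => hq.2).clm_apply
      contDiffOn_const).continuousOn (x := (u, z)) ⟨hu', trivial⟩))
  have hzero : conePath u 0 ∈ Ω := hpath u hu' 0 ⟨le_rfl, zero_le_one⟩
  have hcone : f (conePath u 0, z) = 0 := by
    refine hf _ hzero ?_ z
    rw [bil_eta6]
    simp only [conePath, map_add, map_smul, proj5_lastAxis, smul_zero, add_zero]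
    simp [lastAxis]
    linear_combination hrsq
  rw [hcone, intervalIntegral.integral_const_mul] at hftc
  have h1 : conePath u 1 = u := by simp [conePath]
  rw [h1, sub_zero] at hftc
  rw [← hftc, bil_eta6, Pi.div_apply, mul_div_assoc', eq_div_iff (hden u hu').ne']
  linear_combination (-∫ t in (0 : ℝ)..1, fderiv ℝ (f : Pt 6 → ℝ) (Γ ((u, z), t)) (lastAxis, 0)) * hrsq

/-- Along the last axis u·u is a quadratic polynomial in t. It is nonzero for small t ≠ 0, since its
derivative at t = 0 is 2u^5 > 0; so f vanishes at points tending to u, and continuity concludes. -/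
theorem Q_injective {Ω : Opens (Fin 6 → ℝ)} (hpos : ∀ u ∈ Ω, 0 < u (Fin.last 5)) {f : Fld Ω}
    (hf : Fld.Q eta6 f = 0) : f = 0 := by
  refine Fld.ext_on fun ⟨u, z⟩ hu => ?_
  have hu' : u ∈ Ω := hu
  have hd : HasDerivAt (fun t : ℝ => u + t • lastAxis) lastAxis 0 := by
    simpa using ((hasDerivAt_id (0 : ℝ)).smul_const lastAxis).const_add u
  have hcont : ContinuousAt (fun t : ℝ => f (u + t • lastAxis, z)) 0 := by
    have h1 : ContinuousAt (fun t : ℝ => ((u + t • lastAxis, z) : Pt 6)) 0 :=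
      hd.continuousAt.prodMk continuousAt_const
    refine ContinuousAt.comp (g := (f : Pt 6 → ℝ)) ?_ h1
    simpa using (Fld.differentiableAt f (p := (u, z)) hu).continuousAt
  have hval : ∀ t : ℝ, Fld.bil eta6 (u + t • lastAxis) (u + t • lastAxis) =
      Fld.bil eta6 u u + 2 * t * u (Fin.last 5) + t ^ 2 := by
    intro t
    rw [bil_eta6, bil_eta6]
    simp only [map_add, map_smul, proj5_lastAxis, smul_zero, add_zero]
    simp [lastAxis]
    ring
  have hev : ∀ᶠ t in nhdsWithin (0 : ℝ) {0}ᶜ, f (u + t • lastAxis, z) = 0 := by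
    by_cases h0 : Fld.bil eta6 u u = 0
    · have : ∀ᶠ t in nhds (0 : ℝ), 0 < 2 * u (Fin.last 5) + t := by
        refine (continuous_const.add continuous_id).continuousAt.eventually_const_lt ?_
        simpa using hpos u hu'
      filter_upwards [nhdsWithin_le_nhds this, self_mem_nhdsWithin] with t ht ht0
      have h1 : Fld.Q eta6 f (u + t • lastAxis, z) = 0 := by rw [hf]; rfl
      rw [Fld.Q_apply, hval, h0] at h1
      refine (mul_eq_zero.1 h1).resolve_left ?_
      have : t * (2 * u (Fin.last 5) + t) ≠ 0 := mul_ne_zero ht0 ht.ne'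
      intro h2
      exact this (by linear_combination h2)
    · have hc : Continuous fun t : ℝ => Fld.bil eta6 u u + 2 * t * u (Fin.last 5) + t ^ 2 := by
        fun_prop
      have : ∀ᶠ t in nhds (0 : ℝ), Fld.bil eta6 u u + 2 * t * u (Fin.last 5) + t ^ 2 ≠ 0 :=
        hc.continuousAt.eventually_ne (by simpa using h0)
      filter_upwards [nhdsWithin_le_nhds this] with t ht
      have h1 : Fld.Q eta6 f (u + t • lastAxis, z) = 0 := by rw [hf]; rfl
      rw [Fld.Q_apply, hval] at h1
      exact (mul_eq_zero.1 h1).resolve_left ht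
  have hlim : Filter.Tendsto (fun t : ℝ => f (u + t • lastAxis, z)) (nhdsWithin 0 {0}ᶜ)
      (nhds (f (u, z))) := by
    simpa using hcont.tendsto.mono_left nhdsWithin_le_nhds
  exact tendsto_nhds_unique hlim (tendsto_const_nhds.congr' (hev.mono fun _ h => h.symm))

/-! ### Tangential derivatives -/

theorem mem_deSitter_iff {x : Fin 5 → ℝ} : x ∈ deSitter ↔ Fld.bil eta5 x x = -1 := by
  simp only [deSitter, mem_ofPred_eq, Fld.bil, sq]

theorem sum_mul_pderiv {n : ℕ} (f : (Fin n → ℝ) → ℝ) (x v : Fin n → ℝ) :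
    ∑ i, v i * pderiv i f x = fderiv ℝ f x v := by
  have : v = ∑ i, v i • (Pi.single i 1 : Fin n → ℝ) := by
    ext j
    simp [Finset.sum_apply, Pi.single_apply]
  conv_rhs => rw [this, map_sum]
  simp only [map_smul, smul_eq_mul, pderiv]

theorem dbar_eq_fderiv (α : Fin 5) (f : Scalar) (x : Fin 5 → ℝ) :
    dbar α f x = fderiv ℝ f x (Pi.single α 1 + low α x • x) := by
  rw [dbar, sum_mul_pderiv, map_add, map_smul, smul_eq_mul, pderiv]

theorem bil_single (α : Fin 5) (x : Fin 5 → ℝ) : Fld.bil eta5 x (Pi.single α 1) = low α x := by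
  simp [Fld.bil, low, Pi.single_apply]

/-- The derivative along a tangent vector of de Sitter space only depends on the restriction. -/
theorem fderiv_eq_of_eqOn_deSitter {V : Set (Fin 5 → ℝ)} (hV : IsOpen V) {f g : Scalar}
    {x t : Fin 5 → ℝ} (hx : x ∈ V ∩ deSitter) (ht : Fld.bil eta5 x t = 0)
    (hf : DifferentiableAt ℝ f x) (hg : DifferentiableAt ℝ g x)
    (hfg : ∀ y ∈ V ∩ deSitter, f y = g y) : fderiv ℝ f x t = fderiv ℝ g x t := by
  have hx1 := mem_deSitter_iff.1 hx.2
  let b := Fld.bil eta5 t t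
  have hq : ∀ s : ℝ, Fld.bil eta5 (x + s • t) (x + s • t) = -(1 - s ^ 2 * b) := by
    intro s
    simp only [Fld.bil_add_left, Fld.bil_add_right, Fld.bil_smul_left, Fld.bil_smul_right, hx1, ht,
      Fld.bil_comm eta5 t x, b]
    ring
  -- The line x + s t rescaled back to the hyperboloid. The scaling factor has zero derivative at s
  -- = 0, so the velocity there is still t.
  let c : ℝ → Fin 5 → ℝ := fun s => (√(1 - s ^ 2 * b))⁻¹ • (x + s • t)
  have hc0 : c 0 = x := by simp [c]
  have hc : HasDerivAt c t 0 := by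
    have h1 : HasDerivAt (fun s : ℝ => 1 - s ^ 2 * b) 0 0 := by
      simpa using ((hasDerivAt_pow 2 (0 : ℝ)).mul_const b).const_sub 1
    have h2 : HasDerivAt (fun s : ℝ => (√(1 - s ^ 2 * b))⁻¹) 0 0 := by
      simpa using (h1.sqrt (by simp)).fun_inv (by simp)
    have h3 : HasDerivAt (fun s : ℝ => x + s • t) t 0 := by
      simpa using ((hasDerivAt_id (0 : ℝ)).smul_const t).const_add x
    have h4 := h2.fun_smul h3
    simp only [zero_smul, add_zero] at h4
    simpa [c] using h4
  have hmem : ∀ᶠ s in nhds (0 : ℝ), c s ∈ V ∩ deSitter := by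
    have h1 : ∀ᶠ s in nhds (0 : ℝ), c s ∈ V :=
      hc.continuousAt.eventually_mem (by rw [hc0]; exact hV.mem_nhds hx.1)
    have h2 : ∀ᶠ s in nhds (0 : ℝ), 0 < 1 - s ^ 2 * b := by
      have : ContinuousAt (fun s : ℝ => 1 - s ^ 2 * b) 0 := by fun_prop
      exact this.eventually_const_lt (by simp)
    filter_upwards [h1, h2] with s hs1 hs2
    refine ⟨hs1, mem_deSitter_iff.2 ?_⟩
    simp only [c, Fld.bil_smul_left, Fld.bil_smul_right, hq]
    rw [← mul_assoc, ← mul_inv, Real.mul_self_sqrt hs2.le, mul_neg, inv_mul_cancel₀ hs2.ne']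
  have hf' : HasDerivAt (f ∘ c) (fderiv ℝ f x t) 0 := by
    refine HasFDerivAt.comp_hasDerivAt (0 : ℝ) ?_ hc
    rw [hc0]
    exact hf.hasFDerivAt
  have hg' : HasDerivAt (g ∘ c) (fderiv ℝ g x t) 0 := by
    refine HasFDerivAt.comp_hasDerivAt (0 : ℝ) ?_ hc
    rw [hc0]
    exact hg.hasFDerivAt
  exact (hf'.congr_of_eventuallyEq (hmem.mono fun s hs => (hfg _ hs).symm)).unique hg'

/-! ### Tangential calculus on homogeneous representatives -/

namespace Fld

variable {V : Set (Fin 5 → ℝ)} {O : Opens (Fin 5 → ℝ)}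

/-- The scalar field `f` is smooth on `V` and agrees with `F` on de Sitter space. -/
def Rep (V : Set (Fin 5 → ℝ)) (f : Scalar) (F : Fld O) : Prop :=
  ContDiffOn ℝ ∞ f V ∧ ∀ x ∈ V ∩ deSitter, f x = F (x, 0)

namespace Rep

variable {f g : Scalar} {F G' : Fld O}

theorem add (hf : Rep V f F) (hg : Rep V g G') : Rep V (fun x => f x + g x) (F + G') :=
  ⟨hf.1.add hg.1, fun x hx => by simp only [coe_add_apply, hf.2 x hx, hg.2 x hx]⟩

theorem sub (hf : Rep V f F) (hg : Rep V g G') : Rep V (fun x => f x - g x) (F - G') :=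
  ⟨hf.1.sub hg.1, fun x hx => by simp only [coe_sub_apply, hf.2 x hx, hg.2 x hx]⟩

theorem neg (hf : Rep V f F) : Rep V (fun x => -f x) (-F) :=
  ⟨hf.1.neg, fun x hx => by simp only [coe_neg_apply, hf.2 x hx]⟩

theorem const_mul (c : ℝ) (hf : Rep V f F) : Rep V (fun x => c * f x) (c • F) :=
  ⟨contDiffOn_const.mul hf.1, fun x hx => by simp only [coe_smul_apply, hf.2 x hx]⟩

theorem sum {f : Fin 5 → Scalar} {F : Fin 5 → Fld O} (hf : ∀ i, Rep V (f i) (F i)) :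
    Rep V (fun x => ∑ i, f i x) (∑ i, F i) :=
  ⟨ContDiffOn.sum fun i _ => (hf i).1, fun x hx => by
    rw [coe_sum_apply]
    exact Finset.sum_congr rfl fun i _ => (hf i).2 x hx⟩

theorem coord_mul (α : Fin 5) (hf : Rep V f F) :
    Rep V (fun x => x α * f x) (gen eta5 0 α F) :=
  ⟨ContDiffOn.mul (by fun_prop) hf.1, fun x hx => by
    simp only [hf.2 x hx]
    rfl⟩

theorem low_mul (α : Fin 5) (hf : Rep V f F) :
    Rep V (fun x => low α x * f x) (eta5 α • gen eta5 0 α F) :=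
  ⟨ContDiffOn.mul (by unfold low; fun_prop) hf.1, fun x hx => by
    simp only [hf.2 x hx, coe_smul_apply, low, mul_assoc]
    rfl⟩

theorem congr (hf : Rep V f F) (h : ∀ x ∈ V ∩ deSitter, F (x, 0) = G' (x, 0)) : Rep V f G' :=
  ⟨hf.1, fun x hx => by rw [hf.2 x hx, h x hx]⟩

theorem congr_eq (hf : Rep V f F) (h : F = G') : Rep V f G' := h ▸ hf

/-- The direction e_α + x_α x is tangent at x, so F may replace f. The radial part x·∂ then acts on
F as the degree operator. -/
theorem dbar (hV : IsOpen V) (hO : V ∩ deSitter ⊆ O) (α : Fin 5) (hf : Rep V f F) :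
    Rep V (dbar α f) (eta5 α • (gen eta5 2 α F + gen eta5 0 α (N eta5 F))) := by
  have hfd : ContDiffOn ℝ ∞ (fderiv ℝ f) V := hf.1.fderiv_of_isOpen hV (by simp)
  refine ⟨?_, fun x hx => ?_⟩
  · have : SixCone.dbar α f = fun x => fderiv ℝ f x (Pi.single α 1 + low α x • x) :=
      funext (dbar_eq_fderiv α f)
    rw [this]
    refine hfd.clm_apply ?_
    unfold low
    fun_prop
  · have hxO : x ∈ O := hO hx
    have hx1 := mem_deSitter_iff.1 hx.2
    have hF : HasFDerivAt (fun y : Fin 5 → ℝ => F (y, 0))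
        ((fderiv ℝ (F : Pt 5 → ℝ) (x, 0)).comp (.inl ℝ _ _)) x :=
      (differentiableAt F (p := (x, 0)) hxO).hasFDerivAt.comp x (hasFDerivAt_prodMk_left x 0)
    rw [dbar_eq_fderiv, fderiv_eq_of_eqOn_deSitter hV hx ?_
      ((hf.1.contDiffAt (hV.mem_nhds hx.1)).differentiableAt (by simp)) hF.differentiableAt hf.2,
      hF.fderiv]
    · have h1 : ((Pi.single α 1 + low α x • x, 0) : Pt 5) =
          (Pi.single α 1, 0) + low α x • (x, 0) := by simp
      rw [ContinuousLinearMap.comp_apply, ContinuousLinearMap.inl_apply, h1, map_add, map_smul]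
      simp only [gen, coe_smul_apply, coe_add_apply, LinearMap.smul_apply, mulL_apply, uL_apply,
        dir_apply _ _ (p := (x, (0 : Fin 5 → ℝ))) hxO, N_apply eta5 F (p := (x, (0 : Fin 5 → ℝ))) hxO,
        smul_eq_mul, mul_add, mul_self_mul, low, mul_assoc]
    · rw [bil_add_right, bil_smul_right, bil_single, hx1]
      ring

end Rep

@[simp] theorem gen_zero_apply (α : Fin 5) (F : Fld O) (p : Pt 5) :
    gen eta5 0 α F p = p.1 α * F p := rfl

theorem N_gen_zero (α : Fin 5) (F : Fld O) :
    N eta5 (gen eta5 0 α F) = gen eta5 0 α (N eta5 F) + gen eta5 0 α F := by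
  have := ctr_gen (IsSignature.mul_self (η := eta5)) 0 2 0 α F
  rw [N, this]
  simp [sympl]

theorem N_gen_two (α : Fin 5) (F : Fld O) :
    N eta5 (gen eta5 2 α F) = gen eta5 2 α (N eta5 F) - gen eta5 2 α F := by
  have := ctr_gen (IsSignature.mul_self (η := eta5)) 0 2 2 α F
  rw [N, this]
  simp [sympl]
  module

theorem box_gen_two (α : Fin 5) (F : Fld O) :
    box eta5 (gen eta5 2 α F) = gen eta5 2 α (box eta5 F) := by
  have := ctr_gen (IsSignature.mul_self (η := eta5)) 2 2 2 α F
  rw [box, this]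
  simp [sympl]

theorem box_gen_zero (α : Fin 5) (F : Fld O) :
    box eta5 (gen eta5 0 α F) = gen eta5 0 α (box eta5 F) + (2 : ℝ) • gen eta5 2 α F := by
  have := ctr_gen (IsSignature.mul_self (η := eta5)) 2 2 0 α F
  rw [box, this]
  simp [sympl]
  module

theorem gen_two_two (α β : Fin 5) (F : Fld O) :
    gen eta5 2 α (gen eta5 2 β F) = gen eta5 2 β (gen eta5 2 α F) := by
  have := gen_comm eta5 2 2 α β F
  simpa [sympl] using this

theorem gen_two_zero (α β : Fin 5) (F : Fld O) :
    gen eta5 2 α (gen eta5 0 β F) =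
      gen eta5 0 β (gen eta5 2 α F) + (if α = β then eta5 α else 0) • F := by
  have := gen_comm eta5 2 0 α β F
  simpa [sympl] using this

theorem sum_gen_zero_two (F : Fld O) :
    ∑ α, eta5 α • gen eta5 0 α (gen eta5 2 α F) = N eta5 F := by
  rw [N, ctr_apply]

theorem sum_gen_two_two (F : Fld O) :
    ∑ α, eta5 α • gen eta5 2 α (gen eta5 2 α F) = box eta5 F := by
  rw [box, ctr_apply]

theorem sum_gen_zero_zero (F : Fld O) :
    ∑ α, eta5 α • gen eta5 0 α (gen eta5 0 α F) = Q eta5 F := by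
  rw [Q, ctr_apply]

theorem sum_gen_two_zero (F : Fld O) :
    ∑ α, eta5 α • gen eta5 2 α (gen eta5 0 α F) = N eta5 F + (5 : ℝ) • F := by
  have := ctr_swap (IsSignature.mul_self (η := eta5)) 2 0 F
  rw [ctr_apply] at this
  rw [this, N]
  simp [sympl]

namespace Rep

variable {f : Scalar} {F : Fld O}

/-- Expanding the square gives □ + (2w² + 4w) + w(w + 1) u·u; putting u·u = −1 leaves w(w + 3). -/
theorem Q0 (hV : IsOpen V) (hO : V ∩ deSitter ⊆ O) (hf : Rep V f F) (w : ℝ)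
    (hF : N eta5 F = w • F) : Rep V (Q0 f) (-box eta5 F - (w * (w + 3)) • F) := by
  have h1 := ((sum fun α => ((hf.dbar hV hO α).dbar hV hO α).const_mul (eta5 α))).neg
  refine Rep.congr h1 fun x hx => ?_
  have h2 : ∑ α, eta5 α • eta5 α • (gen eta5 2 α (eta5 α • (gen eta5 2 α F + gen eta5 0 α (N eta5 F)))
      + gen eta5 0 α (N eta5 (eta5 α • (gen eta5 2 α F + gen eta5 0 α (N eta5 F))))) =
      box eta5 F + (w * (w + 5) + w * (w - 1)) • F + (w * (w + 1)) • Q eta5 F := by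
    have h3 : ∀ α, eta5 α • eta5 α • (gen eta5 2 α (eta5 α • (gen eta5 2 α F +
        gen eta5 0 α (N eta5 F))) +
        gen eta5 0 α (N eta5 (eta5 α • (gen eta5 2 α F + gen eta5 0 α (N eta5 F))))) =
        eta5 α • gen eta5 2 α (gen eta5 2 α F) + w • (eta5 α • gen eta5 2 α (gen eta5 0 α F))
        + (w - 1) • (eta5 α • gen eta5 0 α (gen eta5 2 α F))
        + (w * (w + 1)) • (eta5 α • gen eta5 0 α (gen eta5 0 α F)) := by
      intro α
      have : eta5 α • eta5 α • eta5 α • (1 : ℝ) = eta5 α := by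
        simp only [smul_eq_mul, mul_self_mul eta5, mul_one]
      simp only [hF, map_smul, map_add, N_gen_zero, N_gen_two, map_sub, smul_add, smul_smul,
        smul_sub, IsSignature.mul_self, mul_self_mul]
      module
    rw [Finset.sum_congr rfl fun α _ => h3 α]
    simp only [Finset.sum_add_distrib, ← Finset.smul_sum, sum_gen_two_two, sum_gen_zero_two,
      sum_gen_zero_zero, sum_gen_two_zero, hF]
    module
  rw [h2]
  simp [mem_deSitter_iff.1 hx.2]
  ring

end Rep

end Fld

namespace Fld

variable {V : Set (Fin 5 → ℝ)} {O : Opens (Fin 5 → ℝ)}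

/-! ### The fourth-order operator on homogeneous extensions -/

namespace Rep

/-- The radial part of ∂̄ contributes w times the contraction with x, which vanishes by
transversality. -/
theorem div (hV : IsOpen V) (hO : V ∩ deSitter ⊆ O) {v : Fin 5 → Scalar} {A : Fin 5 → Fld O}
    (hv : ∀ α, Rep V (v α) (A α)) (w : ℝ) (hA : ∀ α, N eta5 (A α) = w • A α)
    (hx : ∑ α, gen eta5 0 α (A α) = 0) :
    Rep V (fun x => ∑ α, eta5 α * SixCone.dbar α (v α) x) (∑ α, gen eta5 2 α (A α)) := by
  refine (Rep.sum fun α => ((hv α).dbar hV hO α).const_mul (eta5 α)).congr_eq ?_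
  have : ∀ α, eta5 α • eta5 α • (gen eta5 2 α (A α) + gen eta5 0 α (N eta5 (A α))) =
      gen eta5 2 α (A α) + w • gen eta5 0 α (A α) := by
    intro α
    rw [smul_smul, IsSignature.mul_self, one_smul, hA, map_smul]
  rw [Finset.sum_congr rfl fun α _ => this α, Finset.sum_add_distrib, ← Finset.smul_sum, hx,
    smul_zero, add_zero]

theorem D2 (hV : IsOpen V) (hO : V ∩ deSitter ⊆ O) {v : Covector} {A : Fin 5 → Fld O}
    (hv : ∀ α, Rep V (v α) (A α)) (α β : Fin 5) :
    Rep V (D2 v α β)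
      ((eta5 α • (gen eta5 2 α (A β) + gen eta5 0 α (N eta5 (A β))) - eta5 α • gen eta5 0 α (A β))
        + (eta5 β • (gen eta5 2 β (A α) + gen eta5 0 β (N eta5 (A α)))
          - eta5 β • gen eta5 0 β (A α))) :=
  (((hv β).dbar hV hO α).sub ((hv β).low_mul α)).add
    (((hv α).dbar hV hO β).sub ((hv α).low_mul β))

theorem Q2 (hV : IsOpen V) (hO : V ∩ deSitter ⊆ O) {K : Tensor2} {A : Fin 5 → Fin 5 → Fld O}
    (hK : ∀ α β, Rep V (K α β) (A α β)) (w : ℝ) (hA : ∀ α β, N eta5 (A α β) = w • A α β)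
    (hx : ∀ β, ∑ α, gen eta5 0 α (A α β) = 0) (α β : Fin 5) :
    Rep V (Q2 K α β) (-box eta5 (A α β) - (w * (w + 3)) • A α β - (6 : ℝ) • A α β
      + (2 : ℝ) • (eta5 α • gen eta5 0 α (∑ γ, gen eta5 2 γ (A γ β))
        + eta5 β • gen eta5 0 β (∑ γ, gen eta5 2 γ (A γ α)))
      + (2 * etaLow α β) • ∑ γ, eta5 γ • A γ γ) := by
  have hdiv : ∀ β, Rep V (divT K β) (∑ γ, gen eta5 2 γ (A γ β)) := fun β =>
    Rep.div hV hO (fun γ => hK γ β) w (fun γ => hA γ β) (hx β)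
  have hxdot : ∀ β, Rep V (xdot K β) (0 : Fld O) := fun β =>
    (Rep.sum fun γ => (hK γ β).coord_mul γ).congr_eq (hx β)
  have htr : Rep V (trace K) (∑ γ, eta5 γ • A γ γ) := Rep.sum fun γ => (hK γ γ).const_mul (eta5 γ)
  refine Rep.congr_eq (((((hK α β).Q0 hV hO w (hA α β)).sub ((hK α β).const_mul 6)).add
    ((((hdiv β).low_mul α).add ((hdiv α).low_mul β)).const_mul 2)).add
    (htr.const_mul (2 * etaLow α β)) |>.sub
    ((((hxdot β).dbar hV hO α).add ((hxdot α).dbar hV hO β)).const_mul 2)) ?_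
  simp

end Rep

/-- The components of a symmetric, transverse, traceless tensor that is homogeneous of degree zero. -/
structure IsHomTT (κ : Fin 5 → Fin 5 → Fld O) : Prop where
  symm : ∀ α β, κ α β = κ β α
  deg : ∀ α β, N eta5 (κ α β) = 0
  zdeg : ∀ α β, Nz eta5 (κ α β) = 0
  transverse : ∀ β, ∑ α, gen eta5 0 α (κ α β) = 0
  traceless : ∑ α, eta5 α • κ α α = 0

/-- The divergence of a tensor. -/
def dvg (κ : Fin 5 → Fin 5 → Fld O) (β : Fin 5) : Fld O := ∑ α, gen eta5 2 α (κ α β)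

/-- The double divergence of a tensor. -/
def dvg2 (κ : Fin 5 → Fin 5 → Fld O) : Fld O := ∑ β, gen eta5 2 β (dvg κ β)

/-- The components of the operator `bach`. -/
def bachComp (κ : Fin 5 → Fin 5 → Fld O) (α β : Fin 5) : Fld O :=
  box eta5 (box eta5 (κ α β)) - eta5 α • gen eta5 2 α (box eta5 (dvg κ β))
    - eta5 β • gen eta5 2 β (box eta5 (dvg κ α))
    + (2 / 3 : ℝ) • eta5 α • eta5 β • gen eta5 2 α (gen eta5 2 β (dvg2 κ))

namespace IsHomTT

variable {κ : Fin 5 → Fin 5 → Fld O}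

theorem N_dvg (h : IsHomTT κ) (β : Fin 5) : N eta5 (dvg κ β) = (-1 : ℝ) • dvg κ β := by
  simp only [dvg, map_sum, N_gen_two, h.deg, map_zero, zero_sub, Finset.smul_sum, neg_one_smul]

theorem N_dvg2 (h : IsHomTT κ) : N eta5 (dvg2 κ) = (-2 : ℝ) • dvg2 κ := by
  simp only [dvg2, map_sum, N_gen_two, h.N_dvg, map_smul, Finset.smul_sum]
  exact Finset.sum_congr rfl fun _ _ => by module

theorem transverse' (h : IsHomTT κ) (α : Fin 5) : ∑ β, gen eta5 0 β (κ α β) = 0 := by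
  simp only [h.symm α, h.transverse]

/-- Differentiate transversality and contract: moving the derivative past the coordinate costs the
trace, which is zero. -/
theorem transverse_dvg (h : IsHomTT κ) : ∑ β, gen eta5 0 β (dvg κ β) = 0 := by
  have h1 : ∑ α, gen eta5 2 α (∑ β, gen eta5 0 β (κ α β)) = 0 := by simp [h.transverse']
  simp only [map_sum, gen_two_zero, Finset.sum_add_distrib] at h1
  rw [Finset.sum_comm] at h1
  simp only [dvg, map_sum]
  simpa [h.traceless] using h1

theorem transverse_box (h : IsHomTT κ) (β : Fin 5) :
    ∑ α, gen eta5 0 α (box eta5 (κ α β)) = -((2 : ℝ) • dvg κ β) := by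
  have h1 : box eta5 (∑ α, gen eta5 0 α (κ α β)) = 0 := by rw [h.transverse, map_zero]
  simp only [map_sum, box_gen_zero, Finset.sum_add_distrib, ← Finset.smul_sum] at h1
  exact eq_neg_of_add_eq_zero_left h1

/-- The tensor `(Q₂ + 6) k + D₂ ∂̄·k` in terms of a homogeneous extension. -/
theorem rep_innerPart (h : IsHomTT κ) (hV : IsOpen V) (hO : V ∩ deSitter ⊆ O) {k : Tensor2}
    (hk : ∀ α β, Rep V (k α β) (κ α β)) (α β : Fin 5) :
    Rep V (innerPart k α β) (-box eta5 (κ α β) + eta5 α • gen eta5 2 α (dvg κ β)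
      + eta5 β • gen eta5 2 β (dvg κ α)) := by
  have hdiv : ∀ β, Rep V (divT k β) (dvg κ β) := fun β =>
    Rep.div hV hO (fun γ => hk γ β) 0 (fun γ => by simp [h.deg]) (h.transverse β)
  refine Rep.congr_eq (((Rep.Q2 hV hO hk 0 (by simp [h.deg]) h.transverse α β).add
    ((hk α β).const_mul 6)).add (Rep.D2 hV hO hdiv α β)) ?_
  rw [h.traceless, h.N_dvg, h.N_dvg]
  change _ + (2 : ℝ) • (eta5 α • gen eta5 0 α (dvg κ β) + eta5 β • gen eta5 0 β (dvg κ α)) + _ + _ + _ = _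
  simp only [map_smul]
  module

/-- The reduction of the fourth-order operator to flat derivatives of the degree-zero extension. The
inner bracket is again transverse and homogeneous, so the formula for Q₂ applies a second time. -/
theorem conformalOperator_eq (h : IsHomTT κ) (hV : IsOpen V) (hO : V ∩ deSitter ⊆ O) {k : Tensor2}
    (hk : ∀ α β, Rep V (k α β) (κ α β)) (α β : Fin 5) {x : Fin 5 → ℝ} (hx : x ∈ V ∩ deSitter) :
    conformalOperator k α β x = bachComp κ α β (x, 0)
      + 1 / 3 * theta α β x * box eta5 (dvg2 κ) (x, 0) := by
  have hdiv : ∀ β, Rep V (divT k β) (dvg κ β) := fun β =>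
    Rep.div hV hO (fun γ => hk γ β) 0 (fun γ => by simp [h.deg]) (h.transverse β)
  have hdiv2 : Rep V (divV (divT k)) (dvg2 κ) :=
    Rep.div hV hO hdiv (-1) h.N_dvg h.transverse_dvg
  -- W represents the inner bracket: degree −2, transverse, with trace twice the double divergence
  -- and divergence the gradient of the double divergence.
  let W : Fin 5 → Fin 5 → Fld O := fun α β => -box eta5 (κ α β) + eta5 α • gen eta5 2 α (dvg κ β)
      + eta5 β • gen eta5 2 β (dvg κ α)
  have hW : ∀ α β, Rep V (innerPart k α β) (W α β) := h.rep_innerPart hV hO hk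
  have hWN : ∀ α β, N eta5 (W α β) = (-2 : ℝ) • W α β := by
    intro α β
    simp [W, N_gen_two, h.N_dvg, h.deg]
    module
  have hWx : ∀ β, ∑ α, gen eta5 0 α (W α β) = 0 := by
    intro β
    have h1 : ∑ α, gen eta5 0 α (gen eta5 2 β (dvg κ α)) = -(eta5 β • dvg κ β) := by
      have h2 : gen eta5 2 β (∑ α, gen eta5 0 α (dvg κ α)) = 0 := by rw [h.transverse_dvg, map_zero]
      simp only [map_sum, gen_two_zero, Finset.sum_add_distrib] at h2
      rw [eq_neg_of_add_eq_zero_left h2]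
      simp
    simp only [W, map_add, map_neg, map_smul, Finset.sum_add_distrib, Finset.sum_neg_distrib,
      h.transverse_box, sum_gen_zero_two, ← Finset.smul_sum, h1, h.N_dvg, smul_neg, smul_smul,
      IsSignature.mul_self]
    module
  have hWtr : ∑ γ, eta5 γ • W γ γ = (2 : ℝ) • dvg2 κ := by
    have h1 : ∑ γ, eta5 γ • box eta5 (κ γ γ) = 0 := by
      simp only [← map_smul, ← map_sum, h.traceless, map_zero]
    simp only [W, smul_add, smul_neg, Finset.sum_add_distrib, Finset.sum_neg_distrib, h1, smul_smul,
      IsSignature.mul_self, one_smul, dvg2]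
    module
  have hWdiv : ∀ β, ∑ γ, gen eta5 2 γ (W γ β) = eta5 β • gen eta5 2 β (dvg2 κ) := by
    intro β
    have h1 : ∑ γ, gen eta5 2 γ (gen eta5 2 β (dvg κ γ)) = gen eta5 2 β (dvg2 κ) := by
      simp only [dvg2, map_sum, gen_two_two β]
    have h2 : ∑ γ, gen eta5 2 γ (box eta5 (κ γ β)) = box eta5 (dvg κ β) := by
      simp only [dvg, map_sum, box_gen_two]
    simp only [W, map_add, map_neg, map_smul, Finset.sum_add_distrib, Finset.sum_neg_distrib,
      sum_gen_two_two, ← Finset.smul_sum, h1, h2]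
    module
  have hD1 : ∀ α, Rep V (D1 (divV (divT k)) α)
      (eta5 α • (gen eta5 2 α (dvg2 κ) - (2 : ℝ) • gen eta5 0 α (dvg2 κ))) := fun α =>
    (hdiv2.dbar hV hO α).congr_eq (by rw [h.N_dvg2, map_smul]; module)
  -- For w = −2 the zeroth-order coefficient −w(w + 3) − 6 + 4 of (Q₂ + 4)W vanishes.
  have e1 := (Rep.Q2 hV hO hW (-2) hWN hWx α β).2 x hx
  have e2 := (hW α β).2 x hx
  have e3 := (Rep.D2 hV hO hD1 α β).2 x hx
  have e4 := (hdiv2.Q0 hV hO (-2) h.N_dvg2).2 x hx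
  have e5 := hdiv2.2 x hx
  rw [hWtr, hWdiv, hWdiv] at e1
  simp only [conformalOperator, e1, e2, e3, e4, e5]
  have hboxW : box eta5 (W α β) = -box eta5 (box eta5 (κ α β))
      + eta5 α • gen eta5 2 α (box eta5 (dvg κ β)) + eta5 β • gen eta5 2 β (box eta5 (dvg κ α)) := by
    simp [W, box_gen_two]
  have h22 : gen eta5 2 β (gen eta5 2 α (dvg2 κ)) = gen eta5 2 α (gen eta5 2 β (dvg2 κ)) :=
    gen_two_two β α _
  have hif : ∀ c : ℝ, (if β = α then eta5 β else 0) * c = (if α = β then eta5 α else 0) * c := by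
    intro c
    by_cases hαβ : α = β
    · rw [if_pos hαβ, if_pos hαβ.symm, hαβ]
    · rw [if_neg hαβ, if_neg (Ne.symm hαβ)]
  have hη : eta5 α * eta5 β * (if α = β then eta5 α else 0) = if α = β then eta5 α else 0 := by
    by_cases hαβ : α = β
    · rw [if_pos hαβ, ← hαβ, IsSignature.mul_self, one_mul]
    · rw [if_neg hαβ, mul_zero]
  simp only [hboxW, bachComp, map_smul, map_sub, N_gen_two, N_gen_zero, h.N_dvg2, gen_two_zero, h22,
    coe_add_apply, coe_sub_apply, coe_neg_apply, coe_smul_apply, gen_zero_apply, theta, etaLow, low,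
    map_add, hif]
  linear_combination (-4 / 3 * dvg2 κ (x, 0)) * hη

theorem bachComp_symm (h : IsHomTT κ) (α β : Fin 5) : bachComp κ α β = bachComp κ β α := by
  rw [bachComp, bachComp, h.symm α β, gen_two_two α β]
  module

theorem conformalOperator_symm (h : IsHomTT κ) (hV : IsOpen V) (hO : V ∩ deSitter ⊆ O) {k : Tensor2}
    (hk : ∀ α β, Rep V (k α β) (κ α β)) (α β : Fin 5) {x : Fin 5 → ℝ} (hx : x ∈ V ∩ deSitter) :
    conformalOperator k α β x = conformalOperator k β α x := by
  rw [h.conformalOperator_eq hV hO hk α β hx, h.conformalOperator_eq hV hO hk β α hx,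
    h.bachComp_symm α β]
  congr 3
  by_cases hαβ : α = β
  · rw [hαβ]
  · simp [theta, etaLow, hαβ, Ne.symm hαβ, mul_comm]

end IsHomTT

/-! ### Contraction with the auxiliary vector -/

section Contraction

variable {n : ℕ} {Ω : Opens (Fin n → ℝ)} (η : Fin n → ℝ)

/-- The contraction of the indices of a tensor with the auxiliary vector. -/
def contr (κ : Fin n → Fin n → Fld Ω) : Fld Ω := ∑ α, ∑ β, gen η 1 α (gen η 1 β (κ α β))

/-- The contraction of the index of a covector with the auxiliary vector. -/
def contr1 (ξ : Fin n → Fld Ω) : Fld Ω := ∑ α, gen η 1 α (ξ α)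

@[simp] theorem gen_one_apply (α : Fin n) (F : Fld Ω) (p : Pt n) :
    gen η 1 α F p = p.2 α * F p := rfl

theorem contr_apply (κ : Fin n → Fin n → Fld Ω) (p : Pt n) :
    contr η κ p = ∑ α, ∑ β, p.2 α * (p.2 β * κ α β p) := by
  simp [contr]

theorem contr1_apply (ξ : Fin n → Fld Ω) (p : Pt n) : contr1 η ξ p = ∑ α, p.2 α * ξ α p := by
  simp [contr1]

variable [h : IsSignature η]

theorem box_gen_one (α : Fin n) (F : Fld Ω) : box η (gen η 1 α F) = gen η 1 α (box η F) := by
  rw [box, ctr_gen h.mul_self]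
  simp [sympl]

theorem D_gen_one (α : Fin n) (F : Fld Ω) : D η (gen η 1 α F) = gen η 1 α (D η F) + gen η 2 α F := by
  rw [D, ctr_gen h.mul_self]
  simp [sympl]

theorem N_gen_one (α : Fin n) (F : Fld Ω) : N η (gen η 1 α F) = gen η 1 α (N η F) := by
  rw [N, ctr_gen h.mul_self]
  simp [sympl]

theorem Nz_gen_one (α : Fin n) (F : Fld Ω) : Nz η (gen η 1 α F) = gen η 1 α (Nz η F) + gen η 1 α F := by
  rw [Nz, ctr_gen h.mul_self]
  simp [sympl]

theorem I_gen_one (α : Fin n) (F : Fld Ω) : I η (gen η 1 α F) = gen η 1 α (I η F) + gen η 0 α F := by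
  rw [I, ctr_gen h.mul_self]
  simp [sympl]

theorem T_gen_one (α : Fin n) (F : Fld Ω) : T η (gen η 1 α F) = gen η 1 α (T η F) + (2 : ℝ) • gen η 3 α F := by
  rw [T, ctr_gen h.mul_self]
  simp [sympl]
  module

theorem N_contr_eq_zero {κ : Fin n → Fin n → Fld Ω} (hκ : ∀ α β, N η (κ α β) = 0) :
    N η (contr η κ) = 0 := by
  simp [contr, N_gen_one, hκ]

theorem Nz_contr {κ : Fin n → Fin n → Fld Ω} (hκ : ∀ α β, Nz η (κ α β) = 0) :
    Nz η (contr η κ) = (2 : ℝ) • contr η κ := by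
  simp only [contr, map_sum, Nz_gen_one, hκ, map_zero, zero_add, Finset.smul_sum]
  exact Finset.sum_congr rfl fun _ _ => Finset.sum_congr rfl fun _ _ => by module

theorem box_contr (κ : Fin n → Fin n → Fld Ω) :
    box η (contr η κ) = contr η fun α β => box η (κ α β) := by
  simp [contr, box_gen_one]

theorem Nz_contr1 {ξ : Fin n → Fld Ω} (hξ : ∀ α, Nz η (ξ α) = 0) :
    Nz η (contr1 η ξ) = contr1 η ξ := by
  simp [contr1, Nz_gen_one, hξ]

theorem N_contr1 {ξ : Fin n → Fld Ω} {w : ℝ} (hξ : ∀ α, N η (ξ α) = w • ξ α) :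
    N η (contr1 η ξ) = w • contr1 η ξ := by
  simp [contr1, N_gen_one, hξ, Finset.smul_sum]

theorem box_contr1 (ξ : Fin n → Fld Ω) :
    box η (contr1 η ξ) = contr1 η fun α => box η (ξ α) := by
  simp [contr1, box_gen_one]

theorem gen_comm_of_eq_zero {p q : Fin 4} (hpq : sympl p q = 0) (α β : Fin n) (F : Fld Ω) :
    gen η p α (gen η q β F) = gen η q β (gen η p α F) := by
  rw [gen_comm, hpq]
  simp

theorem G_eq_contr1 (F : Fld Ω) : G η F = contr1 η fun α => η α • gen η 2 α F := by
  simp only [G, ctr_apply, contr1, map_smul]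

theorem Nz_gen_two {α : Fin n} {F : Fld Ω} (hF : Nz η F = 0) : Nz η (gen η 2 α F) = 0 := by
  rw [Nz, ctr_gen h.mul_self, ← Nz, hF]
  simp [sympl]

end Contraction

namespace IsHomTT

variable {κ : Fin 5 → Fin 5 → Fld O}

theorem Nz_dvg (h : IsHomTT κ) (β : Fin 5) : Nz eta5 (dvg κ β) = 0 := by
  simp [dvg, Nz_gen_two eta5 (h.zdeg _ _)]

theorem Nz_dvg2 (h : IsHomTT κ) : Nz eta5 (dvg2 κ) = 0 := by
  simp [dvg2, Nz_gen_two eta5 (h.Nz_dvg _)]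

theorem Nz_bachComp (h : IsHomTT κ) (α β : Fin 5) : Nz eta5 (bachComp κ α β) = 0 := by
  have hD : ∀ α β, Nz eta5 (gen eta5 2 α (box eta5 (dvg κ β))) = 0 := fun α β =>
    Nz_gen_two eta5 (by rw [Nz_box, h.Nz_dvg, map_zero])
  simp only [bachComp, map_sub, map_add, map_smul, hD, Nz_box, h.zdeg, map_zero,
    Nz_gen_two eta5 (Nz_gen_two eta5 h.Nz_dvg2)]
  simp

theorem I_contr (h : IsHomTT κ) : I eta5 (contr eta5 κ) = 0 := by
  simp only [contr, map_sum, I_gen_one, I_eq_zero eta5 (h.zdeg _ _), map_zero, zero_add,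
    gen_comm_of_eq_zero eta5 (p := 0) (q := 1) (by simp [sympl]), Finset.sum_add_distrib]
  rw [Finset.sum_comm (f := fun α β => gen eta5 1 β (gen eta5 0 α (κ α β)))]
  simp only [← map_sum, h.transverse, h.transverse', map_zero, Finset.sum_const_zero, add_zero]

theorem T_contr (h : IsHomTT κ) : T eta5 (contr eta5 κ) = 0 := by
  have h3 : ∀ α β γ, gen eta5 3 α (gen eta5 1 β (κ β γ)) =
      (if α = β then eta5 α else 0) • κ β γ := by
    intro α β γ
    rw [gen_comm, gen_three_eq_zero eta5 (h.zdeg _ _)]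
    simp [sympl]
  have h4 : ∀ α β, T eta5 (gen eta5 1 α (gen eta5 1 β (κ α β))) =
      (2 : ℝ) • (if α = β then eta5 α else 0) • κ α β := by
    intro α β
    rw [T_gen_one, T_gen_one, T_eq_zero eta5 (h.zdeg _ _), gen_three_eq_zero eta5 (h.zdeg _ _),
      h.symm α β, h3]
    by_cases hαβ : α = β
    · subst hαβ
      simp
    · simp [hαβ]
  simp only [contr, map_sum, h4, ← Finset.smul_sum]
  simp [h.traceless]

theorem D_contr (h : IsHomTT κ) : D eta5 (contr eta5 κ) = (2 : ℝ) • contr1 eta5 (dvg κ) := by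
  simp only [contr, map_sum, D_gen_one, D_eq_zero eta5 (h.zdeg _ _), map_zero, zero_add,
    gen_comm_of_eq_zero eta5 (p := 2) (q := 1) (by simp [sympl] : sympl 2 1 = 0), Finset.sum_add_distrib]
  rw [Finset.sum_comm (f := fun α β => gen eta5 1 β (gen eta5 2 α (κ α β)))]
  simp only [← map_sum, contr1, dvg, fun α β => h.symm α β]
  module

theorem D_D_contr (h : IsHomTT κ) : D eta5 (D eta5 (contr eta5 κ)) = (2 : ℝ) • dvg2 κ := by
  rw [h.D_contr, map_smul, contr1, map_sum]
  simp only [D_gen_one, D_eq_zero eta5 (h.Nz_dvg _), map_zero, zero_add, dvg2]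

/-- Each divergence of the contracted field picks up a factor 2 or 1 according to the remaining
slots, which turns the coefficient 1/3 of `bach` into the 2/3 of the components. -/
theorem contr_bachComp (h : IsHomTT κ) : contr eta5 (bachComp κ) = bach eta5 (contr eta5 κ) := by
  have h12 : ∀ (α β : Fin 5) (F : Fld O),
      gen eta5 2 α (gen eta5 1 β F) = gen eta5 1 β (gen eta5 2 α F) :=
    gen_comm_of_eq_zero eta5 (by simp [sympl])
  have h1 : ∑ α, ∑ β, gen eta5 1 α (gen eta5 1 β (eta5 α • gen eta5 2 α (box eta5 (dvg κ β)))) =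
      G eta5 (contr1 eta5 (fun β => box eta5 (dvg κ β))) := by
    simp only [G_eq_contr1, contr1, map_sum, map_smul, h12]
    exact Finset.sum_comm
  have h2 : ∑ α, ∑ β, gen eta5 1 α (gen eta5 1 β (eta5 β • gen eta5 2 β (box eta5 (dvg κ α)))) =
      G eta5 (contr1 eta5 (fun β => box eta5 (dvg κ β))) := by
    rw [← h1, Finset.sum_comm]
    refine Finset.sum_congr rfl fun α _ => Finset.sum_congr rfl fun β _ => ?_
    rw [gen_comm_of_eq_zero eta5 (by simp [sympl] : sympl 1 1 = 0)]
  have h3 : ∑ α, ∑ β, gen eta5 1 α (gen eta5 1 β (eta5 α • eta5 β •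
      gen eta5 2 α (gen eta5 2 β (dvg2 κ)))) = G eta5 (G eta5 (dvg2 κ)) := by
    simp only [G_eq_contr1, contr1, map_sum, map_smul, h12, Finset.smul_sum]
    rw [Finset.sum_comm]
    simp only [smul_comm (eta5 _) (eta5 _)]
  rw [bach, D_box, h.D_D_contr, h.D_contr, map_smul, map_smul, map_smul, map_smul, box_contr1,
    box_contr, box_contr]
  simp only [contr, bachComp, map_add, map_sub, Finset.sum_add_distrib, Finset.sum_sub_distrib, h1,
    h2, map_smul (gen eta5 1 _) (2 / 3 : ℝ), ← Finset.smul_sum, h3]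
  module

/-- The conformal equation holds at a point if and only if it holds after contraction with an
arbitrary vector. -/
theorem conformalOperator_eq_zero_iff (h : IsHomTT κ) (hV : IsOpen V) (hO : V ∩ deSitter ⊆ O)
    {k : Tensor2} (hk : ∀ α β, Rep V (k α β) (κ α β)) {x : Fin 5 → ℝ} (hx : x ∈ V ∩ deSitter) :
    (∀ α β, conformalOperator k α β x = 0) ↔ ∀ z, (bach eta5 (contr eta5 κ) + (1 / 6 : ℝ) •
      thetaMul eta5 (box eta5 (D eta5 (D eta5 (contr eta5 κ))))) (x, z) = 0 := by
  have key : ∀ z, (bach eta5 (contr eta5 κ) + (1 / 6 : ℝ) •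
      thetaMul eta5 (box eta5 (D eta5 (D eta5 (contr eta5 κ))))) (x, z) =
      ∑ α, ∑ β, z α * (z β * conformalOperator k α β x) := by
    intro z
    have h1 : ∀ α β, bachComp κ α β (x, z) = bachComp κ α β (x, 0) := fun α β =>
      eq_of_Nz_eq_zero eta5 (h.Nz_bachComp α β) x z
    have h2 : box eta5 (dvg2 κ) (x, z) = box eta5 (dvg2 κ) (x, 0) :=
      eq_of_Nz_eq_zero eta5 (by rw [Nz_box, h.Nz_dvg2, map_zero]) x z
    have h3 : ∑ α, ∑ β, z α * (z β * theta α β x) = bil eta5 z z + bil eta5 x z ^ 2 := by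
      simp only [theta, mul_add, Finset.sum_add_distrib]
      congr 1
      · simp [etaLow, bil]
        exact Finset.sum_congr rfl fun _ _ => by ring
      · rw [sq, bil, Finset.sum_mul_sum]
        exact Finset.sum_congr rfl fun _ _ => Finset.sum_congr rfl fun _ _ => by
          simp only [low]; ring
    have h4 : ∀ α β, z α * (z β * conformalOperator k α β x) = z α * (z β * bachComp κ α β (x, z))
        + 1 / 3 * box eta5 (dvg2 κ) (x, z) * (z α * (z β * theta α β x)) := by
      intro α β
      rw [h.conformalOperator_eq hV hO hk α β hx, h1, h2]
      ring
    simp only [h4, Finset.sum_add_distrib, ← Finset.mul_sum]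
    rw [coe_add_apply, ← h.contr_bachComp, contr_apply, h.D_D_contr, Finset.mul_sum]
    simp only [← Finset.mul_sum] at h3 ⊢
    simp only [h3, coe_smul_apply, thetaMul, map_smul, coe_add_apply, Z_apply,
      X_apply]
    ring
  constructor
  · intro hc z
    rw [key]
    simp [hc]
  · intro hz α β
    have hq : ∀ z : Fin 5 → ℝ, ∑ α, ∑ β, z α * (z β * conformalOperator k α β x) = 0 := fun z => by
      rw [← key, hz]
    have hs := h.conformalOperator_symm hV hO hk α β hx
    -- Polarisation of the quadratic form, using symmetry of the components.
    have e1 := hq (Pi.single α 1)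
    have e2 := hq (Pi.single β 1)
    have e3 := hq (Pi.single α 1 + Pi.single β 1)
    simp [Pi.single_apply, add_mul, mul_add, Finset.sum_add_distrib] at e1 e2 e3
    linarith

end IsHomTT

end Fld

/-! ### Homogeneous extensions of fields on de Sitter space -/

theorem radius_pos {x : Fin 5 → ℝ} (hx : Fld.bil eta5 x x < 0) : 0 < radius x :=
  Real.sqrt_pos.2 (neg_pos.2 hx)

theorem radius_sq {x : Fin 5 → ℝ} (hx : Fld.bil eta5 x x < 0) :
    radius x ^ 2 = -Fld.bil eta5 x x := Real.sq_sqrt (neg_pos.2 hx).le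

theorem radius_smul {t : ℝ} (ht : 0 < t) (x : Fin 5 → ℝ) : radius (t • x) = t * radius x := by
  rw [radius, Fld.bil_smul_left, Fld.bil_smul_right, ← mul_assoc, ← mul_neg,
    Real.sqrt_mul (mul_pos ht ht).le, Real.sqrt_mul_self ht.le, radius]

theorem radius_eq_one {x : Fin 5 → ℝ} (hx : x ∈ deSitter) : radius x = 1 := by
  rw [radius, mem_deSitter_iff.1 hx]
  simp

theorem bil_neg_of_mem_deSitter {x : Fin 5 → ℝ} (hx : x ∈ deSitter) : Fld.bil eta5 x x < 0 := by
  rw [mem_deSitter_iff.1 hx]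
  norm_num

/-- The point of de Sitter space on the ray through a given point. -/
def normalize (x : Fin 5 → ℝ) : Fin 5 → ℝ := (radius x)⁻¹ • x

theorem normalize_smul {t : ℝ} (ht : 0 < t) (x : Fin 5 → ℝ) : normalize (t • x) = normalize x := by
  rw [normalize, radius_smul ht, smul_smul, mul_inv, mul_right_comm, inv_mul_cancel₀ ht.ne', one_mul,
    normalize]

theorem normalize_eq_self {x : Fin 5 → ℝ} (hx : x ∈ deSitter) : normalize x = x := by
  rw [normalize, radius_eq_one hx, inv_one, one_smul]

theorem radius_smul_normalize {x : Fin 5 → ℝ} (hx : Fld.bil eta5 x x < 0) :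
    radius x • normalize x = x := by
  rw [normalize, smul_smul, mul_inv_cancel₀ (radius_pos hx).ne', one_smul]

theorem normalize_mem_deSitter {x : Fin 5 → ℝ} (hx : Fld.bil eta5 x x < 0) :
    normalize x ∈ deSitter := by
  rw [mem_deSitter_iff, normalize, Fld.bil_smul_left, Fld.bil_smul_right, ← mul_assoc, ← mul_inv,
    ← sq, radius_sq hx, inv_neg, neg_mul, inv_mul_cancel₀ hx.ne]

theorem contDiffOn_inv_radius :
    ContDiffOn ℝ ∞ (fun x => (radius x)⁻¹) {x | Fld.bil eta5 x x < 0} :=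
  contDiffOn_radius.inv fun _ hx => (radius_pos hx).ne'

theorem contDiffOn_normalize : ContDiffOn ℝ ∞ normalize {x | Fld.bil eta5 x x < 0} :=
  contDiffOn_inv_radius.smul contDiffOn_id

theorem isOpen_timelike : IsOpen {x : Fin 5 → ℝ | Fld.bil eta5 x x < 0} :=
  isOpen_lt (contDiff_bil eta5).continuous continuous_const

/-- The cone over the part of de Sitter space in `V`. -/
def coneOver (V : Opens (Fin 5 → ℝ)) : Opens (Fin 5 → ℝ) :=
  ⟨{x | Fld.bil eta5 x x < 0} ∩ normalize ⁻¹' V,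
    contDiffOn_normalize.continuousOn.isOpen_inter_preimage isOpen_timelike V.2⟩

theorem mem_coneOver {V : Opens (Fin 5 → ℝ)} {x : Fin 5 → ℝ} :
    x ∈ coneOver V ↔ Fld.bil eta5 x x < 0 ∧ normalize x ∈ V := Iff.rfl

theorem inter_deSitter_subset_coneOver (V : Opens (Fin 5 → ℝ)) :
    (V : Set (Fin 5 → ℝ)) ∩ deSitter ⊆ coneOver V := fun x hx =>
  mem_coneOver.2 ⟨bil_neg_of_mem_deSitter hx.2, by rw [normalize_eq_self hx.2]; exact hx.1⟩

theorem mem_of_mem_coneOver {V : Opens (Fin 5 → ℝ)} {x : Fin 5 → ℝ} (hx : x ∈ coneOver V)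
    (hx1 : Fld.bil eta5 x x = -1) : x ∈ (V : Set (Fin 5 → ℝ)) ∩ deSitter := by
  have h := mem_deSitter_iff.2 hx1
  refine ⟨?_, h⟩
  have := (mem_coneOver.1 hx).2
  rwa [normalize_eq_self h] at this

theorem smul_mem_coneOver {V : Opens (Fin 5 → ℝ)} {x : Fin 5 → ℝ} (hx : x ∈ coneOver V) {t : ℝ}
    (ht : 0 < t) : t • x ∈ coneOver V := by
  refine mem_coneOver.2 ⟨?_, ?_⟩
  · rw [Fld.bil_smul_left, Fld.bil_smul_right, ← mul_assoc]
    exact mul_neg_of_pos_of_neg (mul_pos ht ht) hx.1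
  · rw [normalize_smul ht]
    exact hx.2

namespace Fld

variable {V : Opens (Fin 5 → ℝ)}

theorem contDiffOn_hom {f : Scalar} (hf : ContDiffOn ℝ ∞ f V) (j : ℕ) :
    ContDiffOn ℝ ∞ (fun p : Pt 5 => (radius p.1)⁻¹ ^ j * f (normalize p.1))
      ((coneOver V : Set (Fin 5 → ℝ)) ×ˢ univ) := by
  have h1 : MapsTo (Prod.fst : Pt 5 → Fin 5 → ℝ) ((coneOver V : Set (Fin 5 → ℝ)) ×ˢ univ)
      {x | Fld.bil eta5 x x < 0} := fun p hp => hp.1.1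
  exact ((contDiffOn_inv_radius.comp contDiff_fst.contDiffOn h1).pow j).mul
    (hf.comp (contDiffOn_normalize.comp contDiff_fst.contDiffOn h1) fun p hp => hp.1.2)

/-- The extension of a scalar field on de Sitter space that is homogeneous of degree `-j`. -/
def hom {f : Scalar} (hf : ContDiffOn ℝ ∞ f V) (j : ℕ) : Fld (coneOver V) :=
  mk _ (contDiffOn_hom hf j)

theorem hom_apply {f : Scalar} (hf : ContDiffOn ℝ ∞ f V) (j : ℕ) {p : Pt 5}
    (hp : p.1 ∈ coneOver V) : hom hf j p = (radius p.1)⁻¹ ^ j * f (normalize p.1) :=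
  mk_apply (contDiffOn_hom hf j) hp

theorem N_hom {f : Scalar} (hf : ContDiffOn ℝ ∞ f V) (j : ℕ) :
    N eta5 (hom hf j) = (-j : ℝ) • hom hf j := by
  refine ext_on fun ⟨u, z⟩ hu => ?_
  have hu' : u ∈ coneOver V := hu
  have h1 := hasDerivAt_smul_fst (hom hf j) (u := u) z (t := 1) (by rwa [one_smul])
  have h2 : HasDerivAt (fun t : ℝ => hom hf j (t • u, z)) (-j * hom hf j (u, z)) 1 := by
    have h3 : HasDerivAt (fun t : ℝ => t⁻¹ ^ j * hom hf j (u, z)) (-j * hom hf j (u, z)) 1 := by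
      have h4 := ((hasDerivAt_inv (one_ne_zero (α := ℝ))).fun_pow j).mul_const (hom hf j (u, z))
      refine h4.congr_deriv ?_
      simp
    refine h3.congr_of_eventuallyEq ?_
    filter_upwards [lt_mem_nhds (zero_lt_one (α := ℝ))] with t ht
    rw [hom_apply hf j (p := (t • u, z)) (smul_mem_coneOver hu' ht), hom_apply hf j hu]
    simp only [radius_smul ht, normalize_smul ht, mul_inv, mul_pow, mul_assoc]
  have h3 := h1.unique h2
  rw [one_smul] at h3
  rw [N_apply eta5 _ hu, coe_smul_apply]
  exact h3

theorem Nz_eq_zero_of_indep {n : ℕ} {Ω : Opens (Fin n → ℝ)} (η : Fin n → ℝ) [IsSignature η]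
    {f : Fld Ω} (hf : ∀ u ∈ Ω, ∀ z z', f (u, z) = f (u, z')) : Nz η f = 0 := by
  refine ext_on fun ⟨u, z⟩ hu => ?_
  have hu' : u ∈ Ω := hu
  have h1 : HasFDerivAt (fun y : Fin n → ℝ => f (u, y))
      ((fderiv ℝ (f : Pt n → ℝ) (u, z)).comp (.inr ℝ _ _)) z :=
    (differentiableAt f (p := (u, z)) hu).hasFDerivAt.comp z (hasFDerivAt_prodMk_right u z)
  have h2 : (fun y : Fin n → ℝ => f (u, y)) = fun _ => f (u, 0) := funext fun y => hf u hu' y 0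
  rw [h2] at h1
  have h3 := congrArg (· z) (h1.unique (hasFDerivAt_const _ _))
  rw [Nz_apply η _ hu]
  simpa using h3

theorem Nz_hom {f : Scalar} (hf : ContDiffOn ℝ ∞ f V) (j : ℕ) : Nz eta5 (hom hf j) = 0 :=
  Nz_eq_zero_of_indep eta5 fun u hu z z' => by
    rw [hom_apply hf j (p := (u, z)) hu, hom_apply hf j (p := (u, z')) hu]

theorem rep_hom {f : Scalar} (hf : ContDiffOn ℝ ∞ f V) (j : ℕ) : Rep V f (hom hf j) :=
  ⟨hf, fun x hx => by
    rw [hom_apply hf j (p := (x, 0)) (inter_deSitter_subset_coneOver V hx)]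
    simp [radius_eq_one hx.2, normalize_eq_self hx.2]⟩

end Fld

/-- `k` is a smooth symmetric, transverse and traceless tensor field on the part of de Sitter space
in the open set `V`. -/
structure IsTT (V : Opens (Fin 5 → ℝ)) (k : Tensor2) : Prop where
  smooth : ∀ α β, ContDiffOn ℝ ∞ (k α β) V
  symm : ∀ x ∈ (V : Set (Fin 5 → ℝ)) ∩ deSitter, ∀ α β, k α β x = k β α x
  transverse : ∀ x ∈ (V : Set (Fin 5 → ℝ)) ∩ deSitter, ∀ β, xdot k β x = 0
  traceless : ∀ x ∈ (V : Set (Fin 5 → ℝ)) ∩ deSitter, trace k x = 0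

namespace IsTT

open Fld

variable {V : Opens (Fin 5 → ℝ)} {k : Tensor2}

theorem normalize_mem {x : Fin 5 → ℝ} (hx : x ∈ coneOver V) :
    normalize x ∈ (V : Set (Fin 5 → ℝ)) ∩ deSitter := ⟨hx.2, normalize_mem_deSitter hx.1⟩

theorem isHomTT (h : IsTT V k) : IsHomTT fun α β => hom (h.smooth α β) 0 where
  symm α β := ext_on fun p hp => by
    rw [hom_apply _ _ hp, hom_apply _ _ hp, h.symm _ (normalize_mem hp)]
  deg α β := by simp [N_hom]
  zdeg α β := Nz_hom _ _
  transverse β := ext_on fun p hp => by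
    have h1 := h.transverse _ (normalize_mem hp) β
    simp only [coe_sum_apply, gen_zero_apply, hom_apply _ _ hp, pow_zero, one_mul]
    simp only [xdot] at h1
    have h2 : ∀ α, p.1 α = radius p.1 * normalize p.1 α := fun α =>
      (congrFun (radius_smul_normalize hp.1) α).symm
    have h3 : ∀ α, p.1 α * k α β (normalize p.1) =
        radius p.1 * (normalize p.1 α * k α β (normalize p.1)) := fun α => by
      rw [← mul_assoc, ← h2]
    rw [Finset.sum_congr rfl fun α _ => h3 α, ← Finset.mul_sum, h1, mul_zero]
    rfl
  traceless := ext_on fun p hp => by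
    have h1 := h.traceless _ (normalize_mem hp)
    simp only [trace] at h1
    simp only [coe_sum_apply, coe_smul_apply, hom_apply _ _ hp, pow_zero, one_mul]
    exact h1

/-- The homogeneous extension of a tensor field, contracted with the auxiliary vector. -/
def ext (h : IsTT V k) : Fld (coneOver V) := contr eta5 fun α β => hom (h.smooth α β) 0

theorem ext_apply (h : IsTT V k) {p : Pt 5} (hp : p.1 ∈ coneOver V) :
    h.ext p = ∑ α, ∑ β, p.2 α * (p.2 β * k α β (normalize p.1)) := by
  simp only [ext, contr_apply, hom_apply _ _ hp, pow_zero, one_mul]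

theorem N_ext (h : IsTT V k) : N eta5 h.ext = 0 := N_contr_eq_zero eta5 h.isHomTT.deg

theorem Nz_ext (h : IsTT V k) : Nz eta5 h.ext = (2 : ℝ) • h.ext := Nz_contr eta5 h.isHomTT.zdeg

theorem I_ext (h : IsTT V k) : I eta5 h.ext = 0 := h.isHomTT.I_contr

theorem T_ext (h : IsTT V k) : T eta5 h.ext = 0 := h.isHomTT.T_contr

theorem conformalOperator_eq_zero_iff (h : IsTT V k) {x : Fin 5 → ℝ}
    (hx : x ∈ (V : Set (Fin 5 → ℝ)) ∩ deSitter) :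
    (∀ α β, conformalOperator k α β x = 0) ↔ ∀ z, (bach eta5 h.ext + (1 / 6 : ℝ) •
      thetaMul eta5 (Fld.box eta5 (D eta5 (D eta5 h.ext)))) (x, z) = 0 := by
  unfold ext
  exact h.isHomTT.conformalOperator_eq_zero_iff V.2 (inter_deSitter_subset_coneOver V)
    (fun α β => rep_hom (h.smooth α β) 0) hx

end IsTT

/-! ### Tensors on the six-cone -/

@[simp] theorem toCone_castSucc (x : Fin 5 → ℝ) (i : Fin 5) : toCone x i.castSucc = x i := by
  simp [toCone]

@[simp] theorem toCone_last (x : Fin 5 → ℝ) : toCone x (Fin.last 5) = 1 :=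
  Fin.snoc_last (α := fun _ => ℝ) 1 x

@[simp] theorem proj5_toCone (x : Fin 5 → ℝ) : proj5 (toCone x) = x := by
  ext i
  simp

theorem contDiff_toCone : ContDiff ℝ ∞ toCone := by
  refine contDiff_pi.2 fun A => ?_
  refine Fin.lastCases ?_ (fun i => ?_) A
  · simp only [toCone_last]
    exact contDiff_const
  · simp only [toCone_castSucc]
    exact contDiff_apply ℝ ℝ i

theorem mem_cone_iff {u : Fin 6 → ℝ} : u ∈ cone ↔ u ≠ 0 ∧ Fld.bil eta6 u u = 0 := by
  simp only [cone, mem_ofPred_eq, Fld.bil, sq]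

theorem bil_toCone {x : Fin 5 → ℝ} (hx : x ∈ deSitter) :
    Fld.bil eta6 (toCone x) (toCone x) = 0 := by
  rw [bil_eta6, proj5_toCone, mem_deSitter_iff.1 hx, toCone_last]
  norm_num

theorem toCone_mem_cone {x : Fin 5 → ℝ} (hx : x ∈ deSitter) : toCone x ∈ cone :=
  mem_cone_iff.2 ⟨fun h => one_ne_zero ((toCone_last x).symm.trans (congrFun h (Fin.last 5))), bil_toCone hx⟩

/-- On the part of de Sitter space in `V`, the tensor field `ψ` is smooth along the section `(x, 1)`
of the cone, symmetric, transverse and traceless. -/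
structure ConeTT (V : Opens (Fin 5 → ℝ)) (ψ : SixTensor) : Prop where
  smooth : ∀ A B, ContDiffOn ℝ ∞ (fun x => ψ A B (toCone x)) V
  symm : ∀ x ∈ (V : Set (Fin 5 → ℝ)) ∩ deSitter, ∀ A B, ψ A B (toCone x) = ψ B A (toCone x)
  transverse : ∀ x ∈ (V : Set (Fin 5 → ℝ)) ∩ deSitter, ∀ B,
    ∑ A, toCone x A * ψ A B (toCone x) = 0
  traceless : ∀ x ∈ (V : Set (Fin 5 → ℝ)) ∩ deSitter, ∑ A, eta6 A * ψ A A (toCone x) = 0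

namespace ConeTT

open Fld

variable {V : Opens (Fin 5 → ℝ)} {ψ : SixTensor}

theorem transverse_toCone (h : ConeTT V ψ) {x : Fin 5 → ℝ}
    (hx : x ∈ (V : Set (Fin 5 → ℝ)) ∩ deSitter) (B : Fin 6) :
    ∑ γ, x γ * ψ γ.castSucc B (toCone x) = -ψ (Fin.last 5) B (toCone x) := by
  have := h.transverse _ hx B
  rw [Fin.sum_univ_castSucc] at this
  simp only [toCone_castSucc, toCone_last, one_mul] at this
  linarith

theorem traceless_toCone (h : ConeTT V ψ) {x : Fin 5 → ℝ}
    (hx : x ∈ (V : Set (Fin 5 → ℝ)) ∩ deSitter) :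
    ∑ γ, eta5 γ * ψ γ.castSucc γ.castSucc (toCone x) =
      -ψ (Fin.last 5) (Fin.last 5) (toCone x) := by
  have := h.traceless _ hx
  rw [Fin.sum_univ_castSucc] at this
  have h1 : ∀ i : Fin 5, eta6 i.castSucc = eta5 i := fun i => by fin_cases i <;> rfl
  have h2 : eta6 (Fin.last 5) = 1 := rfl
  simp only [h1, h2, one_mul] at this
  linarith

/-- Transversality at (x, 1) trades a contraction with x for minus an index 5. Contracted with y,
the result is ψ evaluated on (y, −x·y), the lift of y orthogonal to (x, 1). -/
theorem ambientTensor_eq (h : ConeTT V ψ) {x : Fin 5 → ℝ}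
    (hx : x ∈ (V : Set (Fin 5 → ℝ)) ∩ deSitter) (α β : Fin 5) :
    ambientTensor ψ α β x = ψ α.castSucc β.castSucc (toCone x)
      - low β x * ψ α.castSucc (Fin.last 5) (toCone x)
      - low α x * ψ β.castSucc (Fin.last 5) (toCone x)
      + low α x * low β x * ψ (Fin.last 5) (Fin.last 5) (toCone x) := by
  have h1 : ∀ B, ∑ γ : Fin 5, ψ B γ.castSucc (toCone x) * x γ = -ψ B (Fin.last 5) (toCone x) := by
    intro B
    rw [h.symm _ hx B, ← h.transverse_toCone hx]
    exact Finset.sum_congr rfl fun γ _ => by rw [h.symm _ hx B, mul_comm]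
  have h2 : ∑ γ : Fin 5, ∑ δ : Fin 5, x γ * ψ γ.castSucc δ.castSucc (toCone x) * x δ =
      ψ (Fin.last 5) (Fin.last 5) (toCone x) := by
    simp only [mul_assoc, ← Finset.mul_sum, h1, mul_neg, Finset.sum_neg_distrib,
      h.transverse_toCone hx, neg_neg]
  rw [ambientTensor, h1, h1, h2]
  ring

theorem contDiff_low (α : Fin 5) : ContDiff ℝ ∞ (low α) := by
  unfold low
  fun_prop

theorem contDiffOn_ambientTensor (h : ∀ A B, ContDiffOn ℝ ∞ (fun x => ψ A B (toCone x)) V) (α β : Fin 5) :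
    ContDiffOn ℝ ∞ (ambientTensor ψ α β) V := by
  have hl : ∀ α, ContDiffOn ℝ ∞ (low α) V := fun α => (contDiff_low α).contDiffOn
  have hc : ∀ γ : Fin 5, ContDiffOn ℝ ∞ (fun x : Fin 5 → ℝ => x γ) V := fun γ =>
    (contDiff_apply ℝ ℝ γ).contDiffOn
  refine ((h _ _).add (((hl β).mul (ContDiffOn.sum fun γ _ => (h _ _).mul (hc γ))).add
    ((hl α).mul (ContDiffOn.sum fun γ _ => (h _ _).mul (hc γ))))).add
    (((hl α).mul (hl β)).mul (ContDiffOn.sum fun γ _ => ContDiffOn.sum fun δ _ =>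
      ((hc γ).mul (h _ _)).mul (hc δ)))

theorem sum_mul_low {x : Fin 5 → ℝ} (hx : x ∈ deSitter) : ∑ α, x α * low α x = -1 := by
  rw [← mem_deSitter_iff.1 hx, bil]
  exact Finset.sum_congr rfl fun α _ => by rw [low]; ring

theorem isTT (h : ConeTT V ψ) : IsTT V (ambientTensor ψ) where
  smooth := contDiffOn_ambientTensor h.smooth
  symm x hx α β := by
    rw [h.ambientTensor_eq hx, h.ambientTensor_eq hx, h.symm _ hx α.castSucc β.castSucc]
    ring
  transverse x hx β := by
    have h1 : ∀ α, x α * ambientTensor ψ α β x = x α * ψ α.castSucc β.castSucc (toCone x)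
        - low β x * (x α * ψ α.castSucc (Fin.last 5) (toCone x))
        + (x α * low α x) * (low β x * ψ (Fin.last 5) (Fin.last 5) (toCone x)
          - ψ β.castSucc (Fin.last 5) (toCone x)) := fun α => by
      rw [h.ambientTensor_eq hx]
      ring
    rw [xdot, Finset.sum_congr rfl fun α _ => h1 α, Finset.sum_add_distrib, Finset.sum_sub_distrib,
      ← Finset.mul_sum, ← Finset.sum_mul, h.transverse_toCone hx, h.transverse_toCone hx,
      sum_mul_low hx.2, h.symm _ hx (Fin.last 5) β.castSucc]
    ring
  traceless x hx := by
    have h1 : ∀ α, eta5 α * ambientTensor ψ α α x =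
        eta5 α * ψ α.castSucc α.castSucc (toCone x)
        - 2 * (x α * ψ α.castSucc (Fin.last 5) (toCone x))
        + (x α * low α x) * ψ (Fin.last 5) (Fin.last 5) (toCone x) := fun α => by
      rw [h.ambientTensor_eq hx, low]
      linear_combination (-2 * (x α * ψ α.castSucc (Fin.last 5) (toCone x)) +
        (x α * (eta5 α * x α)) * ψ (Fin.last 5) (Fin.last 5) (toCone x)) *
        IsSignature.mul_self (η := eta5) α
    rw [trace, Finset.sum_congr rfl fun α _ => h1 α, Finset.sum_add_distrib, Finset.sum_sub_distrib,
      ← Finset.mul_sum, ← Finset.sum_mul, h.transverse_toCone hx, h.traceless_toCone hx,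
      sum_mul_low hx.2]
    ring

end ConeTT

/-! ### Tensor fields as functions of an auxiliary vector -/

namespace Fld

section OfFun

variable {n : ℕ} {Ω : Opens (Fin n → ℝ)}

theorem contDiffOn_comp_fst {f : (Fin n → ℝ) → ℝ} (hf : ContDiffOn ℝ ∞ f Ω) :
    ContDiffOn ℝ ∞ (fun p : Pt n => f p.1) ((Ω : Set (Fin n → ℝ)) ×ˢ univ) :=
  hf.comp contDiff_fst.contDiffOn fun _ hp => hp.1

/-- A function of the point alone. -/
def ofFun {f : (Fin n → ℝ) → ℝ} (hf : ContDiffOn ℝ ∞ f Ω) : Fld Ω := mk _ (contDiffOn_comp_fst hf)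

theorem ofFun_apply {f : (Fin n → ℝ) → ℝ} (hf : ContDiffOn ℝ ∞ f Ω) {p : Pt n} (hp : p.1 ∈ Ω) :
    ofFun hf p = f p.1 := mk_apply (contDiffOn_comp_fst hf) hp

theorem Nz_ofFun (η : Fin n → ℝ) [IsSignature η] {f : (Fin n → ℝ) → ℝ} (hf : ContDiffOn ℝ ∞ f Ω) :
    Nz η (ofFun hf) = 0 :=
  Nz_eq_zero_of_indep η fun u hu z z' => by
    rw [ofFun_apply hf (p := (u, z)) hu, ofFun_apply hf (p := (u, z')) hu]

theorem fderiv_ofFun {f : (Fin n → ℝ) → ℝ} (hf : ContDiffOn ℝ ∞ f Ω) {p : Pt n} (hp : p.1 ∈ Ω)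
    (v : Pt n) : fderiv ℝ (ofFun hf : Pt n → ℝ) p v = fderiv ℝ f p.1 v.1 := by
  have h1 : (ofFun hf : Pt n → ℝ) =ᶠ[nhds p] fun p => f p.1 :=
    mk_eventuallyEq (contDiffOn_comp_fst hf) hp
  have h2 : HasFDerivAt f (fderiv ℝ f p.1) p.1 :=
    ((hf.contDiffAt (Ω.2.mem_nhds hp)).differentiableAt (by simp)).hasFDerivAt
  rw [h1.fderiv_eq]
  exact congrArg (· v) (h2.comp p hasFDerivAt_fst).fderiv

theorem contDiffOn_pderiv {f : (Fin n → ℝ) → ℝ} (hf : ContDiffOn ℝ ∞ f Ω) (i : Fin n) :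
    ContDiffOn ℝ ∞ (pderiv i f) Ω :=
  (hf.fderiv_of_isOpen Ω.2 (by simp)).clm_apply contDiffOn_const

theorem dir_ofFun {f : (Fin n → ℝ) → ℝ} (hf : ContDiffOn ℝ ∞ f Ω) (i : Fin n) :
    dir (Pi.single i 1, 0) (ofFun hf) = ofFun (contDiffOn_pderiv hf i) :=
  ext_on fun p hp => by rw [dir_apply _ _ hp, fderiv_ofFun hf hp, ofFun_apply _ hp, pderiv]

end OfFun

variable {Ω : Opens (Fin 6 → ℝ)}

theorem contDiffOn_box {f : (Fin 6 → ℝ) → ℝ} (hf : ContDiffOn ℝ ∞ f Ω) :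
    ContDiffOn ℝ ∞ (SixCone.box f) Ω :=
  ContDiffOn.sum fun A _ => contDiffOn_const.mul (contDiffOn_pderiv (contDiffOn_pderiv hf A) A)

theorem box_ofFun {f : (Fin 6 → ℝ) → ℝ} (hf : ContDiffOn ℝ ∞ f Ω) :
    box eta6 (ofFun hf) = ofFun (contDiffOn_box hf) := ext_on fun p hp => by
  simp only [box, ctr_apply, gen, LinearMap.smul_apply, map_smul, dir_ofFun, coe_sum_apply,
    coe_smul_apply, ofFun_apply _ hp, mul_self_mul eta6, SixCone.box]

theorem N_ofFun {f : (Fin 6 → ℝ) → ℝ} (hf : ContDiffOn ℝ ∞ f Ω) (h0 : ∀ u ∈ Ω, N5 f u = 0) :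
    N eta6 (ofFun hf) = 0 := ext_on fun p hp => by
  rw [N_apply _ _ hp, fderiv_ofFun hf hp, ← sum_mul_pderiv]
  exact h0 _ hp

end Fld

/-! ### Decomposition near the six-cone into fields on de Sitter space -/

namespace Fld

/-- A function of degree zero is constant along the part of a ray in a convex set. -/
theorem apply_smul_of_convex {n : ℕ} {Ω : Opens (Fin n → ℝ)} (η : Fin n → ℝ) [IsSignature η]
    {f : Fld Ω} (hN : N η f = 0) {B : Set (Fin n → ℝ)} (hB : Convex ℝ B) (hBΩ : B ⊆ Ω)
    {u : Fin n → ℝ} (hu : u ∈ B) {s : ℝ} (hs : 0 < s) (hsu : s • u ∈ B) (z : Fin n → ℝ) :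
    f (s • u, z) = f (u, z) := by
  have hd : ∀ t ∈ segment ℝ s 1, HasDerivWithinAt (fun t : ℝ => f (t • u, z)) 0 (segment ℝ s 1) t := by
    rintro t ⟨a, b, ha, hb, hab, rfl⟩
    have hmem : (a • s + b • (1 : ℝ)) • u ∈ Ω := by
      refine hBΩ ?_
      have := hB hsu hu ha hb hab
      rwa [smul_smul, ← add_smul, ← smul_eq_mul, ← mul_one b, ← smul_eq_mul b] at this
    have hpos : 0 < a • s + b • (1 : ℝ) := by
      simp only [smul_eq_mul, mul_one]
      rcases ha.eq_or_lt with h | h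
      · rw [← h] at hab ⊢
        linarith
      · exact add_pos_of_pos_of_nonneg (mul_pos h hs) hb
    have h1 : N η f ((a • s + b • (1 : ℝ)) • u, z) = 0 := by rw [hN]; rfl
    rw [N_apply η f (p := ((a • s + b • (1 : ℝ)) • u, z)) hmem] at h1
    have h3 : (((a • s + b • (1 : ℝ)) • u, 0) : Pt n) = (a • s + b • (1 : ℝ)) • ((u, 0) : Pt n) := by
      simp
    rw [h3, map_smul, smul_eq_zero, or_iff_right hpos.ne'] at h1
    exact ((hasDerivAt_smul_fst f z hmem).congr_deriv h1).hasDerivWithinAt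
  have := Convex.norm_image_sub_le_of_norm_hasDerivWithin_le (C := 0) hd (by simp)
    (convex_segment s 1) (right_mem_segment ℝ s 1) (left_mem_segment ℝ s 1)
  rw [zero_mul, norm_le_zero_iff, sub_eq_zero, one_smul] at this
  exact this

theorem isCoisometry_proj5 : IsCoisometry proj5 eta6 eta5 := by
  intro j k
  rw [Fin.sum_univ_castSucc (n := 5)]
  simp only [proj5_apply, Pi.single_apply, Fin.castSucc_inj, Fin.castSucc_ne_last, if_false, mul_zero,
    add_zero]
  rw [Finset.sum_eq_single j]
  · have h1 : eta6 j.castSucc = eta5 j := by fin_cases j <;> rfl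
    by_cases hjk : j = k
    · simp [← hjk, h1]
    · simp [hjk, Ne.symm hjk]
  · intro i _ hi
    simp [hi.symm]
  · simp

theorem isCoisometry_id {n : ℕ} (η : Fin n → ℝ) :
    IsCoisometry (ContinuousLinearMap.id ℝ (Fin n → ℝ)) η η := by
  intro j k
  simp only [ContinuousLinearMap.id_apply, Pi.single_apply]
  rw [Finset.sum_eq_single j]
  · by_cases hjk : j = k
    · simp [hjk]
    · simp [hjk, Ne.symm hjk]
  · intro i _ hi
    simp [hi.symm]
  · simp

end Fld

namespace ConeTT

open Fld

variable {V : Opens (Fin 5 → ℝ)} {ψ : SixTensor}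

/-- The components of `ψ` with one index along the cone and one along the hyperboloid, as a covector
field that is homogeneous of degree `-1`. -/
def mixed (h : ConeTT V ψ) : Fld (coneOver V) := contr1 eta5 fun α : Fin 5 =>
  hom (f := fun x => ψ α.castSucc (Fin.last 5) (toCone x)
    - low α x * ψ (Fin.last 5) (Fin.last 5) (toCone x))
    ((h.smooth _ _).sub ((contDiff_low α).contDiffOn.mul (h.smooth _ _))) 1

/-- The component of `ψ` with both indices along the cone, as a scalar field that is homogeneous of
degree `-2`. -/
def scalar (h : ConeTT V ψ) : Fld (coneOver V) := hom (h.smooth (Fin.last 5) (Fin.last 5)) 2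

theorem N_mixed (h : ConeTT V ψ) : N eta5 h.mixed = (-1 : ℝ) • h.mixed :=
  N_contr1 eta5 fun α => by rw [N_hom]; norm_num

theorem Nz_mixed (h : ConeTT V ψ) : Nz eta5 h.mixed = h.mixed := Nz_contr1 eta5 fun _ => Nz_hom _ _

theorem N_scalar (h : ConeTT V ψ) : N eta5 h.scalar = (-2 : ℝ) • h.scalar := by
  rw [scalar, N_hom]
  norm_num

theorem Nz_scalar (h : ConeTT V ψ) : Nz eta5 h.scalar = 0 := Nz_hom _ _

theorem scalar_apply (h : ConeTT V ψ) {p : Pt 5} (hp : p.1 ∈ coneOver V) : h.scalar p =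
    (radius p.1)⁻¹ ^ 2 * ψ (Fin.last 5) (Fin.last 5) (toCone (normalize p.1)) := hom_apply _ _ hp

theorem mixed_apply (h : ConeTT V ψ) {p : Pt 5} (hp : p.1 ∈ coneOver V) : h.mixed p =
    (radius p.1)⁻¹ * (∑ α, p.2 α * ψ α.castSucc (Fin.last 5) (toCone (normalize p.1))
      - (∑ α, p.2 α * low α (normalize p.1)) *
        ψ (Fin.last 5) (Fin.last 5) (toCone (normalize p.1))) := by
  rw [mixed, contr1_apply, Finset.sum_mul, ← Finset.sum_sub_distrib, Finset.mul_sum]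
  refine Finset.sum_congr rfl fun α _ => ?_
  rw [hom_apply _ _ hp]
  ring

theorem ext_apply_eq (h : ConeTT V ψ) {p : Pt 5} (hp : p.1 ∈ coneOver V) : h.isTT.ext p =
    ∑ α, ∑ β, p.2 α * (p.2 β * ψ α.castSucc β.castSucc (toCone (normalize p.1)))
      - 2 * (∑ α, p.2 α * low α (normalize p.1)) *
        ∑ α, p.2 α * ψ α.castSucc (Fin.last 5) (toCone (normalize p.1))
      + (∑ α, p.2 α * low α (normalize p.1)) ^ 2 *
        ψ (Fin.last 5) (Fin.last 5) (toCone (normalize p.1)) := by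
  rw [IsTT.ext_apply _ hp]
  simp only [h.ambientTensor_eq (IsTT.normalize_mem hp)]
  generalize normalize p.1 = x
  have h1 : ∀ a b : Fin 5 → ℝ, (∑ α, p.2 α * a α) * (∑ α, p.2 α * b α) =
      ∑ α, ∑ β, p.2 α * a α * (p.2 β * b β) := fun a b => Finset.sum_mul_sum _ _ _ _
  have h2 := h1 (fun α => low α x) fun α => ψ α.castSucc (Fin.last 5) (toCone x)
  have h3 := h2
  rw [Finset.sum_comm] at h3
  have h4 := h1 (fun α => low α x) fun α => low α x
  rw [sq, two_mul, add_mul, h4]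
  nth_rw 1 [h2]
  rw [h3, Finset.sum_mul]
  simp only [Finset.sum_mul, ← Finset.sum_add_distrib, ← Finset.sum_sub_distrib]
  refine Finset.sum_congr rfl fun α _ => Finset.sum_congr rfl fun β _ => ?_
  ring

theorem I_mixed (h : ConeTT V ψ) : I eta5 h.mixed = 0 := by
  simp only [mixed, contr1, map_sum, I_gen_one, I_eq_zero eta5 (Nz_hom _ _), map_zero, zero_add]
  refine ext_on fun p hp => ?_
  have hx := IsTT.normalize_mem hp
  simp only [coe_sum_apply, gen_zero_apply, hom_apply _ _ hp]
  have h2 : ∀ α, p.1 α = radius p.1 * normalize p.1 α := fun α =>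
    (congrFun (radius_smul_normalize hp.1) α).symm
  have h3 : ∀ α, p.1 α * ((radius p.1)⁻¹ ^ 1 *
      (ψ α.castSucc (Fin.last 5) (toCone (normalize p.1)) -
        low α (normalize p.1) * ψ (Fin.last 5) (Fin.last 5) (toCone (normalize p.1)))) =
      normalize p.1 α * ψ α.castSucc (Fin.last 5) (toCone (normalize p.1)) -
        normalize p.1 α * low α (normalize p.1) *
          ψ (Fin.last 5) (Fin.last 5) (toCone (normalize p.1)) := fun α => by
    rw [h2]
    field_simp [(radius_pos hp.1).ne']
  rw [Finset.sum_congr rfl fun α _ => h3 α, Finset.sum_sub_distrib, ← Finset.sum_mul,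
    h.transverse_toCone hx, sum_mul_low hx.2]
  simp

end ConeTT

theorem conePath_apply_last (u : Fin 6 → ℝ) (t : ℝ) : conePath u t (Fin.last 5) =
    u (Fin.last 5) + (1 - t) * (radius (proj5 u) - u (Fin.last 5)) := by
  simp [conePath, lastAxis]

theorem proj5_conePath (u : Fin 6 → ℝ) (t : ℝ) : proj5 (conePath u t) = proj5 u := by
  rw [conePath, map_add, map_smul, proj5_lastAxis, smul_zero, add_zero]

theorem conePath_zero_eq (u : Fin 6 → ℝ) (t : ℝ) : conePath (conePath u t) 0 = conePath u 0 := by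
  rw [conePath, proj5_conePath, conePath_apply_last, conePath, conePath]
  module

theorem conePath_eq_combination (u : Fin 6 → ℝ) (t : ℝ) :
    conePath u t = (1 - t) • conePath u 0 + t • u := by
  rw [conePath, conePath]
  module

theorem continuousOn_conePath_zero :
    ContinuousOn (fun u => conePath u 0) {u | Fld.bil eta5 (proj5 u) (proj5 u) < 0} := by
  have h1 : ContinuousOn (fun u => radius (proj5 u)) {u | Fld.bil eta5 (proj5 u) (proj5 u) < 0} :=
    contDiffOn_radius.continuousOn.comp proj5.continuous.continuousOn fun u hu => hu
  unfold conePath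
  fun_prop

theorem ext_castSucc_last {u v : Fin 6 → ℝ} (h1 : proj5 u = proj5 v)
    (h2 : u (Fin.last 5) = v (Fin.last 5)) : u = v :=
  funext fun A => Fin.lastCases h2 (fun i => congrFun h1 i) A

theorem inv_radius_smul_eq {u : Fin 6 → ℝ} (hu : Fld.bil eta5 (proj5 u) (proj5 u) < 0)
    (h : u (Fin.last 5) = radius (proj5 u)) :
    (radius (proj5 u))⁻¹ • u = toCone (normalize (proj5 u)) := by
  refine ext_castSucc_last ?_ ?_
  · rw [map_smul, proj5_toCone, normalize]
  · rw [Pi.smul_apply, h, toCone_last, smul_eq_mul, inv_mul_cancel₀ (radius_pos hu).ne']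

theorem last_eq_radius {u : Fin 6 → ℝ} (hu : Fld.bil eta5 (proj5 u) (proj5 u) < 0)
    (hpos : 0 < u (Fin.last 5)) (h : Fld.bil eta6 u u = 0) : u (Fin.last 5) = radius (proj5 u) := by
  rw [bil_eta6] at h
  have h1 := radius_sq hu
  exact (pow_left_inj₀ hpos.le (radius_pos hu).le two_ne_zero).1 (by rw [h1]; linarith)

namespace Fld

/-- Neighbourhoods of a point of the cone that are adapted to division by `u·u`. -/
theorem exists_coneNhd {B : Set (Fin 6 → ℝ)} (hB : IsOpen B) (hconv : Convex ℝ B)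
    (hneg : ∀ u ∈ B, bil eta5 (proj5 u) (proj5 u) < 0) {x : Fin 5 → ℝ} (hx : x ∈ deSitter)
    (hxB : toCone x ∈ B) : ∃ Ω : Opens (Fin 6 → ℝ), toCone x ∈ Ω ∧ (Ω : Set (Fin 6 → ℝ)) ⊆ B ∧
      (∀ u ∈ Ω, ∀ t ∈ Icc (0 : ℝ) 1, conePath u t ∈ Ω) ∧
      ∀ u ∈ Ω, (radius (proj5 u))⁻¹ • conePath u 0 ∈ B := by
  have hc : ContinuousOn (fun u => conePath u 0) B := continuousOn_conePath_zero.mono hneg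
  have hr : ContinuousOn (fun u => (radius (proj5 u))⁻¹) B :=
    contDiffOn_inv_radius.continuousOn.comp proj5.continuous.continuousOn hneg
  -- The neighbourhood consists of the points of B whose projection to the cone along the last axis,
  -- and the rescaling of that projection to the section u^5 = 1, also lie in B. Moving along the
  -- path changes neither of these two points, and convexity keeps the path in B.
  refine ⟨⟨B ∩ (fun u => (conePath u 0, (radius (proj5 u))⁻¹ • conePath u 0)) ⁻¹' (B ×ˢ B),
    (hc.prodMk (hr.smul hc)).isOpen_inter_preimage hB (hB.prod hB)⟩, ?_, fun u hu => hu.1,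
    fun u hu t ht => ?_, fun u hu => hu.2.2⟩
  · have h1 : conePath (toCone x) 0 = toCone x := by
      rw [conePath, proj5_toCone, radius_eq_one hx, toCone_last]
      simp
    refine ⟨hxB, ?_, ?_⟩
    · dsimp only
      rwa [h1]
    · dsimp only
      rwa [h1, proj5_toCone, radius_eq_one hx, inv_one, one_smul]
  · refine ⟨?_, ?_, ?_⟩
    · rw [conePath_eq_combination]
      exact hconv hu.2.1 hu.1 (sub_nonneg.2 ht.2) ht.1 (sub_add_cancel 1 t)
    · dsimp only
      rw [conePath_zero_eq]
      exact hu.2.1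
    · dsimp only
      rw [conePath_zero_eq, proj5_conePath]
      exact hu.2.2

end Fld

namespace ConeTT

open Fld

variable {V : Opens (Fin 5 → ℝ)} {ψ : SixTensor}

/-- Near a point of the cone, a tensor field on six-dimensional space of degree zero that agrees
with `ψ` on the section `(x, 1)` of the cone is determined, up to multiples of `u·u`, by fields on de
Sitter space. -/
theorem exists_decomposition (h : ConeTT V ψ) {Ω₀ : Opens (Fin 6 → ℝ)} {F : Fld Ω₀}
    (hN : N eta6 F = 0) (hz : Nz eta6 F = (2 : ℝ) • F)
    (hF : ∀ x ∈ (V : Set (Fin 5 → ℝ)) ∩ deSitter, toCone x ∈ Ω₀ → ∀ z,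
      F (toCone x, z) = ∑ A, ∑ B, z A * (z B * ψ A B (toCone x)))
    {x₀ : Fin 5 → ℝ} (hx₀ : x₀ ∈ (V : Set (Fin 5 → ℝ)) ∩ deSitter) (hx₀' : toCone x₀ ∈ Ω₀) :
    ∃ (Ω : Opens (Fin 6 → ℝ))
      (hid : ∀ u ∈ Ω, ContinuousLinearMap.id ℝ (Fin 6 → ℝ) u ∈ Ω₀)
      (hπ : ∀ u ∈ Ω, proj5 u ∈ coneOver V) (χ : Fld Ω),
      toCone x₀ ∈ Ω ∧ (∀ u ∈ Ω, 0 < u (Fin.last 5)) ∧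
      N eta6 χ = (-2 : ℝ) • χ ∧ Nz eta6 χ = (2 : ℝ) • χ ∧
      pull _ hid F = pull proj5 hπ h.isTT.ext + (2 : ℝ) • X eta6 (pull proj5 hπ h.mixed)
        + X eta6 (X eta6 (pull proj5 hπ h.scalar)) + Q eta6 χ := by
  have hO : IsOpen ((Ω₀ : Set (Fin 6 → ℝ)) ∩ {u | 0 < u (Fin.last 5)} ∩ proj5 ⁻¹' (coneOver V ∩ V)) := by
    refine (Ω₀.2.inter (isOpen_lt continuous_const (continuous_apply _))).inter ?_
    exact ((coneOver V).2.inter V.2).preimage proj5.continuous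
  have hmem : toCone x₀ ∈
      (Ω₀ : Set (Fin 6 → ℝ)) ∩ {u | 0 < u (Fin.last 5)} ∩ proj5 ⁻¹' (coneOver V ∩ V) := by
    refine ⟨⟨hx₀', ?_⟩, ?_⟩
    · rw [mem_ofPred_eq, toCone_last]
      exact one_pos
    · rw [mem_preimage, proj5_toCone]
      exact ⟨inter_deSitter_subset_coneOver V hx₀, hx₀.1⟩
  obtain ⟨ε, hε, hball⟩ := Metric.isOpen_iff.1 hO _ hmem
  obtain ⟨Ω, hxΩ, hΩB, hpath, hrad⟩ := exists_coneNhd Metric.isOpen_ball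
    (convex_ball (toCone x₀) ε) (fun u hu => (hball hu).2.1.1) hx₀.2 (Metric.mem_ball_self hε)
  have hpos : ∀ u ∈ Ω, 0 < u (Fin.last 5) := fun u hu => (hball (hΩB hu)).1.2
  have hid : ∀ u ∈ Ω, ContinuousLinearMap.id ℝ (Fin 6 → ℝ) u ∈ Ω₀ := fun u hu =>
    (hball (hΩB hu)).1.1
  have hπ : ∀ u ∈ Ω, proj5 u ∈ coneOver V := fun u hu => (hball (hΩB hu)).2.1
  obtain ⟨χ, hχ⟩ := exists_eq_Q hpos (fun u hu => (hπ u hu).1) hpath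
    (f := pull _ hid F - (pull proj5 hπ h.isTT.ext + (2 : ℝ) • X eta6 (pull proj5 hπ h.mixed)
        + X eta6 (X eta6 (pull proj5 hπ h.scalar)))) (by
    intro u hu hu0 z
    have hneg := (hπ u hu).1
    have hlast := last_eq_radius hneg (hpos u hu) hu0
    have hray := inv_radius_smul_eq hneg hlast
    have hu1 : (radius (proj5 u))⁻¹ • u ∈ Metric.ball (toCone x₀) ε := by
      have h1 : conePath u 0 = u := by rw [conePath, hlast, sub_self, mul_zero, zero_smul, add_zero]
      have := hrad u hu
      rwa [h1] at this
    have hx : normalize (proj5 u) ∈ (V : Set (Fin 5 → ℝ)) ∩ deSitter := IsTT.normalize_mem (hπ u hu)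
    -- The domain of F need not be conic, so homogeneity is used only inside the ball, between u and
    -- its rescaling to (x, 1).
    have hF1 : F (u, z) = ∑ A, ∑ B, z A * (z B * ψ A B (toCone (normalize (proj5 u)))) := by
      rw [← apply_smul_of_convex eta6 hN (convex_ball (toCone x₀) ε)
        (fun v hv => (hball hv).1.1) (hΩB hu) (inv_pos.2 (radius_pos hneg)) hu1, hray]
      exact hF _ hx (by rw [← hray]; exact (hball hu1).1.1) z
    -- On the cone u = r (x, 1). The factor r here cancels the powers of 1/r in the extensions of
    -- degree −1 and −2.
    have hb : bil eta6 u z = radius (proj5 u) *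
        (∑ α, proj5 z α * low α (normalize (proj5 u)) + z (Fin.last 5)) := by
      rw [bil_eta6, hlast, mul_add]
      congr 1
      conv_lhs => rw [← radius_smul_normalize hneg]
      rw [bil_smul_left, bil]
      congr 1
      exact Finset.sum_congr rfl fun α _ => by rw [low]; ring
    simp only [coe_sub_apply, coe_add_apply, coe_smul_apply, X_apply, pull_apply _ _ _ (p := (u, z)) hu,
      ContinuousLinearMap.id_apply, h.ext_apply_eq (p := (proj5 u, proj5 z)) (hπ u hu),
      h.mixed_apply (p := (proj5 u, proj5 z)) (hπ u hu),
      h.scalar_apply (p := (proj5 u, proj5 z)) (hπ u hu), hF1, hb]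
    have hr := (radius_pos hneg).ne'
    have h5 : ∀ α : Fin 5, ψ (Fin.last 5) α.castSucc (toCone (normalize (proj5 u))) =
        ψ α.castSucc (Fin.last 5) (toCone (normalize (proj5 u))) := fun α => h.symm _ hx _ _
    have hsum : ∑ A, ∑ B, z A * (z B * ψ A B (toCone (normalize (proj5 u)))) =
        ∑ α, ∑ β, proj5 z α * (proj5 z β *
          ψ α.castSucc β.castSucc (toCone (normalize (proj5 u))))
        + 2 * z (Fin.last 5) *
          ∑ α, proj5 z α * ψ α.castSucc (Fin.last 5) (toCone (normalize (proj5 u)))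
        + z (Fin.last 5) ^ 2 * ψ (Fin.last 5) (Fin.last 5) (toCone (normalize (proj5 u))) := by
      simp only [Fin.sum_univ_castSucc (n := 5), h5, Finset.sum_add_distrib, proj5_apply,
        mul_left_comm _ (z (Fin.last 5)), ← Finset.mul_sum]
      ring
    rw [hsum]
    field_simp
    ring)
  refine ⟨Ω, hid, hπ, χ, hxΩ, hpos, ?_, ?_, sub_eq_iff_eq_add'.1 hχ⟩
  -- The degrees of χ follow by applying the degree operators to the decomposition and cancelling Q.
  · have h1 := congrArg (N eta6) hχ
    simp [N_pull _ _ eta6 eta6, N_pull _ _ eta6 eta5, hN, h.isTT.N_ext, h.N_mixed, h.N_scalar] at h1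
    rw [← sub_eq_zero]
    refine Q_injective hpos ?_
    rw [map_sub, map_smul]
    rw [eq_sub_of_add_eq h1.symm]
    module
  · have h1 := congrArg (Nz eta6) hχ
    simp [Nz_pull _ _ eta6 eta6, Nz_pull _ _ eta6 eta5, hz, h.isTT.Nz_ext, h.Nz_mixed,
      h.Nz_scalar] at h1
    rw [← sub_eq_zero]
    refine Q_injective hpos ?_
    rw [map_sub, map_smul]
    rw [← h1, ← hχ]
    module

end ConeTT

/-! ### Solutions of Dirac's system satisfy the equation -/

namespace Fld

/-- The squared wave operator on a field divisible by `u·u` with the critical degree. -/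
theorem box_box_Q {Ω : Opens (Fin 6 → ℝ)} {χ : Fld Ω} (hN : N eta6 χ = (-2 : ℝ) • χ) :
    box eta6 (box eta6 (Q eta6 χ)) = Q eta6 (box eta6 (box eta6 χ)) := by
  -- The corrections from the two wave operators are −16 + 12 + 4 times □χ, which is zero.
  simp [hN]
  module

end Fld

/-- The points `x` with `(x, 1)` in a given open set. -/
def sliceOpens (U : Opens (Fin 6 → ℝ)) : Opens (Fin 5 → ℝ) :=
  ⟨toCone ⁻¹' U, U.2.preimage contDiff_toCone.continuous⟩

namespace DiracSystem

open Fld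

variable {U : Opens (Fin 6 → ℝ)} {ψ : SixTensor}

theorem coneTT (h : DiracSystem U ψ) : ConeTT (sliceOpens U) ψ where
  smooth A B := (h.smooth A B).comp contDiff_toCone.contDiffOn fun _ hx => hx
  symm _ hx := h.symm _ hx.1
  transverse _ hx := h.transverse _ ⟨hx.1, toCone_mem_cone hx.2⟩
  traceless _ hx := h.traceless _ ⟨hx.1, toCone_mem_cone hx.2⟩

/-- The tensor field contracted with the auxiliary vector. -/
def form (h : DiracSystem U ψ) : Fld U := contr eta6 fun A B => ofFun (h.smooth A B)

theorem form_apply (h : DiracSystem U ψ) {p : Pt 6} (hp : p.1 ∈ U) :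
    h.form p = ∑ A, ∑ B, p.2 A * (p.2 B * ψ A B p.1) := by
  simp only [form, contr_apply, ofFun_apply _ hp]

theorem N_form (h : DiracSystem U ψ) : N eta6 h.form = 0 :=
  N_contr_eq_zero eta6 fun A B => N_ofFun _ fun u hu => h.degree u hu A B

theorem Nz_form (h : DiracSystem U ψ) : Nz eta6 h.form = (2 : ℝ) • h.form :=
  Nz_contr eta6 fun _ _ => Nz_ofFun _ _

theorem box_box_form (h : DiracSystem U ψ) {u : Fin 6 → ℝ} (hu : u ∈ (U : Set (Fin 6 → ℝ)) ∩ cone)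
    (z : Fin 6 → ℝ) : Fld.box eta6 (Fld.box eta6 h.form) (u, z) = 0 := by
  have hu' : u ∈ U := hu.1
  simp only [form, box_contr, box_ofFun, contr_apply, ofFun_apply _ (p := (u, z)) hu', h.wave u hu,
    mul_zero, Finset.sum_const_zero]

/-- Apply □² to the decomposition at u = (x, 1), z = (y, s), where u·z = x·y + s and z·z = y·y + s²,
and sort by powers of s. The term Qχ drops out on the cone. -/
theorem wave_decomposition (h : DiracSystem U ψ) {x : Fin 5 → ℝ}
    (hx : x ∈ (sliceOpens U : Set (Fin 5 → ℝ)) ∩ deSitter) (y : Fin 5 → ℝ) (s : ℝ) :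
    (Fld.box eta5 (Fld.box eta5 h.coneTT.isTT.ext)
      + (2 : ℝ) • X eta5 (Fld.box eta5 (Fld.box eta5 h.coneTT.mixed))
      + (8 : ℝ) • G eta5 (Fld.box eta5 h.coneTT.mixed)
      + X eta5 (X eta5 (Fld.box eta5 (Fld.box eta5 h.coneTT.scalar)))
      + (8 : ℝ) • X eta5 (G eta5 (Fld.box eta5 h.coneTT.scalar))
      + (4 : ℝ) • Z eta5 (Fld.box eta5 h.coneTT.scalar)
      + (8 : ℝ) • G eta5 (G eta5 h.coneTT.scalar)) (x, y)
    + 2 * s * (Fld.box eta5 (Fld.box eta5 h.coneTT.mixed)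
      + X eta5 (Fld.box eta5 (Fld.box eta5 h.coneTT.scalar))
      + (4 : ℝ) • G eta5 (Fld.box eta5 h.coneTT.scalar)) (x, y)
    + s ^ 2 * (Fld.box eta5 (Fld.box eta5 h.coneTT.scalar)
      + (4 : ℝ) • Fld.box eta5 h.coneTT.scalar) (x, y) = 0 := by
  obtain ⟨Ω, hid, hπ, χ, hxΩ, -, hχ, -, hdec⟩ := h.coneTT.exists_decomposition h.N_form h.Nz_form
    (fun x _ hx' z => h.form_apply (p := (toCone x, z)) hx') hx hx.1
  let z : Fin 6 → ℝ := Fin.snoc y s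
  have hz : proj5 z = y := by
    ext i
    rw [proj5_apply]
    exact Fin.snoc_castSucc (α := fun _ => ℝ) s y i
  have hz5 : z (Fin.last 5) = s := Fin.snoc_last (α := fun _ => ℝ) s y
  have h0 := congrArg (fun f => Fld.box eta6 (Fld.box eta6 f) (toCone x, z)) hdec
  have h1 : Fld.box eta6 (Fld.box eta6 (pull _ hid h.form)) (toCone x, z) = 0 := by
    rw [box_pull hid (isCoisometry_id eta6), box_pull hid (isCoisometry_id eta6),
      pull_apply _ _ _ (p := (toCone x, z)) hxΩ]
    exact h.box_box_form ⟨hx.1, toCone_mem_cone hx.2⟩ z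
  rw [h1] at h0
  simp only [map_add, box_box_Q hχ] at h0
  simp [box_pull hπ isCoisometry_proj5, G_pull _ hπ eta6 eta5] at h0
  simp only [pull_apply _ _ _ (p := (toCone x, z)) hxΩ, bil_eta6, proj5_toCone, toCone_last, hz, hz5,
    mem_deSitter_iff.1 hx.2] at h0
  simp
  linear_combination -h0

theorem conformalOperator_ambientTensor (h : DiracSystem U ψ) {x : Fin 5 → ℝ}
    (hx : x ∈ (sliceOpens U : Set (Fin 5 → ℝ)) ∩ deSitter) (α β : Fin 5) :
    conformalOperator (ambientTensor ψ) α β x = 0 := by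
  revert α β
  have hx' := inter_deSitter_subset_coneOver _ hx
  have hx1 := mem_deSitter_iff.1 hx.2
  rw [h.coneTT.isTT.conformalOperator_eq_zero_iff hx]
  refine bach_add_trace_eq_zero h.coneTT.isTT.Nz_ext h.coneTT.isTT.T_ext hx' hx1 _
    (bach_eq_of_wave (fun u hu t ht => smul_mem_coneOver hu ht) (fun u hu => hu.1)
      h.coneTT.isTT.N_ext h.coneTT.isTT.I_ext h.coneTT.isTT.T_ext
      h.coneTT.N_mixed h.coneTT.Nz_mixed h.coneTT.I_mixed h.coneTT.N_scalar h.coneTT.Nz_scalar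
      ?_ ?_ ?_ hx' hx1)
  -- The values s = 0, 1, −1 separate the three coefficients of the polynomial in s.
  all_goals
    intro v hv hv1 y
    have h0 := h.wave_decomposition (mem_of_mem_coneOver hv hv1) y 0
    have h1 := h.wave_decomposition (mem_of_mem_coneOver hv hv1) y 1
    have h2 := h.wave_decomposition (mem_of_mem_coneOver hv hv1) y (-1)
  · simp only [coe_add_apply (Fld.box eta5 (Fld.box eta5 h.coneTT.scalar)), coe_smul_apply] at h0 h1 h2 ⊢
    linarith
  · linarith
  · linarith

end DiracSystem

/-! ### The conformal group -/

/-- A one-sided inverse of a square matrix is two-sided. The relation for the rows of M is what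
traces and inverse metrics require. -/
theorem IsConformal.mul_transpose {M : Matrix (Fin 6) (Fin 6) ℝ} (hM : IsConformal M) :
    M * Matrix.diagonal eta6 * M.transpose = Matrix.diagonal eta6 := by
  have hη : Matrix.diagonal eta6 * Matrix.diagonal eta6 = 1 := by
    rw [Matrix.diagonal_mul_diagonal, ← Matrix.diagonal_one]
    exact congrArg _ (funext IsSignature.mul_self)
  have h1 : (Matrix.diagonal eta6 * M.transpose * Matrix.diagonal eta6) * M = 1 := by
    rw [Matrix.mul_assoc, Matrix.mul_assoc, ← Matrix.mul_assoc M.transpose, hM, hη]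
  have h2 := congrArg (· * Matrix.diagonal eta6) (mul_eq_one_comm.1 h1)
  simp only [one_mul, Matrix.mul_assoc, hη, mul_one] at h2
  rwa [Matrix.mul_assoc]

theorem IsConformal.sum_mul {M : Matrix (Fin 6) (Fin 6) ℝ} (hM : IsConformal M) (A B : Fin 6) :
    ∑ C, eta6 C * (M A C * M B C) = if A = B then eta6 A else 0 := by
  have h := congrFun (congrFun hM.mul_transpose A) B
  rw [Matrix.mul_apply, Matrix.diagonal_apply] at h
  rw [← h]
  refine Finset.sum_congr rfl fun C _ => ?_
  rw [Matrix.mul_diagonal, Matrix.transpose_apply]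
  ring

theorem IsConformal.neg {M : Matrix (Fin 6) (Fin 6) ℝ} (hM : IsConformal M) : IsConformal (-M) := by
  rw [IsConformal, Matrix.transpose_neg, Matrix.neg_mul, Matrix.neg_mul, Matrix.mul_neg, neg_neg]
  exact hM

theorem IsConformal.bil_mulVec {M : Matrix (Fin 6) (Fin 6) ℝ} (hM : IsConformal M)
    (u v : Fin 6 → ℝ) : Fld.bil eta6 (M.mulVec u) (M.mulVec v) = Fld.bil eta6 u v := by
  have h : ∀ a b : Fin 6 → ℝ, Fld.bil eta6 a b = a ⬝ᵥ (Matrix.diagonal eta6).mulVec b := fun a b => by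
    simp only [Fld.bil, dotProduct, Matrix.mulVec_diagonal]
    exact Finset.sum_congr rfl fun _ _ => by ring
  rw [h, h, Matrix.mulVec_mulVec, Matrix.dotProduct_mulVec, Matrix.vecMul_mulVec,
    ← Matrix.dotProduct_mulVec, ← Matrix.mul_assoc, hM]

theorem ofCone_mem_deSitter {v : Fin 6 → ℝ} (hv : Fld.bil eta6 v v = 0) (h5 : v (Fin.last 5) ≠ 0) :
    ofCone v ∈ deSitter := by
  have h1 : ofCone v = (v (Fin.last 5))⁻¹ • proj5 v := by
    ext i
    simp [ofCone, div_eq_inv_mul]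
  rw [bil_eta6] at hv
  rw [mem_deSitter_iff, h1, Fld.bil_smul_left, Fld.bil_smul_right, eq_neg_of_add_eq_zero_left hv]
  field_simp

theorem last_smul_ofCone {v : Fin 6 → ℝ} (h5 : v (Fin.last 5) ≠ 0) :
    v (Fin.last 5) • ofCone v = proj5 v := by
  ext i
  simp only [Pi.smul_apply, ofCone, smul_eq_mul, proj5_apply]
  field_simp

theorem normalize_proj5 {v : Fin 6 → ℝ} (hv : Fld.bil eta6 v v = 0) (h5 : 0 < v (Fin.last 5)) :
    normalize (proj5 v) = ofCone v := by
  rw [← last_smul_ofCone h5.ne', normalize_smul h5,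
    normalize_eq_self (ofCone_mem_deSitter hv h5.ne')]

/-- The pull-back of `k`, regarded as a tensor field on the cone. -/
def conePullback (M : Matrix (Fin 6) (Fin 6) ℝ) (k : Tensor2) : SixTensor := fun A B u =>
  ∑ γ : Fin 5, ∑ δ : Fin 5,
    M γ.castSucc A * M δ.castSucc B * k γ δ (ofCone (M.mulVec u))

theorem conformalTransform_eq (M : Matrix (Fin 6) (Fin 6) ℝ) (k : Tensor2) :
    conformalTransform M k = ambientTensor (conePullback M k) := rfl

theorem ofCone_neg (u : Fin 6 → ℝ) : ofCone (-u) = ofCone u := by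
  ext i
  simp [ofCone]

theorem conePullback_neg (M : Matrix (Fin 6) (Fin 6) ℝ) (k : Tensor2) :
    conePullback (-M) k = conePullback M k := by
  funext A B u
  simp only [conePullback, Matrix.neg_mulVec, ofCone_neg, Matrix.neg_apply, neg_mul_neg]

theorem contDiff_mulVec_toCone (M : Matrix (Fin 6) (Fin 6) ℝ) (A : Fin 6) :
    ContDiff ℝ ∞ fun x => M.mulVec (toCone x) A := by
  simp only [Matrix.mulVec, dotProduct]
  exact ContDiff.sum fun B _ => contDiff_const.mul (contDiff_pi.1 contDiff_toCone B)

theorem contDiffOn_conformalMap (M : Matrix (Fin 6) (Fin 6) ℝ) :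
    ContDiffOn ℝ ∞ (conformalMap M) {x | M.mulVec (toCone x) (Fin.last 5) ≠ 0} :=
  contDiffOn_pi.2 fun i => (contDiff_mulVec_toCone M i.castSucc).contDiffOn.div
    (contDiff_mulVec_toCone M (Fin.last 5)).contDiffOn fun _ hx => hx

/-- The domain of the conformal transform, as an open set. -/
def conformalOpens (M : Matrix (Fin 6) (Fin 6) ℝ) (V : Opens (Fin 5 → ℝ)) : Opens (Fin 5 → ℝ) :=
  ⟨conformalDomain M V, (contDiffOn_conformalMap M).continuousOn.isOpen_inter_preimage
    (isOpen_ne_fun (contDiff_mulVec_toCone M _).continuous continuous_const) V.2⟩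

theorem conformalOpens_neg (M : Matrix (Fin 6) (Fin 6) ℝ) (V : Opens (Fin 5 → ℝ)) :
    conformalOpens (-M) V = conformalOpens M V := by
  ext x
  change (_ ∧ _) ↔ (_ ∧ _)
  simp only [conformalMap, Matrix.neg_mulVec, ofCone_neg, Pi.neg_apply, ne_eq, neg_eq_zero]

namespace IsTT

open Fld

variable {V : Opens (Fin 5 → ℝ)} {k : Tensor2} {M : Matrix (Fin 6) (Fin 6) ℝ}

theorem conformalMap_mem (hM : IsConformal M) {x : Fin 5 → ℝ}
    (hx : x ∈ (conformalOpens M V : Set (Fin 5 → ℝ)) ∩ deSitter) :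
    ofCone (M.mulVec (toCone x)) ∈ (V : Set (Fin 5 → ℝ)) ∩ deSitter :=
  ⟨hx.1.2, ofCone_mem_deSitter (by rw [hM.bil_mulVec, bil_toCone hx.2]) hx.1.1⟩

/-- With M(x, 1) = λ(y, 1), contracting M with (x, 1) gives λ y, so transversality of k at y is
inherited. The trace is inherited because the first five rows of M are orthonormal for the metric.
-/
theorem coneTT_conePullback (h : IsTT V k) (hM : IsConformal M) :
    ConeTT (conformalOpens M V) (conePullback M k) where
  smooth A B := ContDiffOn.sum fun γ _ => ContDiffOn.sum fun δ _ => contDiffOn_const.mul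
    ((h.smooth γ δ).comp ((contDiffOn_conformalMap M).mono fun _ hx => hx.1) fun _ hx => hx.2)
  symm x hx A B := by
    simp only [conePullback]
    rw [Finset.sum_comm]
    refine Finset.sum_congr rfl fun γ _ => Finset.sum_congr rfl fun δ _ => ?_
    rw [h.symm _ (conformalMap_mem hM hx) γ δ]
    ring
  transverse x hx B := by
    have h1 := h.transverse _ (conformalMap_mem hM hx)
    have h5 : M.mulVec (toCone x) (Fin.last 5) ≠ 0 := hx.1.1
    simp only [xdot] at h1
    have h2 : ∀ γ : Fin 5, ∑ A, M γ.castSucc A * toCone x A =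
        M.mulVec (toCone x) (Fin.last 5) * ofCone (M.mulVec (toCone x)) γ := fun γ =>
      (congrFun (last_smul_ofCone h5) γ).symm
    calc ∑ A, toCone x A * conePullback M k A B (toCone x)
        = ∑ δ : Fin 5, ∑ γ : Fin 5, (∑ A, M γ.castSucc A * toCone x A) *
            (M δ.castSucc B * k γ δ (ofCone (M.mulVec (toCone x)))) := by
          simp only [conePullback, Finset.mul_sum, Finset.sum_mul]
          rw [Finset.sum_comm]
          simp only [Finset.sum_comm (s := (Finset.univ : Finset (Fin 6)))]
          rw [Finset.sum_comm]
          refine Finset.sum_congr rfl fun _ _ => Finset.sum_congr rfl fun _ _ =>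
            Finset.sum_congr rfl fun _ _ => ?_
          ring
      _ = ∑ δ : Fin 5, M.mulVec (toCone x) (Fin.last 5) * M δ.castSucc B *
            ∑ γ : Fin 5, ofCone (M.mulVec (toCone x)) γ *
              k γ δ (ofCone (M.mulVec (toCone x))) := by
          simp only [h2, Finset.mul_sum]
          refine Finset.sum_congr rfl fun _ _ => Finset.sum_congr rfl fun _ _ => ?_
          ring
      _ = 0 := by simp only [h1, mul_zero, Finset.sum_const_zero]
  traceless x hx := by
    have h1 := h.traceless _ (conformalMap_mem hM hx)
    simp only [trace] at h1
    calc ∑ A, eta6 A * conePullback M k A A (toCone x)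
        = ∑ γ : Fin 5, ∑ δ : Fin 5, (∑ A, eta6 A * (M γ.castSucc A * M δ.castSucc A)) *
            k γ δ (ofCone (M.mulVec (toCone x))) := by
          simp only [conePullback, Finset.mul_sum, Finset.sum_mul]
          rw [Finset.sum_comm]
          refine Finset.sum_congr rfl fun _ _ => ?_
          rw [Finset.sum_comm]
          refine Finset.sum_congr rfl fun _ _ => Finset.sum_congr rfl fun _ _ => ?_
          ring
      _ = ∑ γ : Fin 5, eta5 γ * k γ γ (ofCone (M.mulVec (toCone x))) := by
          simp only [hM.sum_mul, Fin.castSucc_inj]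
          refine Finset.sum_congr rfl fun γ _ => ?_
          rw [Finset.sum_eq_single γ]
          · rw [if_pos rfl]
            congr 1
            fin_cases γ <;> rfl
          · intro δ _ hδ
            rw [if_neg hδ.symm, zero_mul]
          · simp
      _ = 0 := h1

end IsTT

/-- The action of a matrix on six-dimensional space, followed by the projection to the ambient space
of de Sitter space. -/
def projMul (M : Matrix (Fin 6) (Fin 6) ℝ) : (Fin 6 → ℝ) →L[ℝ] (Fin 5 → ℝ) :=
  proj5.comp (LinearMap.toContinuousLinearMap M.mulVecLin)

theorem projMul_apply (M : Matrix (Fin 6) (Fin 6) ℝ) (u : Fin 6 → ℝ) :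
    projMul M u = proj5 (M.mulVec u) := rfl

theorem IsConformal.isCoisometry_projMul {M : Matrix (Fin 6) (Fin 6) ℝ} (hM : IsConformal M) :
    Fld.IsCoisometry (projMul M) eta6 eta5 := by
  intro j k
  simp only [projMul_apply, proj5_apply, Matrix.mulVec_single_one, Matrix.col_apply, hM.sum_mul, Fin.castSucc_inj]
  congr 1
  fin_cases j <;> rfl

/-- The part of six-dimensional space that is mapped into the cone over `V`, with positive last
coordinate. -/
def preimageOpens (M : Matrix (Fin 6) (Fin 6) ℝ) (V : Opens (Fin 5 → ℝ)) : Opens (Fin 6 → ℝ) :=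
  ⟨projMul M ⁻¹' coneOver V ∩ {u | 0 < M.mulVec u (Fin.last 5)},
    ((coneOver V).2.preimage (projMul M).continuous).inter (isOpen_lt continuous_const
      ((continuous_apply _).comp (LinearMap.toContinuousLinearMap M.mulVecLin).continuous))⟩

theorem projMul_mem {M : Matrix (Fin 6) (Fin 6) ℝ} {V : Opens (Fin 5 → ℝ)} :
    ∀ u ∈ preimageOpens M V, projMul M u ∈ coneOver V := fun _ hu => hu.1

/-! ### Conformal invariance modulo gauge terms -/

namespace Fld

variable {Ω : Opens (Fin 6 → ℝ)}

/-- The gauge form of the remainder in the decomposition of a transverse and traceless field. -/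
theorem remainder_eq {F κ ξ σ χ : Fld Ω} (hpos : ∀ u ∈ Ω, 0 < u (Fin.last 5))
    (hI : I eta6 F = 0) (hT : T eta6 F = 0) (hκI : I eta6 κ = 0) (hκT : T eta6 κ = 0)
    (hξz : Nz eta6 ξ = ξ) (hξI : I eta6 ξ = 0)
    (hσz : Nz eta6 σ = 0) (h : F = κ + (2 : ℝ) • X eta6 ξ + X eta6 (X eta6 σ) + Q eta6 χ) :
    F = κ + (Q eta6 χ - X eta6 (I eta6 χ) + (1 / 2 : ℝ) • X eta6 (X eta6 (T eta6 χ))) := by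
  have hIσ : I eta6 σ = 0 := I_eq_zero eta6 hσz
  have hTσ : T eta6 σ = 0 := T_eq_zero eta6 hσz
  have hTξ : T eta6 ξ = 0 := T_eq_zero_of_Nz eta6 hξz
  -- I and T annihilate F and κ, so applying them to the decomposition and cancelling Q expresses ξ
  -- and σ through χ.
  have h1 : I eta6 χ = -((2 : ℝ) • ξ) - (2 : ℝ) • X eta6 σ := by
    rw [← sub_eq_zero]
    refine Q_injective hpos ?_
    have h2 := congrArg (I eta6) h
    simp [hI, hκI, hξI, hIσ] at h2 ⊢
    rw [eq_neg_of_add_eq_zero_right h2.symm]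
    module
  have h3 : T eta6 χ = -((2 : ℝ) • σ) := by
    rw [← sub_eq_zero]
    refine Q_injective hpos ?_
    have h2 := congrArg (T eta6) h
    simp [hT, hκT, hξI, hIσ, hTσ, hTξ] at h2 ⊢
    rw [eq_neg_of_add_eq_zero_right h2.symm]
    module
  rw [h1, h3, h]
  simp only [map_sub, map_neg, map_smul]
  module

end Fld

namespace IsTT

open Fld

variable {V : Opens (Fin 5 → ℝ)} {k : Tensor2} {M : Matrix (Fin 6) (Fin 6) ℝ}

/-- The value of `bach` along a ray through a point at which the equation holds. -/
theorem bach_smul_eq (h : IsTT V k) {y : Fin 5 → ℝ} (hy : y ∈ (V : Set (Fin 5 → ℝ)) ∩ deSitter)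
    (heq : ∀ α β, conformalOperator k α β y = 0) {t : ℝ} (ht : 0 < t) : ∃ e, ∀ w,
      bach eta5 h.ext (t • y, w) = e * (bil eta5 w w + bil eta5 y w ^ 2) := by
  have hy' := inter_deSitter_subset_coneOver V hy
  -- The equation at y gives the factor −(1/6) □DDκ, and bach κ has degree −4 along the ray.
  refine ⟨-(1 / 6) * (Fld.box eta5 (D eta5 (D eta5 h.ext)) (y, 0)) * (t ^ 4)⁻¹, fun w => ?_⟩
  have h1 := (h.conformalOperator_eq_zero_iff hy).1 heq w
  have h2 := pow_mul_smul_fst eta5 (fun u hu s hs => smul_mem_coneOver hu hs) 4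
    (f := bach eta5 h.ext) (by rw [N_bach eta5 h.N_ext]; norm_num) hy' w ht
  have h3 : Fld.box eta5 (D eta5 (D eta5 h.ext)) (y, w) =
      Fld.box eta5 (D eta5 (D eta5 h.ext)) (y, 0) :=
    eq_of_Nz_eq_zero eta5 (by simp [h.Nz_ext]; module) y w
  simp only [coe_add_apply, coe_smul_apply, thetaMul, Z_apply, X_apply, h3, ← h2] at h1
  have h4 := (pow_pos ht 4).ne'
  field_simp
  linear_combination 6 * h1

/-- The linear pull-back of the homogeneous extension of `k` to six-dimensional space. -/
def pullExt (h : IsTT V k) (M : Matrix (Fin 6) (Fin 6) ℝ) : Fld (preimageOpens M V) :=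
  pull (projMul M) projMul_mem h.ext

/-- The extension has degree zero and λ > 0, so its value at π M(x, 1) = λ y is its value at y. -/
theorem pullExt_toCone (h : IsTT V k) (hM : IsConformal M) {x : Fin 5 → ℝ} (hx : x ∈ deSitter)
    (hx' : toCone x ∈ preimageOpens M V) (z : Fin 6 → ℝ) :
    h.pullExt M (toCone x, z) = ∑ A, ∑ B, z A * (z B * conePullback M k A B (toCone x)) := by
  have hnorm : normalize (projMul M (toCone x)) = ofCone (M.mulVec (toCone x)) := by
    rw [projMul_apply, normalize_proj5 _ hx'.2]
    rw [hM.bil_mulVec, bil_toCone hx]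
  rw [pullExt, pull_apply _ _ _ (p := (toCone x, z)) hx',
    h.ext_apply (p := (projMul M (toCone x), projMul M z)) hx'.1, hnorm]
  have hcomm : ∀ f : Fin 6 → Fin 6 → Fin 5 → Fin 5 → ℝ,
      ∑ A, ∑ B, ∑ γ, ∑ δ, f A B γ δ = ∑ γ, ∑ δ, ∑ A, ∑ B, f A B γ δ := fun f => by
    rw [Finset.sum_congr rfl fun A _ => Finset.sum_comm, Finset.sum_comm]
    refine Finset.sum_congr rfl fun γ _ => ?_
    rw [Finset.sum_congr rfl fun A _ => Finset.sum_comm, Finset.sum_comm]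
  simp only [conePullback, Finset.mul_sum]
  rw [hcomm]
  refine Finset.sum_congr rfl fun γ _ => Finset.sum_congr rfl fun δ _ => ?_
  rw [projMul_apply, proj5_apply, proj5_apply, ← mul_assoc, Matrix.mulVec, Matrix.mulVec, dotProduct,
    dotProduct, Finset.sum_mul_sum, Finset.sum_mul]
  refine Finset.sum_congr rfl fun A _ => ?_
  rw [Finset.sum_mul]
  refine Finset.sum_congr rfl fun B _ => ?_
  ring

theorem N_pullExt (h : IsTT V k) : N eta6 (h.pullExt M) = 0 := by
  rw [pullExt, N_pull _ _ eta6 eta5, h.N_ext, map_zero]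

theorem Nz_pullExt (h : IsTT V k) : Nz eta6 (h.pullExt M) = (2 : ℝ) • h.pullExt M := by
  rw [pullExt, Nz_pull _ _ eta6 eta5, h.Nz_ext, map_smul]

theorem I_pullExt (h : IsTT V k) : I eta6 (h.pullExt M) = 0 := by
  rw [pullExt, I_pull _ _ eta6 eta5, h.I_ext, map_zero]

theorem T_pullExt (h : IsTT V k) (hM : IsConformal M) : T eta6 (h.pullExt M) = 0 := by
  rw [pullExt, T_pull _ hM.isCoisometry_projMul, h.T_ext, map_zero]

theorem toCone_mem_preimageOpens (hM : IsConformal M) {x : Fin 5 → ℝ}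
    (hx : x ∈ (conformalOpens M V : Set (Fin 5 → ℝ)) ∩ deSitter)
    (hpos : 0 < M.mulVec (toCone x) (Fin.last 5)) : toCone x ∈ preimageOpens M V :=
  ⟨by
    rw [mem_preimage, projMul_apply, ← last_smul_ofCone hpos.ne']
    exact smul_mem_coneOver (inter_deSitter_subset_coneOver V (conformalMap_mem hM hx)) hpos, hpos⟩

/-- The transformed field and the original one have the same `bach`, up to gauge terms. -/
theorem exists_bach_eq (h : IsTT V k) (hM : IsConformal M) {x : Fin 5 → ℝ}
    (hx : x ∈ (conformalOpens M V : Set (Fin 5 → ℝ)) ∩ deSitter)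
    (hpos : 0 < M.mulVec (toCone x) (Fin.last 5)) : ∃ e : ℝ, ∀ z, bil eta6 (toCone x) z = 0 →
      bach eta5 h.ext (projMul M (toCone x), projMul M z) =
        bach eta5 (h.coneTT_conePullback hM).isTT.ext (x, proj5 z) + e * bil eta6 z z := by
  have hc := h.coneTT_conePullback hM
  have hx₀ := toCone_mem_preimageOpens hM hx hpos
  obtain ⟨Ω, hid, hπ, χ, hxΩ, hΩpos, hχN, hχz, hdec⟩ := hc.exists_decomposition
    (h.N_pullExt (M := M)) h.Nz_pullExt (fun x hx hx' z => h.pullExt_toCone hM hx.2 hx' z) hx hx₀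
  have hF := remainder_eq hΩpos
    (by rw [I_pull _ _ eta6 eta6, h.I_pullExt, map_zero])
    (by rw [T_pull _ (isCoisometry_id eta6), h.T_pullExt hM, map_zero])
    (by rw [I_pull _ _ eta6 eta5, hc.isTT.I_ext, map_zero])
    (by rw [T_pull _ isCoisometry_proj5, hc.isTT.T_ext, map_zero])
    (by rw [Nz_pull _ _ eta6 eta5, hc.Nz_mixed]) (by rw [I_pull _ _ eta6 eta5, hc.I_mixed, map_zero])
    (by rw [Nz_pull _ _ eta6 eta5, hc.Nz_scalar, map_zero]) hdec
  obtain ⟨a, b, c, hcz, hgauge⟩ := bach_gauge eta6 hχN hχz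
  have hb := congrArg (bach eta6) hF
  rw [bach_add, hgauge, bach_pull _ (isCoisometry_id eta6), pullExt,
    bach_pull _ hM.isCoisometry_projMul, bach_pull _ isCoisometry_proj5] at hb
  -- At a point of the cone with u·z = 0 the gauge terms Xa and Qb vanish, leaving c z·z with c
  -- independent of z.
  refine ⟨c (toCone x, 0), fun z hz => ?_⟩
  have hcc : c (toCone x, z) = c (toCone x, 0) := eq_of_Nz_eq_zero eta6 hcz _ _
  have h0 := congrArg (fun f : Fld Ω => f (toCone x, z)) hb
  simp only [coe_add_apply, pull_apply _ _ _ (p := (toCone x, z)) hxΩ, X_apply, Q_apply, Z_apply, hz,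
    bil_toCone hx.2, zero_mul, zero_add, hcc, proj5_toCone] at h0
  rw [ContinuousLinearMap.id_apply, ContinuousLinearMap.id_apply,
    pull_apply _ _ _ (p := (toCone x, z)) hx₀] at h0
  rw [h0, mul_comm (c _)]

/-- By `bach_add_trace_eq_zero` it suffices that bach of the new extension is a multiple of θ at x.
It differs from bach of the old one by a multiple of z·z, and the old one is a multiple of θ at the
image point. -/
theorem conformalOperator_conePullback_of_pos (h : IsTT V k) (hM : IsConformal M)
    (heq : ∀ y ∈ (V : Set (Fin 5 → ℝ)) ∩ deSitter, ∀ α β, conformalOperator k α β y = 0)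
    {x : Fin 5 → ℝ} (hx : x ∈ (conformalOpens M V : Set (Fin 5 → ℝ)) ∩ deSitter)
    (hpos : 0 < M.mulVec (toCone x) (Fin.last 5)) (α β : Fin 5) :
    conformalOperator (ambientTensor (conePullback M k)) α β x = 0 := by
  revert α β
  have hc := h.coneTT_conePullback hM
  have hsmul := last_smul_ofCone hpos.ne'
  have hy := conformalMap_mem hM hx
  obtain ⟨e', he'⟩ := h.exists_bach_eq hM hx hpos
  obtain ⟨e, he⟩ := h.bach_smul_eq hy (heq _ hy) hpos
  have hx' := inter_deSitter_subset_coneOver _ hx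
  have hx1 := mem_deSitter_iff.1 hx.2
  rw [hc.isTT.conformalOperator_eq_zero_iff hx]
  refine bach_add_trace_eq_zero hc.isTT.Nz_ext hc.isTT.T_ext hx' hx1 (e - e')
    fun y => ?_
  -- The lift of y orthogonal to (x, 1), for which z·z is θ(y, y) at x.
  let z : Fin 6 → ℝ := Fin.snoc y (-bil eta5 x y)
  have hz : proj5 z = y := by
    ext i
    rw [proj5_apply]
    exact Fin.snoc_castSucc (α := fun _ => ℝ) _ y i
  have hz5 : z (Fin.last 5) = -bil eta5 x y := Fin.snoc_last (α := fun _ => ℝ) _ y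
  have huz : bil eta6 (toCone x) z = 0 := by
    rw [bil_eta6, proj5_toCone, toCone_last, hz, hz5]
    ring
  have hzz : bil eta6 z z = bil eta5 y y + bil eta5 x y ^ 2 := by
    rw [bil_eta6, hz, hz5]
    ring
  have h0 := he' z huz
  rw [hz, hzz] at h0
  rw [projMul_apply, ← hsmul, he] at h0
  -- M preserves orthogonality, so Mz is orthogonal to the ray of the image point. Hence θ there,
  -- evaluated on π(Mz), equals Mz·Mz = z·z.
  have h5 : bil eta5 (ofCone (M.mulVec (toCone x))) (projMul M z) = -M.mulVec z (Fin.last 5) := by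
    have h6 := hM.bil_mulVec (toCone x) z
    rw [huz, bil_eta6, ← hsmul, bil_smul_left, ← mul_add] at h6
    exact eq_neg_of_add_eq_zero_left ((mul_eq_zero.1 h6).resolve_left hpos.ne')
  have h7 : bil eta5 (projMul M z) (projMul M z) + M.mulVec z (Fin.last 5) ^ 2 =
      bil eta5 y y + bil eta5 x y ^ 2 := by
    rw [← hzz, ← hM.bil_mulVec z z, bil_eta6 (M.mulVec z), projMul_apply]
    ring
  rw [h5, neg_sq, h7] at h0
  linear_combination -h0

end IsTT

theorem IsTT.isConformalField {V : Opens (Fin 5 → ℝ)} {k : Tensor2} (h : IsTT V k)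
    (heq : ∀ x ∈ (V : Set (Fin 5 → ℝ)) ∩ deSitter, ∀ α β, conformalOperator k α β x = 0) :
    IsConformalField V k :=
  ⟨h.smooth, h.symm, h.transverse, h.traceless, heq⟩

theorem IsConformalField.isTT {V : Opens (Fin 5 → ℝ)} {k : Tensor2} (h : IsConformalField V k) :
    IsTT V k :=
  ⟨h.smooth, h.symm, h.transverse, h.traceless⟩

/-- The transform and its domain are unchanged under M ↦ −M. This reduces negative λ to positive λ,
the case compatible with extensions that are homogeneous along positive rays. -/
theorem IsConformalField.conformalTransform {V : Opens (Fin 5 → ℝ)} {k : Tensor2}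
    (h : IsConformalField V k) {M : Matrix (Fin 6) (Fin 6) ℝ} (hM : IsConformal M) :
    IsConformalField (conformalOpens M V) (conformalTransform M k) := by
  rw [conformalTransform_eq]
  refine (h.isTT.coneTT_conePullback hM).isTT.isConformalField fun x hx => ?_
  have h5 : M.mulVec (toCone x) (Fin.last 5) ≠ 0 := hx.1.1
  rcases h5.lt_or_gt with h5 | h5
  · rw [← conePullback_neg]
    rw [← conformalOpens_neg] at hx
    refine h.isTT.conformalOperator_conePullback_of_pos hM.neg h.equation hx ?_
    rw [Matrix.neg_mulVec, Pi.neg_apply]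
    exact neg_pos.2 h5
  · exact h.isTT.conformalOperator_conePullback_of_pos hM h.equation hx h5

end SixCone

end

theorem mainTheorem1 :
    -- the tensor field built from a solution of Dirac's system satisfies the equation
    (∀ (U : Set (Fin 6 → ℝ)) (ψ : SixCone.SixTensor), IsOpen U → SixCone.DiracSystem U ψ →
      SixCone.IsConformalField (SixCone.toCone ⁻¹' U) (SixCone.ambientTensor ψ)) ∧
    -- the equation is conformally invariant
    (∀ (M : Matrix (Fin 6) (Fin 6) ℝ) (V : Set (Fin 5 → ℝ)) (k : SixCone.Tensor2),
      SixCone.IsConformal M → IsOpen V → SixCone.IsConformalField V k →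
      SixCone.IsConformalField (SixCone.conformalDomain M V)
        (SixCone.conformalTransform M k)) := by
  refine ⟨fun U ψ hU h => ?_, fun M V k hM hV h => ?_⟩
  · have h' : SixCone.DiracSystem (⟨U, hU⟩ : TopologicalSpace.Opens (Fin 6 → ℝ)) ψ := h
    exact h'.coneTT.isTT.isConformalField fun x hx => h'.conformalOperator_ambientTensor hx
  · have h' : SixCone.IsConformalField (⟨V, hV⟩ : TopologicalSpace.Opens (Fin 5 → ℝ)) k := h
    exact h'.conformalTransform hM
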